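/- **Setting.** "Efficient" means probabilistic polynomial time. Let $(\mathsf{Gen},\mathsf{Enc},\mathsf{Dec},\mathsf{Comp})$ be an order-revealing encryption (ORE) scheme: $\mathsf{Gen}(1^\lambda,1^\ell)$ outputs $(\mathsf{sk},\mathsf{params})$, $\mathsf{Enc}(\mathsf{sk},m)$ encrypts a message $m\in\{0,1\}^\ell$, the deterministic $\mathsf{Dec}(\mathsf{sk},c)$ outputs a message or $\bot$, and the deterministic $\mathsf{Comp}(\mathsf{params},c_0,c_1)$ outputs one of $<,=,>,\bot$; all are efficient, decryption of an encryption of $m$ always gives $m$, and $\mathsf{Comp}$ on encryptions of $m_0,m_1$ always gives the order of $m_0,m_1$. Let $\ell=\ell(\lambda)$ be computable in time polynomial in $\lambda$ (in unary), with $2^{-\ell(\lambda)}$ negligible in $\lambda$, put $N=2^{\ell}$ and identify $\{0,1\}^\ell$ with $[N]=\{1,\dots,N\}$. Let $k=k(\lambda)$ be polynomially bounded and such that every pair $(\mathsf{params},c)$ consisting of parameters output by $\mathsf{Gen}(1^\lambda,1^{\ell})$ and an encryption $c$ under the corresponding key is an instance of size at most $k$. The scheme is *statically single-challenge secure* (for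 plaintext length $\ell(\lambda)$) if for every efficient adversary $\mathcal A$, $|\Pr[W_0]-\Pr[W_1]|$ is negligible in $\lambda$, where $W_b$ is the event that $\mathcal A$ outputs $1$ in this experiment: $\mathcal A(1^\lambda,1^\ell)$ chooses messages $m_1<\dots<m_q$ and $m_L,m_R$ with $m_i<m_L<m_R<m_{i+1}$ for some $i\in[q-1]$; keys are drawn from $\mathsf{Gen}(1^\lambda,1^\ell)$; $\mathcal A$ receives $\mathsf{params}$, encryptions of $m_1,\dots,m_q$, and an encryption of $m_L$ if $b=0$, of $m_R$ if $b=1$; $\mathcal A$ outputs a bit. The class $\mathsf{EncThresh}$ consists, at security parameter $\lambda$, of the concepts $f_{t,r}$ on instances $(\mathsf{params},c)$ of size at most $k(\lambda)$, where $t\in[N+1]$, $r$ is a sequence of coin tosses of $\mathsf{Gen}$, $(\mathsf{sk}^r,\mathsf{params}^r)$ are the keys it yields, and $f_{t,r}(\mathsf{params},c)=1$ if and only if $\mathsf{params}=\mathsf{params}^r$, $\mathsf{Dec}(\mathsf{sk}^r,c)\neq\bot$ and $\mathsf{Dec}(\mathsf{sk}^r,c)<t$. An efficient learner is an efficient algorithm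 that, given $1^\lambda$ and a labeled sample, outputs a description of a hypothesis, together with a deterministic polynomial-time evaluator of described hypotheses. Write ${\rm error}_{\mathcal D}(c,h)=\Pr_{x\sim\mathcal D}[h(x)\ne c(x)]$. For functions $\alpha(n),\xi(n)$, an *efficient $(\alpha,\xi)$-example reidentification scheme* for a concept class $\mathcal C$ is a pair of efficient algorithms: $\mathsf{Gen_{ex}}(1^\lambda,1^n)$ samples a concept $c\in\mathcal C_\lambda$, an associated distribution $\mathcal D$ on instances and an instance $x_0$, and, given these, i.i.d. examples $x_1,\dots,x_n$ from $\mathcal D$; it outputs the labeled sample $S=((x_i,c(x_i)))_{i\le n}$, the labeled junk example $(x_0,c(x_0))$ and a state. $\mathsf{Trace_{ex}}$ gets the state and oracle access to a hypothesis $h$, and outputs an index in $[n]$ or $\bot$. With $S_{-i}$ denoting $S$ with its $i$-th entry replaced by $(x_0,c(x_0))$, it is required that for every efficient learner $L$, every polynomially bounded $n=n(\lambda)\ge1$, and all sufficiently large $\lambda$: * (completeness) $\Pr[{\rm error}_{\mathcal D}(c,h)\le\alpha(n)\ \wedge\ \mathsf{Trace_{ex}}(h)=\bot]\le\xi(n)$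 for $h\gets L(S)$; * (soundness) $\Pr[\mathsf{Trace_{ex}}(h)=i]\le\xi(n)$ for $h\gets L(S_{-i})$, for every $i\in[n]$. A function $f$ on the positive integers is *noticeable* if $f(n)>0$ for all $n\ge1$ and, for some $c$, $f(n)\ge n^{-c}$ for all sufficiently large $n$. **Theorem.** Let $\gamma(n)$ and $\xi(n)$ be noticeable functions, and let the ORE scheme be statically single-challenge secure. Then: 1. There is an efficient $(\alpha=\tfrac12-\gamma,\ \xi)$-example reidentification scheme for $\mathsf{EncThresh}$. 2. Consequently, for every polynomially bounded $n=n(\lambda)\ge1$ and all functions $\beta,\varepsilon,\delta$ of $\lambda$ such that $$\delta<\frac{1-\beta-\xi(n)}{n}-e^{\varepsilon}\,\xi(n)$$ for infinitely many $\lambda$, there is no efficient learner that, for every $\lambda$, is $(\varepsilon,\delta)$-differentially private on samples of $n$ labeled examples (with respect to changing one example) and is a $(\tfrac12-\gamma(n),\beta)$-accurate PAC learner for $\mathsf{EncThresh}$ with $n$ samples, i.e. for every concept $c$ and every distribution $\mathcal D$ on instances its hypothesis has error at most $\tfrac12-\gamma(n)$ with probability at least $1-\beta$. -/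

import Mathlib

noncomputable section

namespace PrivLearn

/-! ### Strings, programs and running time -/

/-- Binary trees (S-expressions). They play the role of bit strings: every input, output, key,
ciphertext, example and hypothesis description is a tree, and its length is the number of nodes. -/
inductive Data : Type
  | nil : Data
  | cons (a b : Data) : Data

namespace Data

def size : Data → ℕ
  | nil => 1
  | cons a b => a.size + b.size + 1

def fst : Data → Data
  | nil => nil
  | cons a _ => a

def snd : Data → Data
  | nil => nil
  | cons _ b => b

def ofBool : Bool → Data
  | false => nil
  | true => cons nil nil

/-- Reading a tree as a truth value: everything but `nil` is true. -/
def toBool : Data → Bool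
  | nil => false
  | cons _ _ => true

def ofList : List Data → Data
  | [] => nil
  | a :: l => cons a (ofList l)

def toList : Data → List Data
  | nil => []
  | cons a b => a :: b.toList

/-- The number `n` in unary, `1ⁿ`. -/
def unary (n : ℕ) : Data := ofList (List.replicate n nil)

def ofBits (l : List Bool) : Data := ofList (l.map ofBool)

end Data

/-- Programs over trees: projections, pairing, composition, branching, an unbounded while loop, and
one call to a Boolean oracle. -/
inductive Code : Type
  | id : Code
  | nil : Code
  | fst : Code
  | snd : Code
  | pair (f g : Code) : Code
  | comp (f g : Code) : Code
  | cond (p f g : Code) : Code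
  | loop (f : Code) : Code
  | query : Code

/-- `c.Runs O x y t`: with oracle `O` and input `x`, the program `c` halts with output `y` after
`t` time units. Every executed instruction costs as much as the size of the tree it is applied to
(so that copying is paid for), and each pass through a loop pays for the size of the current value.
`comp f g` runs `g` first; `cond p f g` runs `f` if `p` returns a non-`nil` value and `g` otherwise;
`loop f` applies `f` as long as the first component of the current value is not `nil`. -/
inductive Code.Runs (O : Data → Bool) : Code → Data → Data → ℕ → Prop
  | id (x : Data) : Runs O Code.id x x x.size
  | nil (x : Data) : Runs O Code.nil x Data.nil x.size
  | fst (x : Data) : Runs O Code.fst x x.fst x.size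
  | snd (x : Data) : Runs O Code.snd x x.snd x.size
  | query (x : Data) : Runs O Code.query x (Data.ofBool (O x)) x.size
  | pair {f g : Code} {x a b : Data} {s t : ℕ} : Runs O f x a s → Runs O g x b t →
      Runs O (Code.pair f g) x (Data.cons a b) (x.size + s + t)
  | comp {f g : Code} {x y z : Data} {s t : ℕ} : Runs O g x y s → Runs O f y z t →
      Runs O (Code.comp f g) x z (x.size + s + t)
  | cond_true {p f g : Code} {x v y : Data} {s t : ℕ} : Runs O p x v s → v.toBool = true →
      Runs O f x y t → Runs O (Code.cond p f g) x y (x.size + s + t)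
  | cond_false {p f g : Code} {x v y : Data} {s t : ℕ} : Runs O p x v s → v.toBool = false →
      Runs O g x y t → Runs O (Code.cond p f g) x y (x.size + s + t)
  | loop_done {f : Code} {x : Data} : x.fst.toBool = false → Runs O (Code.loop f) x x x.size
  | loop_step {f : Code} {x y z : Data} {s t : ℕ} : x.fst.toBool = true → Runs O f x y s →
      Runs O (Code.loop f) y z t → Runs O (Code.loop f) x z (x.size + s + t)

/-- A run is determined by program, oracle and input. -/
theorem Code.Runs.unique {O : Data → Bool} {c : Code} {x y y' : Data} {t t' : ℕ}
    (h : c.Runs O x y t) (h' : c.Runs O x y' t') : y = y' ∧ t = t' := by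
  induction h generalizing y' t' with
  | id x => cases h'; exact ⟨rfl, rfl⟩
  | nil x => cases h'; exact ⟨rfl, rfl⟩
  | fst x => cases h'; exact ⟨rfl, rfl⟩
  | snd x => cases h'; exact ⟨rfl, rfl⟩
  | query x => cases h'; exact ⟨rfl, rfl⟩
  | pair _ _ ih₁ ih₂ =>
    cases h' with
    | pair k₁ k₂ =>
      obtain ⟨rfl, rfl⟩ := ih₁ k₁
      obtain ⟨rfl, rfl⟩ := ih₂ k₂
      exact ⟨rfl, rfl⟩
  | comp _ _ ih₁ ih₂ =>
    cases h' with
    | comp k₁ k₂ =>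
      obtain ⟨rfl, rfl⟩ := ih₁ k₁
      obtain ⟨rfl, rfl⟩ := ih₂ k₂
      exact ⟨rfl, rfl⟩
  | cond_true _ hv _ ih₁ ih₂ =>
    cases h' with
    | cond_true k₁ kv k₂ =>
      obtain ⟨rfl, rfl⟩ := ih₁ k₁
      obtain ⟨rfl, rfl⟩ := ih₂ k₂
      exact ⟨rfl, rfl⟩
    | cond_false k₁ kv k₂ =>
      obtain ⟨rfl, rfl⟩ := ih₁ k₁
      rw [hv] at kv
      cases kv
  | cond_false _ hv _ ih₁ ih₂ =>
    cases h' with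
    | cond_true k₁ kv k₂ =>
      obtain ⟨rfl, rfl⟩ := ih₁ k₁
      rw [hv] at kv
      cases kv
    | cond_false k₁ kv k₂ =>
      obtain ⟨rfl, rfl⟩ := ih₁ k₁
      obtain ⟨rfl, rfl⟩ := ih₂ k₂
      exact ⟨rfl, rfl⟩
  | loop_done hx =>
    cases h' with
    | loop_done _ => exact ⟨rfl, rfl⟩
    | loop_step kx _ _ => rw [hx] at kx; cases kx
  | loop_step hx _ _ ih₁ ih₂ =>
    cases h' with
    | loop_done kx => rw [hx] at kx; cases kx
    | loop_step _ k₁ k₂ =>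
      obtain ⟨rfl, rfl⟩ := ih₁ k₁
      obtain ⟨rfl, rfl⟩ := ih₂ k₂
      exact ⟨rfl, rfl⟩

/-- A deterministic polynomial-time (oracle) algorithm. -/
structure Alg where
  code : Code
  time : Polynomial ℕ
  halts : ∀ (O : Data → Bool) (x : Data), ∃ y t, code.Runs O x y t ∧ t ≤ time.eval x.size

/-- The output of a deterministic algorithm. -/
def Alg.out (A : Alg) (O : Data → Bool) (x : Data) : Data := (A.halts O x).choose

theorem Alg.out_eq_iff (A : Alg) (O : Data → Bool) (x y : Data) :
    A.out O x = y ↔ ∃ t, A.code.Runs O x y t := by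
  obtain ⟨t, h, _⟩ := (A.halts O x).choose_spec
  constructor
  · rintro rfl
    exact ⟨t, h⟩
  · rintro ⟨t', h'⟩
    exact (h.unique h').1

/-- A probabilistic polynomial-time (oracle) algorithm: a deterministic one that gets, besides its
input `x`, polynomially many (in the size of `x`) independent fair coin tosses. -/
structure RandAlg extends Alg where
  coins : Polynomial ℕ

/-- The output on input `x` when the coin tosses are `r`. -/
def RandAlg.onCoins (A : RandAlg) (O : Data → Bool) (x : Data)
    (r : Fin (A.coins.eval x.size) → Bool) : Data :=
  A.out O (Data.cons x (Data.ofBits (List.ofFn r)))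

/-- The output distribution on input `x`. -/
def RandAlg.run (A : RandAlg) (O : Data → Bool) (x : Data) : PMF Data :=
  (PMF.uniformOfFintype (Fin (A.coins.eval x.size) → Bool)).map (A.onCoins O x)

/-- The trivial oracle, with which algorithms without an oracle are run. -/
def noOracle : Data → Bool := fun _ => false

/-! ### Asymptotics and probability -/

def PolyBounded (f : ℕ → ℕ) : Prop := ∃ p : Polynomial ℕ, ∀ s, f s ≤ p.eval s

/-- `f` can be computed in polynomial time, arguments and values being in unary. -/
def UnaryComputable (f : ℕ → ℕ) : Prop :=
  ∃ A : Alg, ∀ s, A.out noOracle (Data.unary s) = Data.unary (f s)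

def Negligible (f : ℕ → ℝ) : Prop :=
  Asymptotics.SuperpolynomialDecay Filter.atTop (fun s : ℕ => (s : ℝ)) f

/-- Noticeable functions are positive and eventually at least an inverse polynomial. -/
def Noticeable (f : ℕ → ℝ) : Prop :=
  (∀ n, 1 ≤ n → 0 < f n) ∧ ∃ c : ℕ, ∀ᶠ n : ℕ in Filter.atTop, 1 / (n : ℝ) ^ c ≤ f n

def prob {Ω : Type} (p : PMF Ω) (T : Set Ω) : ℝ := (p.toOuterMeasure T).toReal

/-- The law of `n` independent samples from `D`. -/
def iid {Ω : Type} (D : PMF Ω) : ℕ → PMF (List Ω)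
  | 0 => PMF.pure []
  | n + 1 => D.bind fun x => (iid D n).map fun xs => x :: xs

/-! ### Learning -/

/-- A sequence of learning problems: instance spaces and sets of concepts. (A concept is a total
function, of which only the values on the instance space matter.) -/
structure ConceptClass where
  inst : ℕ → Set Data
  concepts : ℕ → Set (Data → Bool)

/-- Generalization error of the hypothesis `h` for the target `c` under `D`. -/
def genError (D : PMF Data) (c h : Data → Bool) : ℝ := prob D {x | h x ≠ c x}

def encodeSample (S : List (Data × Bool)) : Data :=
  Data.ofList (S.map fun e => Data.cons e.1 (Data.ofBool e.2))

def decodeExample (d : Data) : Data × Bool := (d.fst, d.snd.toBool)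

def decodeSample (d : Data) : List (Data × Bool) := d.toList.map decodeExample

/-- The sample `xs` labeled by the concept `c`. -/
def labeled (c : Data → Bool) (xs : List Data) : List (Data × Bool) := xs.map fun x => (x, c x)

/-- An efficient (possibly improper) learner: a probabilistic polynomial-time algorithm that outputs
a description `w` of a hypothesis, with a polynomial-time evaluator `(w, x) ↦ h(x)`. -/
structure Learner where
  learn : RandAlg
  eval : Alg

/-- The distribution of the hypothesis learned from the labeled sample `S` at size parameter `s`. -/
def Learner.hyp (L : Learner) (s : ℕ) (S : List (Data × Bool)) : PMF (Data → Bool) :=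
  (L.learn.run noOracle (Data.cons (Data.unary s) (encodeSample S))).map
    fun w x => (L.eval.out noOracle (Data.cons w x)).toBool

/-- `(α, β)`-accurate PAC learning with `n` samples, at size parameter `s`. -/
def Learner.IsPAC (L : Learner) (C : ConceptClass) (s n : ℕ) (α β : ℝ) : Prop :=
  ∀ c ∈ C.concepts s, ∀ D : PMF Data, D.support ⊆ C.inst s →
    1 - β ≤ prob ((iid D n).bind fun xs => L.hyp s (labeled c xs)) {h | genError D c h ≤ α}

/-- `(ε, δ)`-differential privacy for samples of `n` labeled examples, at size parameter `s`. -/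
def Learner.IsDP (L : Learner) (C : ConceptClass) (s n : ℕ) (ε δ : ℝ) : Prop :=
  ∀ S : List (Data × Bool), S.length = n → (∀ e ∈ S, e.1 ∈ C.inst s) →
    ∀ (i : ℕ) (e : Data × Bool), i < n → e.1 ∈ C.inst s → ∀ T : Set (Data → Bool),
      prob (L.hyp s S) T ≤ Real.exp ε * prob (L.hyp s (S.set i e)) T + δ ∧
      prob (L.hyp s (S.set i e)) T ≤ Real.exp ε * prob (L.hyp s S) T + δ

/-- A pair of efficient algorithms. On input `(1ˢ, 1ⁿ)`, `gen` outputs a tuple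
`(key, state, junk, sample)`: the key determines the chosen concept and its distribution through
`concept` and `dist`, the state is handed to `trace`, `junk` is the labeled junk example, and
`sample` is the list of labeled examples. `trace` gets the state as input and the hypothesis as an
oracle. -/
structure ReidScheme where
  gen : RandAlg
  trace : RandAlg
  concept : Data → Data → Bool
  dist : Data → PMF Data

namespace ReidScheme

def genLaw (R : ReidScheme) (s n : ℕ) : PMF Data :=
  R.gen.run noOracle (Data.cons (Data.unary s) (Data.unary n))

def key (o : Data) : Data := o.fst

def state (o : Data) : Data := o.snd.fst

def junk (o : Data) : Data × Bool := decodeExample o.snd.snd.fst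

def sample (o : Data) : List (Data × Bool) := decodeSample o.snd.snd.snd

/-- The sample with example number `i` replaced by the junk example (`i` is counted from `0`). -/
def sampleWithout (i : ℕ) (o : Data) : List (Data × Bool) := (sample o).set i (junk o)

/-- The joint law of key, hypothesis and output of `trace` when `L` gets the sample `S`. -/
def game (R : ReidScheme) (L : Learner) (s n : ℕ) (S : Data → List (Data × Bool)) :
    PMF (Data × (Data → Bool) × Data) :=
  (R.genLaw s n).bind fun o => (L.hyp s (S o)).bind fun h =>
    (R.trace.run h (state o)).map fun z => (key o, h, z)

/-- `trace` identifies example number `i` (counted from `0`) by the output `1^(i+1)`. -/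
def Accuses (z : Data) (i : ℕ) : Prop := z = Data.unary (i + 1)

/-- `R` is an `(α, ξ)`-example reidentification scheme for `C`. -/
structure IsFor (R : ReidScheme) (C : ConceptClass) (α ξ : ℕ → ℝ) : Prop where
  concept_mem : ∀ s n, ∀ o ∈ (R.genLaw s n).support, R.concept (key o) ∈ C.concepts s
  dist_support : ∀ s n, ∀ o ∈ (R.genLaw s n).support, (R.dist (key o)).support ⊆ C.inst s
  junk_mem : ∀ s n, ∀ o ∈ (R.genLaw s n).support,
    (junk o).1 ∈ C.inst s ∧ (junk o).2 = R.concept (key o) (junk o).1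
  /-- Given the concept, its distribution and the junk example, the examples are i.i.d. from the
  distribution, labeled by the concept. -/
  sample_iid : ∀ s n,
    (R.genLaw s n).map (fun o => (key o, junk o, sample o)) =
      ((R.genLaw s n).map fun o => (key o, junk o)).bind fun a =>
        (iid (R.dist a.1) n).map fun xs => (a.1, a.2, labeled (R.concept a.1) xs)
  /-- Every output of `trace` that is not an index of an example counts as a failure. -/
  complete : ∀ (L : Learner) (n : ℕ → ℕ), PolyBounded n → (∀ s, 1 ≤ n s) →
    ∀ᶠ s in Filter.atTop,
      prob (R.game L s (n s) sample)
        {w | genError (R.dist w.1) (R.concept w.1) w.2.1 ≤ α (n s) ∧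
          ∀ i < n s, ¬ Accuses w.2.2 i} ≤ ξ (n s)
  sound : ∀ (L : Learner) (n : ℕ → ℕ), PolyBounded n → (∀ s, 1 ≤ n s) →
    ∀ᶠ s in Filter.atTop, ∀ i < n s,
      prob (R.game L s (n s) (sampleWithout i)) {w | Accuses w.2.2 i} ≤ ξ (n s)

end ReidScheme

/-! ### Order-revealing encryption -/

/-- The plaintext `m`, a string of `ℓ` bits, least significant bit first. -/
def msgBits : ℕ → ℕ → List Bool
  | 0, _ => []
  | ℓ + 1, m => m.bodd :: msgBits ℓ (m / 2)

def encodeMsg (ℓ : ℕ) (m : Fin (2 ^ ℓ)) : Data := Data.ofBits (msgBits ℓ m)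

open Classical in
/-- Every tree that is not a plaintext of length `ℓ` stands for `⊥`. -/
def decodeMsg (ℓ : ℕ) (d : Data) : Option (Fin (2 ^ ℓ)) :=
  if h : ∃ m, encodeMsg ℓ m = d then some h.choose else none

def encodeOrdering : Ordering → Data
  | .lt => Data.unary 1
  | .eq => Data.unary 2
  | .gt => Data.unary 3

/-- The algorithms of an order-revealing encryption scheme: `gen (1ˢ, 1^ℓ) = (sk, params)`,
`enc (sk, m) = c`, `dec (sk, c)` and `comp (params, c₀, c₁)`; together with the correctness
requirements. -/
structure ORE where
  gen : RandAlg
  enc : RandAlg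
  dec : Alg
  comp : Alg
  correct_dec : ∀ (s ℓ : ℕ), ∀ keys ∈ (gen.run noOracle (.cons (.unary s) (.unary ℓ))).support,
    ∀ m : Fin (2 ^ ℓ), ∀ c ∈ (enc.run noOracle (.cons keys.fst (encodeMsg ℓ m))).support,
      dec.out noOracle (.cons keys.fst c) = encodeMsg ℓ m
  correct_comp : ∀ (s ℓ : ℕ), ∀ keys ∈ (gen.run noOracle (.cons (.unary s) (.unary ℓ))).support,
    ∀ m₀ m₁ : Fin (2 ^ ℓ),
    ∀ c₀ ∈ (enc.run noOracle (.cons keys.fst (encodeMsg ℓ m₀))).support,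
    ∀ c₁ ∈ (enc.run noOracle (.cons keys.fst (encodeMsg ℓ m₁))).support,
      comp.out noOracle (.cons keys.snd (.cons c₀ c₁)) = encodeOrdering (compare m₀ m₁)

/-- An efficient adversary: `choose (1ˢ, 1^ℓ) = (state, m_L, m_R, [m₁, …, m_q])`, and
`guess (state, params, [c₁, …, c_q], c*)` is the guess, a bit. -/
structure Adversary where
  choose : RandAlg
  guess : RandAlg

/-- `(m_L, m_R, [m₁, …, m_q])` is a legal challenge: `m₁ < … < m_q`, and
`m_i < m_L < m_R < m_{i+1}` for some `i`. -/
def LegalChallenge (ℓ : ℕ) (d : Data) : Prop :=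
  ∃ (mL mR : Fin (2 ^ ℓ)) (ms : List (Fin (2 ^ ℓ))),
    d = .cons (encodeMsg ℓ mL) (.cons (encodeMsg ℓ mR) (.ofList (ms.map (encodeMsg ℓ)))) ∧
    ms.Pairwise (· < ·) ∧
    ∃ (i : ℕ) (hi : i + 1 < ms.length), ms[i] < mL ∧ mL < mR ∧ mR < ms[i + 1]

namespace ORE

/-- The law of `(sk, params)`. -/
def keyLaw (E : ORE) (s ℓ : ℕ) : PMF Data := E.gen.run noOracle (.cons (.unary s) (.unary ℓ))

/-- The law of an encryption of the encoded message `m`. -/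
def encrypt (E : ORE) (sk m : Data) : PMF Data := E.enc.run noOracle (.cons sk m)

/-- Independent encryptions of a list of encoded messages. -/
def encryptAll (E : ORE) (sk : Data) : List Data → PMF (List Data)
  | [] => PMF.pure []
  | m :: ms => (E.encrypt sk m).bind fun c => (E.encryptAll sk ms).map fun cs => c :: cs

open Classical in
/-- The single-challenge experiment with challenge bit `b` (`false`: `m_L` is encrypted, `true`:
`m_R`), as the law of the adversary's guess. An illegal challenge counts as the guess `0`. -/
def experiment (E : ORE) (A : Adversary) (s ℓ : ℕ) (b : Bool) : PMF Bool :=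
  (A.choose.run noOracle (.cons (.unary s) (.unary ℓ))).bind fun q =>
    if LegalChallenge ℓ q.snd then
      (E.keyLaw s ℓ).bind fun keys =>
      (E.encryptAll keys.fst q.snd.snd.snd.toList).bind fun cs =>
      (E.encrypt keys.fst (if b then q.snd.snd.fst else q.snd.fst)).bind fun c =>
      (A.guess.run noOracle (.cons q.fst (.cons keys.snd (.cons (.ofList cs) c)))).map Data.toBool
    else PMF.pure false

/-- Static single-challenge security for plaintexts of length `ℓ s` at security parameter `s`. -/
def StaticallySingleChallengeSecure (E : ORE) (ℓ : ℕ → ℕ) : Prop :=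
  ∀ A : Adversary, Negligible fun s =>
    |prob (E.experiment A s (ℓ s) false) {true} - prob (E.experiment A s (ℓ s) true) {true}|

/-- The threshold concept `f_{t,r}`, where `keys = (sk, params)` are the keys that `gen` outputs on
the coin tosses `r`. The string `m : Fin (2 ^ ℓ)` is the plaintext number `m + 1` of
`{1, …, 2 ^ ℓ}`. -/
def thresh (E : ORE) (ℓ : ℕ) (keys : Data) (t : ℕ) : Data → Bool
  | .nil => false
  | .cons params c =>
    open Classical in
    decide (params = keys.snd ∧
      ∃ m, decodeMsg ℓ (E.dec.out noOracle (.cons keys.fst c)) = some m ∧ (m : ℕ) + 1 < t)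

/-- The concept class of encrypted thresholds, with plaintext length `ℓ s` and instances
`(params, c)` of size at most `k s` at security parameter `s`. -/
def encThresh (E : ORE) (ℓ k : ℕ → ℕ) : ConceptClass where
  inst s := {x | x.size ≤ k s}
  concepts s := {f | ∃ r, ∃ t ∈ Set.Icc 1 (2 ^ ℓ s + 1),
    f = E.thresh (ℓ s) (E.gen.onCoins noOracle (.cons (.unary s) (.unary (ℓ s))) r) t}

/-- All pairs `(params, c)` of public parameters and honest ciphertexts have size at most `k s`. -/
def InstancesFit (E : ORE) (ℓ k : ℕ → ℕ) : Prop :=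
  ∀ s, ∀ keys ∈ (E.keyLaw s (ℓ s)).support, ∀ m : Fin (2 ^ ℓ s),
    ∀ c ∈ (E.encrypt keys.fst (encodeMsg (ℓ s) m)).support, (Data.cons keys.snd c).size ≤ k s

end ORE

end PrivLearn

end

/-! The scheme. Messages are independent and uniform, examples are their encryptions, labeled by the
threshold half-way, and the junk example is a fixed instance with label 0. Let `P` be a polynomial
that dominates 1/γ and 1/ξ. The tracer, who knows the keys and the plaintexts, cuts the plaintexts
into K = 2^d intervals ("blocks") by their d leading bits, K being at least 12(n+1)P(n) and
polynomial in n. Let p_v be the probability that the hypothesis h accepts an encryption of a random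
message of block v, and put N = K·P(n). For each v the drop p_v - p_{v+1} is estimated by sampling;
the test of the pair is positive if the estimate is at least 1/N. The first example whose message
lies in a pair with a positive test is accused.

Completeness and soundness. If h has error at most 1/2 - γ, then p_v is on average larger by 2γ
below the threshold than above it, so some neighbouring blocks have a drop of at least 2/N
(`exists_drop`, `exists_drop_of_error`), and by Chebyshev's inequality their test is very likely
positive. On the other hand, a positive test at a pair of blocks that contains none of the learner's
messages is improbable (`prob_positive_unseen_le`). If a test is positive and nobody is accused,
then the pair was such an unseen one (`prob_not_accused_le`). If an example that was withheld from
the learner is accused, then either the pair was unseen, or another message fell into the same pair,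
which has probability at most 3n/K (`prob_accused_le`).

Unseen blocks. It remains to see that p_v and p_{v+1} are close in mean square when the learner has
seen neither block (`eventually_unseen_le`). The mean of (p_v - p_{v+1})² expands into probabilities
F(a, b) that h accepts encryptions of two random messages a, b at once. An adversary against the ORE
scheme can run the learner on the encryptions it asked for, take one of the two test ciphertexts
from among them and use the challenge as the other. This yields differences F(f, m_L) - F(f, m_R),
but only for f not between m_L and m_R. For a, b in one block and c in the other, the combination
2F(a, b) - F(a, c) - F(b, c) can still be obtained: if a < b < c it is 2(F(a, b) - F(a, c)) + (F(c,
a) - F(c, b)), and both brackets belong to legal challenges (`sum_gain_eq`). Averaged over a, b, c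
and over both roles of the two blocks, it is the mean square wanted, up to the probability that
messages coincide (`le_expect_gain_challengeLaw`). Since n(λ) need not be computable, the adversary
draws n, the withheld example and the pair of blocks at random from polynomially many; wrong choices
do almost no harm, because their mean gain is also a mean square up to coincidences.

Privacy. An accurate private learner would have some example accused with probability at least 1 - β
- ξ, hence one fixed example i with probability at least (1 - β - ξ)/n. By privacy the same i is
accused almost as often when it has been replaced by the junk example, against soundness.

Efficiency. `PolyTime` and `Samplable` are type classes closed under the constructions in use, so
that the efficiency of an algorithm is inferred from the expression that defines it. Each such
expression on trees is then identified with its mathematical counterpart by an equation. -/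

noncomputable section

namespace PrivLearn

/-! ### Trees as lists -/

namespace Data

theorem size_pos (d : Data) : 0 < d.size := by cases d <;> simp [size]

@[simp] theorem toList_ofList (l : List Data) : (ofList l).toList = l := by
  induction l <;> simp_all [ofList, toList]

@[simp] theorem ofList_toList (d : Data) : ofList d.toList = d := by
  induction d <;> simp_all [ofList, toList]

@[simp] theorem toBool_ofBool (b : Bool) : (ofBool b).toBool = b := by cases b <;> rfl

theorem size_ofList (l : List Data) : (ofList l).size = (l.map size).sum + l.length + 1 := by
  induction l with
  | nil => rfl
  | cons a l ih => simp only [ofList, size, ih, List.map_cons, List.sum_cons, List.length_cons]; omega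

theorem size_eq (d : Data) : d.size = (d.toList.map size).sum + d.toList.length + 1 := by
  conv_lhs => rw [← ofList_toList d, size_ofList]

theorem size_le_of_mem {d e : Data} (h : e ∈ d.toList) : e.size ≤ d.size := by
  rw [size_eq d]
  have := List.single_le_sum (l := d.toList.map size) (by simp) e.size (List.mem_map_of_mem h)
  omega

theorem length_toList_le (d : Data) : d.toList.length ≤ d.size := by
  rw [size_eq d]; omega

theorem size_fst_le (d : Data) : d.fst.size ≤ d.size := by cases d <;> simp [fst, size]; omega

theorem size_snd_le (d : Data) : d.snd.size ≤ d.size := by cases d <;> simp [snd, size]; omega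

@[simp] theorem fst_cons (a b : Data) : (cons a b).fst = a := rfl
@[simp] theorem snd_cons (a b : Data) : (cons a b).snd = b := rfl
@[simp] theorem toList_nil : nil.toList = [] := rfl
@[simp] theorem toList_cons (a b : Data) : (cons a b).toList = a :: b.toList := rfl
@[simp] theorem ofList_nil : ofList [] = nil := rfl
@[simp] theorem ofList_cons (a : Data) (l : List Data) : ofList (a :: l) = cons a (ofList l) := rfl
@[simp] theorem toBool_nil : nil.toBool = false := rfl
@[simp] theorem toBool_cons (a b : Data) : (cons a b).toBool = true := rfl
@[simp] theorem fst_nil : nil.fst = nil := rfl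
@[simp] theorem snd_nil : nil.snd = nil := rfl

theorem toList_snd (d : Data) : d.snd.toList = d.toList.tail := by cases d <;> rfl

theorem toBool_eq (d : Data) : d.toBool = !d.toList.isEmpty := by cases d <;> rfl

@[simp] theorem length_unary (n : ℕ) : (unary n).toList.length = n := by simp [unary]

theorem unary_succ (n : ℕ) : unary (n + 1) = cons nil (unary n) := rfl

end Data

open Data

/-! ### Polynomial time -/

theorem eval_mono (p : Polynomial ℕ) {a b : ℕ} (h : a ≤ b) : p.eval a ≤ p.eval b := by
  simp only [Polynomial.eval_eq_sum, Polynomial.sum]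
  gcongr

/-- Every instruction pays for the size of its input, so outputs cannot outgrow the running time;
this is what makes polynomial bounds compose. The factor 3 pays for the output of a query, which may
have size 3 on an input of size 1. -/
theorem Code.Runs.size_le {O : Data → Bool} {c : Code} {x y : Data} {t : ℕ}
    (h : c.Runs O x y t) : y.size ≤ 3 * t := by
  induction h with
  | id x => omega
  | nil x => have := size_pos x; simp only [size]; omega
  | fst x => have := size_fst_le x; omega
  | snd x => have := size_snd_le x; omega
  | query x => have := size_pos x; cases O x <;> simp only [ofBool, size] <;> omega
  | @pair _ _ x _ _ _ _ _ _ ih₁ ih₂ => have := size_pos x; simp only [size]; omega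
  | _ => omega

/-- Functions of an oracle and a tree that are computed by a program in polynomial time. -/
class PolyTime (F : (Data → Bool) → Data → Data) : Prop where
  exists_code : ∃ (c : Code) (p : Polynomial ℕ), ∀ O x, ∃ t, c.Runs O x (F O x) t ∧
    t ≤ p.eval x.size

namespace PolyTime

theorem exists_alg (F : (Data → Bool) → Data → Data) [h : PolyTime F] :
    ∃ A : Alg, ∀ O x, A.out O x = F O x := by
  obtain ⟨c, p, h⟩ := h
  refine ⟨⟨c, p, fun O x => ?_⟩, fun O x => ?_⟩
  · obtain ⟨t, ht⟩ := h O x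
    exact ⟨_, t, ht⟩
  · rw [Alg.out_eq_iff]
    obtain ⟨t, ht⟩ := h O x
    exact ⟨t, ht.1⟩

theorem size_le (F : (Data → Bool) → Data → Data) [h : PolyTime F] :
    ∃ p : Polynomial ℕ, ∀ O x, (F O x).size ≤ p.eval x.size := by
  obtain ⟨c, p, h⟩ := h
  refine ⟨3 * p, fun O x => ?_⟩
  obtain ⟨t, ht, hp⟩ := h O x
  have := ht.size_le
  simp only [Polynomial.eval_mul, Polynomial.eval_ofNat]
  omega

instance id : PolyTime fun _ x => x :=
  ⟨.id, .X, fun O x => ⟨_, .id x, by simp⟩⟩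

theorem comp {F G : (Data → Bool) → Data → Data} (hF : PolyTime F) (hG : PolyTime G) :
    PolyTime fun O x => F O (G O x) := by
  obtain ⟨q, hq⟩ := size_le G
  obtain ⟨c, p, hF⟩ := hF
  obtain ⟨c', p', hG⟩ := hG
  refine ⟨.comp c c', .X + p' + p.comp q, fun O x => ?_⟩
  obtain ⟨s, hs, hs'⟩ := hG O x
  obtain ⟨t, ht, ht'⟩ := hF O (G O x)
  refine ⟨_, .comp hs ht, ?_⟩
  have := eval_mono p (hq O x)
  simp only [Polynomial.eval_add, Polynomial.eval_X, Polynomial.eval_comp]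
  omega

variable {f g h : (Data → Bool) → Data → Data}

instance fst [hf : PolyTime f] : PolyTime fun O x => (f O x).fst :=
  comp (F := fun _ x => x.fst) ⟨.fst, .X, fun O x => ⟨_, .fst x, by simp⟩⟩ hf

instance snd [hf : PolyTime f] : PolyTime fun O x => (f O x).snd :=
  comp (F := fun _ x => x.snd) ⟨.snd, .X, fun O x => ⟨_, .snd x, by simp⟩⟩ hf

instance query [hf : PolyTime f] : PolyTime fun O x => ofBool (O (f O x)) :=
  comp (F := fun O x => ofBool (O x)) ⟨.query, .X, fun O x => ⟨_, .query x, by simp⟩⟩ hf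

instance cons [hf : PolyTime f] [hg : PolyTime g] :
    PolyTime fun O x => Data.cons (f O x) (g O x) := by
  obtain ⟨c, p, hf⟩ := hf
  obtain ⟨c', p', hg⟩ := hg
  refine ⟨.pair c c', .X + p + p', fun O x => ?_⟩
  obtain ⟨s, hs, hs'⟩ := hf O x
  obtain ⟨t, ht, ht'⟩ := hg O x
  refine ⟨_, .pair hs ht, ?_⟩
  simp only [Polynomial.eval_add, Polynomial.eval_X]
  omega

instance const (d : Data) : PolyTime fun _ _ => d := by
  induction d with
  | nil => exact ⟨.nil, .X, fun O x => ⟨_, .nil x, by simp⟩⟩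
  | cons a b _ _ => exact cons (f := fun _ _ => a) (g := fun _ _ => b)

instance cond [hf : PolyTime f] [hg : PolyTime g] [hh : PolyTime h] :
    PolyTime fun O x => bif (f O x).toBool then g O x else h O x := by
  obtain ⟨c, p, hf⟩ := hf
  obtain ⟨c', p', hg⟩ := hg
  obtain ⟨c'', p'', hh⟩ := hh
  refine ⟨.cond c c' c'', .X + p + (p' + p''), fun O x => ?_⟩
  obtain ⟨s, hs, hs'⟩ := hf O x
  obtain ⟨t, ht, ht'⟩ := hg O x
  obtain ⟨u, hu, hu'⟩ := hh O x
  simp only [Polynomial.eval_add, Polynomial.eval_X]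
  rcases hb : (f O x).toBool with _ | _
  · exact ⟨_, .cond_false hs hb hu, by omega⟩
  · exact ⟨_, .cond_true hs hb ht, by omega⟩

end PolyTime

/-- The program that behaves without an oracle as `c` does with the trivial one. -/
def Code.withoutOracle : Code → Code
  | .pair f g => .pair f.withoutOracle g.withoutOracle
  | .comp f g => .comp f.withoutOracle g.withoutOracle
  | .cond p f g => .cond p.withoutOracle f.withoutOracle g.withoutOracle
  | .loop f => .loop f.withoutOracle
  | .query => .nil
  | c => c

/-- A query to `noOracle` returns `nil` at the cost of its argument, exactly as the instruction
`nil` does, so even the running time is preserved. The tracer needs this to run the algorithms of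
the ORE scheme while it holds a genuine oracle. -/
theorem Code.Runs.withoutOracle {c : Code} {x y : Data} {t : ℕ} (h : c.Runs noOracle x y t)
    (O : Data → Bool) : c.withoutOracle.Runs O x y t := by
  induction h with
  | id x => exact .id x
  | nil x => exact .nil x
  | fst x => exact .fst x
  | snd x => exact .snd x
  | query x => exact .nil x
  | pair _ _ h₁ h₂ => exact .pair h₁ h₂
  | comp _ _ h₁ h₂ => exact .comp h₁ h₂
  | cond_true _ hv _ h₁ h₂ => exact .cond_true h₁ hv h₂
  | cond_false _ hv _ h₁ h₂ => exact .cond_false h₁ hv h₂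
  | loop_done hx => exact .loop_done hx
  | loop_step hx _ _ h₁ h₂ => exact .loop_step hx h₁ h₂

namespace PolyTime

variable {f g h : (Data → Bool) → Data → Data}

instance alg (A : Alg) [hf : PolyTime f] : PolyTime fun O x => A.out noOracle (f O x) := by
  refine comp (F := fun _ x => A.out noOracle x) ⟨A.code.withoutOracle, A.time, fun O x => ?_⟩ hf
  obtain ⟨y, t, ht, hle⟩ := A.halts noOracle x
  rw [(A.out_eq_iff noOracle x y).2 ⟨t, ht⟩]
  exact ⟨t, ht.withoutOracle O, hle⟩

/-- The first component of the loop value must stay true for exactly `R` passes. A bound on all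
intermediate sizes is assumed separately, because a polynomial-time step, iterated, may produce
values of superpolynomial size. -/
theorem iterate {G Z : (Data → Bool) → Data → Data} (hG : PolyTime G) (hZ : PolyTime Z)
    (R : (Data → Bool) → Data → ℕ) (q : Polynomial ℕ) (hR : ∀ O x, R O x ≤ q.eval x.size)
    (hq : ∀ O x, ∀ k ≤ R O x, ((G O)^[k] (Z O x)).size ≤ q.eval x.size)
    (hlt : ∀ O x, ∀ k < R O x, ((G O)^[k] (Z O x)).fst.toBool = true)
    (hend : ∀ O x, ((G O)^[R O x] (Z O x)).fst.toBool = false) :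
    PolyTime fun O x => (G O)^[R O x] (Z O x) := by
  obtain ⟨c, p, hG⟩ := hG
  obtain ⟨c', p', hZ⟩ := hZ
  have key : ∀ O (S m : ℕ) (y : Data), (∀ k ≤ m, ((G O)^[k] y).size ≤ S) →
      (∀ k < m, ((G O)^[k] y).fst.toBool = true) → ((G O)^[m] y).fst.toBool = false →
      ∃ t, (Code.loop c).Runs O y ((G O)^[m] y) t ∧ t ≤ (m + 1) * (S + p.eval S) := by
    intro O S m
    induction m with
    | zero =>
      intro y hS _ hend
      have := hS 0 le_rfl
      simp only [Function.iterate_zero, _root_.id] at *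
      exact ⟨_, .loop_done hend, by omega⟩
    | succ m ih =>
      intro y hS hlt hend
      obtain ⟨t, ht, hle⟩ := ih (G O y) (fun k hk => hS (k + 1) (by omega))
        (fun k hk => hlt (k + 1) (by omega)) hend
      obtain ⟨s, hs, hs'⟩ := hG O y
      have h0 := hS 0 (by omega)
      simp only [Function.iterate_zero, _root_.id] at h0
      have := eval_mono p h0
      refine ⟨_, .loop_step (hlt 0 (by omega)) hs ht, ?_⟩
      rw [add_mul (m + 1) 1]
      omega
  refine ⟨.comp (.loop c) c', .X + p' + (q + 1) * (q + p.comp q), fun O x => ?_⟩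
  obtain ⟨s, hs, hs'⟩ := hZ O x
  obtain ⟨t, ht, hle⟩ := key O (q.eval x.size) (R O x) (Z O x) (hq O x) (hlt O x) (hend O x)
  refine ⟨_, .comp hs ht, ?_⟩
  have : (R O x + 1) * (q.eval x.size + p.eval (q.eval x.size)) ≤
      (q.eval x.size + 1) * (q.eval x.size + p.eval (q.eval x.size)) := by
    gcongr; exact hR O x
  simp only [Polynomial.eval_add, Polynomial.eval_X, Polynomial.eval_mul, Polynomial.eval_one,
    Polynomial.eval_comp]
  omega

/-- The loop value is `(rest of the list, (accumulator, x))`; the rest itself is the loop flag,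
since a list is `nil` exactly when it is empty. -/
theorem foldl {l z : (Data → Bool) → Data → Data} {g : (Data → Bool) → Data → Data → Data → Data}
    [hl : PolyTime l] [hz : PolyTime z]
    [hg : PolyTime fun O w => g O w.fst w.snd.fst w.snd.snd] (q : Polynomial ℕ)
    (hq : ∀ O x k, (((l O x).toList.take k).foldl (g O x) (z O x)).size ≤ q.eval x.size) :
    PolyTime fun O x => (l O x).toList.foldl (g O x) (z O x) := by
  let G : (Data → Bool) → Data → Data := fun O st =>
    .cons st.fst.snd (.cons (g O st.snd.snd st.snd.fst st.fst.fst) st.snd.snd)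
  have hG : PolyTime G := by
    have : PolyTime fun O st => g O st.snd.snd st.snd.fst st.fst.fst :=
      comp hg (G := fun O st => .cons st.snd.snd (.cons st.snd.fst st.fst.fst)) inferInstance
    exact cons
  obtain ⟨r, hr⟩ := size_le l
  have key : ∀ O x k (w z : Data), k ≤ w.toList.length →
      (G O)^[k] (.cons w (.cons z x)) =
      .cons (ofList (w.toList.drop k)) (.cons ((w.toList.take k).foldl (g O x) z) x) := by
    intro O x k
    induction k with
    | zero => intro w z _; simp
    | succ k ih =>
      intro w z hk
      cases w with
      | nil => simp at hk
      | cons a b => exact ih b (g O x z a) (by simpa using hk)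
  have hit := iterate hG (Z := fun O x => .cons (l O x) (.cons (z O x) x)) inferInstance
    (fun O x => (l O x).toList.length) (r + q + 2 + .X)
    (fun O x => ?_) (fun O x k hk => ?_) (fun O x k hk => ?_) (fun O x => ?_)
  · have := comp (F := fun _ y => y.snd.fst) inferInstance hit
    simpa [key] using this
  · have := hr O x
    have := length_toList_le (l O x)
    simp only [Polynomial.eval_add]
    omega
  · rw [key _ _ _ _ _ hk]
    have h₁ : (ofList ((l O x).toList.drop k)).size ≤ (l O x).size := by
      rw [size_ofList, size_eq (l O x)]
      have : (((l O x).toList.drop k).map size).sum ≤ ((l O x).toList.map size).sum :=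
        ((List.drop_sublist k _).map size).sum_le_sum (by simp)
      rw [List.length_drop]
      omega
    have := hr O x
    have := hq O x k
    simp only [size, Polynomial.eval_add, Polynomial.eval_X, Polynomial.eval_ofNat]
    omega
  · rw [key _ _ _ _ _ hk.le, toBool_eq]
    simp [hk]
  · rw [key _ _ _ _ _ le_rfl, toBool_eq]
    simp

/-- If each step adds at most a polynomial in the size of the original input `x`, then so do all
steps together, and the size hypothesis of `foldl` is automatic. -/
theorem foldl_of_add {l z : (Data → Bool) → Data → Data}
    {g : (Data → Bool) → Data → Data → Data → Data}
    [hl : PolyTime l] [hz : PolyTime z]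
    [hg : PolyTime fun O w => g O w.fst w.snd.fst w.snd.snd] (q : Polynomial ℕ)
    (hq : ∀ O x a, ∀ e ∈ (l O x).toList, (g O x a e).size ≤ a.size + q.eval x.size) :
    PolyTime fun O x => (l O x).toList.foldl (g O x) (z O x) := by
  obtain ⟨r, hr⟩ := size_le l
  obtain ⟨r', hr'⟩ := size_le z
  refine foldl (r' + r * q) fun O x k => ?_
  have key : ∀ (w : List Data) (a : Data), (∀ e ∈ w, e ∈ (l O x).toList) →
      (w.foldl (g O x) a).size ≤ a.size + w.length * q.eval x.size := by
    intro w
    induction w with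
    | nil => intro a _; simp
    | cons e w ih =>
      intro a hw
      have h₁ := ih (g O x a e) fun e he => hw e (by simp [he])
      have h₂ := hq O x a e (hw e (by simp))
      simp only [List.foldl_cons, List.length_cons, add_mul, one_mul]
      omega
  refine (key _ _ fun e he => List.mem_of_mem_take he).trans ?_
  simp only [Polynomial.eval_add, Polynomial.eval_mul]
  gcongr
  · exact hr' O x
  · exact (List.length_take_le' _ _).trans ((length_toList_le _).trans (hr O x))

end PolyTime

end PrivLearn

/-! ### Polynomial-time operations on lists, truth values and unary numbers. -/

namespace PrivLearn

open Data

namespace PolyTime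

variable {f g h l a b : (Data → Bool) → Data → Data} {F P : (Data → Bool) → Data → Data → Data}

instance reverse [hl : PolyTime l] : PolyTime fun O x => ofList (l O x).toList.reverse := by
  have := foldl_of_add (l := l) (z := fun _ _ => Data.nil) (g := fun _ _ a e => .cons e a)
    (((size_le l).choose) + 1) (fun O x a e he => by
      have := (size_le l).choose_spec O x
      have := size_le_of_mem he
      simp only [size, Polynomial.eval_add, Polynomial.eval_one]; omega)
  have key : ∀ (w : List Data) (a : Data),
      w.foldl (fun a e => Data.cons e a) a = ofList (w.reverse ++ a.toList) := by
    intro w; induction w <;> simp_all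
  simpa [key] using this

theorem size_append (a b : Data) : (ofList (a.toList ++ b.toList)).size + 1 = a.size + b.size := by
  rw [size_ofList, size_eq a, size_eq b]
  simp
  omega

instance append [ha : PolyTime a] [hb : PolyTime b] :
    PolyTime fun O x => ofList ((a O x).toList ++ (b O x).toList) := by
  have := foldl_of_add (l := fun O x => ofList (a O x).toList.reverse) (z := b)
    (g := fun _ _ a e => .cons e a)
    (((size_le a).choose) + 1) (fun O x u e he => by
      have := (size_le a).choose_spec O x
      have := size_le_of_mem (d := a O x) (e := e) (by simpa using he)
      simp only [size, Polynomial.eval_add, Polynomial.eval_one]; omega)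
  have key : ∀ (w : List Data) (a : Data),
      w.foldl (fun a e => Data.cons e a) a = ofList (w.reverse ++ a.toList) := by
    intro w; induction w <;> simp_all
  simpa [key] using this

instance flatMap [hl : PolyTime l] [hF : PolyTime fun O w => F O w.fst w.snd] :
    PolyTime fun O x => ofList ((l O x).toList.flatMap fun e => (F O x e).toList) := by
  obtain ⟨r, hr⟩ := size_le l
  obtain ⟨q, hq⟩ := size_le fun O w => F O w.fst w.snd
  have h1 : PolyTime fun O w => F O w.fst w.snd.snd :=
    comp hF (G := fun O w => .cons w.fst w.snd.snd) inferInstance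
  have := foldl_of_add (l := l) (z := fun _ _ => Data.nil)
    (g := fun O x a e => ofList (a.toList ++ (F O x e).toList))
    (q.comp (.X + r + 1)) (fun O x u e he => by
      have h₁ := size_append u (F O x e)
      have h₂ := hq O (.cons x e)
      have h₃ : (Data.cons x e).size ≤ ((.X + r + 1 : Polynomial ℕ)).eval x.size := by
        have := hr O x
        have := size_le_of_mem he
        simp only [size, Polynomial.eval_add, Polynomial.eval_one, Polynomial.eval_X]; omega
      have h₄ := eval_mono q h₃
      simp only [fst_cons, snd_cons] at h₂
      simp only [Polynomial.eval_comp]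
      omega)
  have key : ∀ O x (w : List Data) (a : Data),
      w.foldl (fun a e => ofList (a.toList ++ (F O x e).toList)) a =
        ofList (a.toList ++ w.flatMap fun e => (F O x e).toList) := by
    intro O x w; induction w <;> simp_all
  simpa [key] using this

instance map [hl : PolyTime l] [hF : PolyTime fun O w => F O w.fst w.snd] :
    PolyTime fun O x => ofList ((l O x).toList.map fun e => F O x e) := by
  have : PolyTime fun O x =>
      ofList ((l O x).toList.flatMap fun e => (Data.cons (F O x e) .nil).toList) := inferInstance
  simpa [← List.map_eq_flatMap] using this

instance filter [hl : PolyTime l] [hF : PolyTime fun O w => F O w.fst w.snd] :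
    PolyTime fun O x => ofList ((l O x).toList.filter fun e => (F O x e).toBool) := by
  have : PolyTime fun O x => ofList ((l O x).toList.flatMap fun e =>
      (bif (F O x e).toBool then Data.cons e .nil else .nil).toList) := inferInstance
  convert this using 5 with O x
  generalize (l O x).toList = w
  induction w with
  | nil => rfl
  | cons e w ih => cases h : (F O x e).toBool <;> simp [h, ih]

instance any [hl : PolyTime l] [hF : PolyTime fun O w => F O w.fst w.snd] :
    PolyTime fun O x => ofBool ((l O x).toList.any fun e => (F O x e).toBool) := by
  have : PolyTime fun O x =>
      bif (ofList ((l O x).toList.filter fun e => (F O x e).toBool)).toBool then ofBool true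
        else ofBool false := inferInstance
  convert this using 3 with O x
  rw [toBool_eq, toList_ofList]
  generalize (l O x).toList = w
  induction w with
  | nil => rfl
  | cons e w ih => cases h : (F O x e).toBool <;> simp [h, ih]

instance boolean [hf : PolyTime f] : PolyTime fun O x => ofBool (f O x).toBool := by
  have : PolyTime fun O x => bif (f O x).toBool then ofBool true else ofBool false := inferInstance
  convert this using 3 with O x
  cases (f O x).toBool <;> rfl

instance and [hf : PolyTime f] [hg : PolyTime g] :
    PolyTime fun O x => ofBool ((f O x).toBool && (g O x).toBool) := by
  have : PolyTime fun O x => bif (f O x).toBool then (bif (g O x).toBool then ofBool true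
    else ofBool false) else ofBool false := inferInstance
  convert this using 3 with O x
  cases (f O x).toBool <;> cases (g O x).toBool <;> rfl

instance or [hf : PolyTime f] [hg : PolyTime g] :
    PolyTime fun O x => ofBool ((f O x).toBool || (g O x).toBool) := by
  have : PolyTime fun O x => bif (f O x).toBool then ofBool true else (bif (g O x).toBool
    then ofBool true else ofBool false) := inferInstance
  convert this using 3 with O x
  cases (f O x).toBool <;> cases (g O x).toBool <;> rfl

instance not [hf : PolyTime f] : PolyTime fun O x => ofBool (!(f O x).toBool) := by
  have : PolyTime fun O x => bif (f O x).toBool then ofBool false else ofBool true := inferInstance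
  convert this using 3 with O x
  cases (f O x).toBool <;> rfl

instance xor [hf : PolyTime f] [hg : PolyTime g] :
    PolyTime fun O x => ofBool ((f O x).toBool ^^ (g O x).toBool) := by
  have : PolyTime fun O x => bif (f O x).toBool then ofBool (!(g O x).toBool)
    else bif (g O x).toBool then ofBool true else ofBool false := inferInstance
  convert this using 3 with O x
  cases (f O x).toBool <;> cases (g O x).toBool <;> rfl

instance all [hl : PolyTime l] [hF : PolyTime fun O w => F O w.fst w.snd] :
    PolyTime fun O x => ofBool ((l O x).toList.all fun e => (F O x e).toBool) := by
  have : PolyTime fun O x =>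
      ofBool (!(ofBool ((l O x).toList.any fun e => (ofBool (!(F O x e).toBool)).toBool)).toBool) :=
    inferInstance
  convert this using 4 with O x
  simp [List.not_any_eq_all_not]

instance drop [hl : PolyTime l] [ha : PolyTime a] :
    PolyTime fun O x => ofList ((l O x).toList.drop (a O x).toList.length) := by
  have := foldl_of_add (l := a) (z := l) (g := fun _ _ a _ => a.snd)
    0 (fun O x u e he => by simpa using size_snd_le u)
  have key : ∀ (w : List Data) (u : Data),
      w.foldl (fun u _ => u.snd) u = ofList (u.toList.drop w.length) := by
    intro w; induction w with
    | nil => simp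
    | cons e w ih => intro u; simp [ih, toList_snd, List.drop_tail]
  simpa only [key] using this

instance take [hl : PolyTime l] [ha : PolyTime a] :
    PolyTime fun O x => ofList ((l O x).toList.take (a O x).toList.length) := by
  have : PolyTime fun O x => ofList (ofList ((ofList (l O x).toList.reverse).toList.drop
    (ofList ((l O x).toList.drop (a O x).toList.length)).toList.length)).toList.reverse :=
    inferInstance
  convert this using 4 with O x
  simp only [toList_ofList, List.length_drop, List.reverse_drop, List.reverse_reverse]
  rw [List.length_reverse]
  rcases le_total (a O x).toList.length (l O x).toList.length with h | h
  · congr 1; omega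
  · rw [List.take_of_length_le h, List.take_of_length_le]
    omega

/-- The accumulator is `(unused part of the second list, pairs so far in reverse order)`. -/
instance zip [ha : PolyTime a] [hb : PolyTime b] :
    PolyTime fun O x => ofList (List.zipWith Data.cons (a O x).toList (b O x).toList) := by
  have := foldl_of_add (l := a) (z := fun O x => .cons (b O x) .nil)
    (g := fun _ _ st e => bif st.fst.toBool then
      .cons st.fst.snd (.cons (.cons e st.fst.fst) st.snd) else st)
    ((size_le a).choose + 2) (fun O x st e he => by
      have := (size_le a).choose_spec O x
      have := size_le_of_mem he
      rcases st with _ | ⟨_ | ⟨u, v⟩, w⟩ <;>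
      simp [size]
      omega)
  have key : ∀ (w : List Data) (u v : Data),
      (w.foldl (fun st e => bif st.fst.toBool then
      .cons st.fst.snd (.cons (.cons e st.fst.fst) st.snd) else st) (Data.cons u v)).snd =
        ofList ((List.zipWith Data.cons w u.toList).reverse ++ v.toList) := by
    intro w; induction w with
    | nil => simp
    | cons e w ih =>
      intro u v
      cases u with
      | nil =>
        have h := ih .nil v
        simp only [List.foldl_cons, fst_cons, toBool_nil, cond_false, h]
        simp
      | cons c d =>
        simp only [List.foldl_cons, fst_cons, toBool_cons, cond_true, ih, snd_cons]
        simp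
  have h2 : PolyTime fun O x => ofList (((a O x).toList.foldl (fun st e => bif st.fst.toBool then
      .cons st.fst.snd (.cons (.cons e st.fst.fst) st.snd) else st)
        (Data.cons (b O x) .nil)).snd).toList.reverse := inferInstance
  simpa [key] using h2

instance mulUnary [ha : PolyTime a] [hb : PolyTime b] :
    PolyTime fun O x => unary ((a O x).toList.length * (b O x).toList.length) := by
  have : PolyTime fun O w => b O w.fst := comp hb inferInstance
  have : PolyTime fun O x => ofList ((a O x).toList.flatMap fun _ =>
    (ofList ((b O x).toList.map fun _ => Data.nil)).toList) := inferInstance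
  convert this using 3 with O x
  rw [unary]
  congr 1
  rw [toList_ofList]
  generalize (a O x).toList = w
  induction w with
  | nil => simp
  | cons e w ih =>
    rw [List.flatMap_cons, ← ih, List.length_cons, add_mul, one_mul, add_comm, List.replicate_add]
    simp [List.map_const']

instance addUnary [ha : PolyTime a] [hb : PolyTime b] :
    PolyTime fun O x => unary ((a O x).toList.length + (b O x).toList.length) := by
  have : PolyTime fun O x => ofList ((ofList ((a O x).toList.map fun _ => Data.nil)).toList ++
    (ofList ((b O x).toList.map fun _ => Data.nil)).toList) := inferInstance
  convert this using 3 with O x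
  simp only [unary, List.map_const', toList_ofList, List.replicate_add]

instance polyUnary (p : Polynomial ℕ) [ha : PolyTime a] :
    PolyTime fun O x => unary (p.eval (a O x).toList.length) := by
  induction p using Polynomial.induction_on with
  | C n => simp only [Polynomial.eval_C]; infer_instance
  | add p q hp hq =>
    have := addUnary (a := fun O x => unary (p.eval (a O x).toList.length))
      (b := fun O x => unary (q.eval (a O x).toList.length))
    simpa only [length_unary, ← Polynomial.eval_add] using this
  | monomial n c ih =>
    have := mulUnary (a := fun O x => unary ((Polynomial.C c * .X ^ n).eval (a O x).toList.length))
      (b := a)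
    rw [pow_succ, ← mul_assoc]
    simpa only [length_unary, Polynomial.eval_mul, Polynomial.eval_X] using this

/-- The tree is traversed with a stack of pending subtrees: a `nil` on top is popped, a `cons` is
replaced by its two children, and a counter advances. Each step lowers the total size of the stack
by one, so the stack is empty after exactly `x.size` steps. -/
instance sizeUnary [ha : PolyTime a] : PolyTime fun O x => unary (a O x).size := by
  refine comp (F := fun _ x => unary x.size) ?_ ha
  let G : (Data → Bool) → Data → Data := fun _ st =>
    .cons (bif st.fst.fst.toBool then .cons st.fst.fst.fst (.cons st.fst.fst.snd st.fst.snd)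
      else st.fst.snd) (.cons .nil st.snd)
  have key : ∀ O x k, k ≤ size x → ∃ w, (G O)^[k] (.cons (.cons x .nil) .nil) = .cons w (unary k) ∧
      (w.toList.map size).sum + k = x.size := by
    intro O x k
    induction k with
    | zero => intro _; exact ⟨_, rfl, by simp⟩
    | succ k ih =>
      intro hk
      obtain ⟨w, hw, hs⟩ := ih (by omega)
      rw [Function.iterate_succ_apply', hw]
      refine ⟨_, rfl, ?_⟩
      rcases w with _ | ⟨_ | ⟨u, v⟩, w⟩
      · simp at hs; omega
      · simp [size] at hs ⊢; omega
      · simp [size] at hs ⊢; omega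
  have hsum : ∀ w : List Data, w.length ≤ (w.map size).sum := by
    intro w
    induction w with
    | nil => simp
    | cons e w ih => have := size_pos e; simp; omega
  have hu : ∀ k, (unary k).size = 2 * k + 1 := by
    intro k
    induction k with
    | zero => rfl
    | succ k ih => rw [unary_succ, size, ih, size]; omega
  have hit := iterate (G := G) inferInstance
    (Z := fun _ x => .cons (.cons x .nil) .nil) inferInstance
    (fun _ x => x.size) (4 * .X + 3) (fun O x => by simp; omega) (fun O x k hk => ?_)
    (fun O x k hk => ?_) (fun O x => ?_)
  · have := comp (F := fun _ y => y.snd) inferInstance hit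
    convert this using 3 with O x
    obtain ⟨w, hw, hs⟩ := key O x x.size le_rfl
    rw [hw]; rfl
  · obtain ⟨w, hw, hs⟩ := key O x k hk
    have := hsum w.toList
    have := size_eq w
    rw [hw, size, hu]
    simp only [Polynomial.eval_add, Polynomial.eval_mul, Polynomial.eval_ofNat, Polynomial.eval_X]
    omega
  · obtain ⟨w, hw, hs⟩ := key O x k hk.le
    rw [hw]
    cases w
    · simp at hs; omega
    · rfl
  · obtain ⟨w, hw, hs⟩ := key O x x.size le_rfl
    rw [hw]
    rcases w with _ | ⟨u, v⟩
    · rfl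
    · have := size_pos u
      simp at hs
      omega

end PolyTime

end PrivLearn

namespace PrivLearn

open Data

/-! ### Expectation under a discrete law -/

section Expect

variable {α β : Type}

/-- Real-valued, hence meaningful only for summable integrands; the explicit bounds `C` in the
lemmas below guarantee this. -/
def expect (p : PMF α) (f : α → ℝ) : ℝ := ∑' a, (p a).toReal * f a

open Classical in
/-- The indicator of a proposition. -/
def ind (P : Prop) : ℝ := if P then 1 else 0

theorem ind_true {P : Prop} (h : P) : ind P = 1 := if_pos h
theorem ind_false {P : Prop} (h : ¬ P) : ind P = 0 := if_neg h
theorem ind_nonneg (P : Prop) : 0 ≤ ind P := by unfold ind; split_ifs <;> norm_num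
theorem ind_le_one (P : Prop) : ind P ≤ 1 := by unfold ind; split_ifs <;> norm_num
theorem abs_ind_le (P : Prop) : |ind P| ≤ 1 := by
  rw [abs_of_nonneg (ind_nonneg P)]; exact ind_le_one P
theorem ind_mono {P Q : Prop} (h : P → Q) : ind P ≤ ind Q := by
  by_cases hP : P
  · rw [ind_true hP, ind_true (h hP)]
  · rw [ind_false hP]; exact ind_nonneg Q
theorem ind_and (P Q : Prop) : ind (P ∧ Q) = ind P * ind Q := by
  by_cases hP : P <;> by_cases hQ : Q <;> simp [ind, hP, hQ]
theorem ind_or_le (P Q : Prop) : ind (P ∨ Q) ≤ ind P + ind Q := by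
  by_cases hP : P <;> by_cases hQ : Q <;> simp [ind, hP, hQ]

theorem hasSum_toReal (p : PMF α) : HasSum (fun a => (p a).toReal) 1 := by
  have h : ∑' a, p a ≠ ⊤ := by rw [p.tsum_coe]; simp
  have := (ENNReal.summable_toReal h).hasSum
  rwa [← ENNReal.tsum_toReal_eq fun a => ENNReal.ne_top_of_tsum_ne_top h a, p.tsum_coe] at this

theorem summable_expect (p : PMF α) {f : α → ℝ} {C : ℝ} (hf : ∀ a, |f a| ≤ C) :
    Summable fun a => (p a).toReal * f a := by
  refine Summable.of_norm_bounded ((hasSum_toReal p).summable.mul_right C) fun a => ?_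
  rw [norm_mul, Real.norm_of_nonneg ENNReal.toReal_nonneg]
  exact mul_le_mul_of_nonneg_left (hf a) ENNReal.toReal_nonneg

theorem expect_const (p : PMF α) (c : ℝ) : expect p (fun _ => c) = c := by
  rw [expect, tsum_mul_right, (hasSum_toReal p).tsum_eq, one_mul]

theorem expect_const_mul (p : PMF α) (c : ℝ) (f : α → ℝ) :
    expect p (fun a => c * f a) = c * expect p f := by
  simp only [expect, ← tsum_mul_left]
  congr 1; ext a; ring

theorem expect_mul_const (p : PMF α) (f : α → ℝ) (c : ℝ) :
    expect p (fun a => f a * c) = expect p f * c := by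
  simp only [mul_comm _ c, expect_const_mul]

theorem expect_add (p : PMF α) {f g : α → ℝ} {C C' : ℝ} (hf : ∀ a, |f a| ≤ C)
    (hg : ∀ a, |g a| ≤ C') : expect p (fun a => f a + g a) = expect p f + expect p g := by
  simp only [expect, mul_add]
  exact (summable_expect p hf).tsum_add (summable_expect p hg)

theorem expect_sub (p : PMF α) {f g : α → ℝ} {C C' : ℝ} (hf : ∀ a, |f a| ≤ C)
    (hg : ∀ a, |g a| ≤ C') : expect p (fun a => f a - g a) = expect p f - expect p g := by
  simp only [expect, mul_sub]
  exact (summable_expect p hf).tsum_sub (summable_expect p hg)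

theorem expect_congr (p : PMF α) {f g : α → ℝ} (h : ∀ a ∈ p.support, f a = g a) :
    expect p f = expect p g := by
  refine tsum_congr fun a => ?_
  by_cases ha : a ∈ p.support
  · rw [h a ha]
  · rw [(p.apply_eq_zero_iff a).2 ha]; simp

theorem expect_mono (p : PMF α) {f g : α → ℝ} {C C' : ℝ} (hf : ∀ a, |f a| ≤ C)
    (hg : ∀ a, |g a| ≤ C') (h : ∀ a ∈ p.support, f a ≤ g a) : expect p f ≤ expect p g := by
  refine (summable_expect p hf).tsum_le_tsum (fun a => ?_) (summable_expect p hg)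
  by_cases ha : a ∈ p.support
  · exact mul_le_mul_of_nonneg_left (h a ha) ENNReal.toReal_nonneg
  · rw [(p.apply_eq_zero_iff a).2 ha]; simp

theorem expect_le (p : PMF α) {f : α → ℝ} {C c : ℝ} (hf : ∀ a, |f a| ≤ C)
    (h : ∀ a ∈ p.support, f a ≤ c) : expect p f ≤ c := by
  simpa only [expect_const] using expect_mono p hf (fun _ => le_refl |c|) h

theorem le_expect (p : PMF α) {f : α → ℝ} {C c : ℝ} (hf : ∀ a, |f a| ≤ C)
    (h : ∀ a ∈ p.support, c ≤ f a) : c ≤ expect p f := by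
  simpa only [expect_const] using expect_mono p (fun _ => le_refl |c|) hf h

theorem expect_nonneg (p : PMF α) {f : α → ℝ} (h : ∀ a, 0 ≤ f a) : 0 ≤ expect p f :=
  tsum_nonneg fun a => mul_nonneg ENNReal.toReal_nonneg (h a)

theorem abs_expect_le (p : PMF α) {f : α → ℝ} {C : ℝ} (hf : ∀ a, |f a| ≤ C) :
    |expect p f| ≤ C :=
  abs_le.2 ⟨le_expect p hf fun a _ => (abs_le.1 (hf a)).1,
    expect_le p hf fun a _ => (abs_le.1 (hf a)).2⟩

theorem expect_eq_toReal (p : PMF α) {f : α → ℝ} (h : ∀ a, 0 ≤ f a) :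
    expect p f = (∑' a, p a * ENNReal.ofReal (f a)).toReal := by
  rw [ENNReal.tsum_toReal_eq]
  · exact tsum_congr fun a => by rw [ENNReal.toReal_mul, ENNReal.toReal_ofReal (h a)]
  · exact fun a => ENNReal.mul_ne_top (p.apply_ne_top a) ENNReal.ofReal_ne_top

theorem expect_pure (a : α) (f : α → ℝ) : expect (PMF.pure a) f = f a := by
  rw [expect, tsum_eq_single a]
  · simp
  · intro b hb; simp [hb]

theorem expect_bind (p : PMF α) (k : α → PMF β) {f : β → ℝ} {C : ℝ} (hf : ∀ a, |f a| ≤ C) :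
    expect (p.bind k) f = expect p fun a => expect (k a) f := by
  have hpos : ∀ g : β → ℝ, (∀ b, 0 ≤ g b) → (∀ b, g b ≤ 2 * C) →
      expect (p.bind k) g = expect p fun a => expect (k a) g := by
    intro g hg hC
    rw [expect_eq_toReal _ hg, expect_eq_toReal _ fun a => expect_nonneg _ hg]
    congr 1
    simp only [PMF.bind_apply, ← ENNReal.tsum_mul_right]
    rw [ENNReal.tsum_comm]
    refine tsum_congr fun a => ?_
    rw [expect_eq_toReal _ hg, ENNReal.ofReal_toReal, ← ENNReal.tsum_mul_left]
    · exact tsum_congr fun b => by rw [mul_assoc]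
    · have : ∑' b, k a b * ENNReal.ofReal (g b) ≤ ENNReal.ofReal (2 * C) := by
        calc _ ≤ ∑' b, k a b * ENNReal.ofReal (2 * C) := by
              gcongr with b; exact hC b
          _ = _ := by rw [ENNReal.tsum_mul_right, PMF.tsum_coe, one_mul]
      exact ne_top_of_le_ne_top ENNReal.ofReal_ne_top this
  -- Adding `C` makes the integrand nonnegative, so that sums may be exchanged in `ENNReal`; the
  -- constant is then subtracted again.
  have h := hpos (fun b => f b + C) (fun b => by linarith [(abs_le.1 (hf b)).1])
    (fun b => by linarith [(abs_le.1 (hf b)).2])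
  have hc : ∀ {γ : Type} (_ : γ), |C| ≤ |C| := fun _ => le_rfl
  rw [expect_add _ hf hc, expect_const] at h
  simp only [expect_add _ hf hc, expect_const] at h
  rw [expect_add _ (fun a => abs_expect_le (k a) hf) hc, expect_const] at h
  linarith

theorem expect_map (p : PMF α) (k : α → β) {f : β → ℝ} {C : ℝ} (hf : ∀ a, |f a| ≤ C) :
    expect (p.map k) f = expect p fun a => f (k a) := by
  rw [PMF.map, expect_bind _ _ hf]
  simp only [Function.comp, expect_pure]

theorem expect_comm (p : PMF α) (q : PMF β) {f : α → β → ℝ} {C : ℝ} (hf : ∀ a b, |f a b| ≤ C) :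
    expect p (fun a => expect q (f a)) = expect q fun b => expect p fun a => f a b := by
  have h := congrArg (fun r => expect r fun z : α × β => f z.1 z.2)
    (PMF.bind_comm p q fun a b => PMF.pure (a, b))
  have hf' : ∀ z : α × β, |f z.1 z.2| ≤ C := fun z => hf z.1 z.2
  simpa only [expect_bind _ _ hf', expect_pure] using h

theorem prob_eq_expect (p : PMF α) (T : Set α) : prob p T = expect p fun a => ind (a ∈ T) := by
  rw [prob, PMF.toOuterMeasure_apply, expect_eq_toReal _ fun a => ind_nonneg _]
  congr 1
  refine tsum_congr fun a => ?_
  by_cases h : a ∈ T <;> simp [h, ind]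

theorem prob_nonneg (p : PMF α) (T : Set α) : 0 ≤ prob p T := ENNReal.toReal_nonneg

theorem prob_le_one (p : PMF α) (T : Set α) : prob p T ≤ 1 := by
  rw [prob_eq_expect]
  exact expect_le _ (fun a => abs_ind_le _) fun a _ => ind_le_one _

theorem abs_prob_le (p : PMF α) (T : Set α) : |prob p T| ≤ 1 := by
  rw [abs_of_nonneg (prob_nonneg p T)]; exact prob_le_one p T

theorem prob_bind (p : PMF α) (k : α → PMF β) (T : Set β) :
    prob (p.bind k) T = expect p fun a => prob (k a) T := by
  simp only [prob_eq_expect]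
  exact expect_bind _ _ fun a => abs_ind_le _

theorem prob_map (p : PMF α) (k : α → β) (T : Set β) : prob (p.map k) T = prob p (k ⁻¹' T) := by
  simp only [prob_eq_expect]
  exact expect_map _ _ fun a => abs_ind_le _

theorem prob_pure (a : α) (T : Set α) : prob (PMF.pure a) T = ind (a ∈ T) := by
  rw [prob_eq_expect, expect_pure]

theorem prob_mono (p : PMF α) {T U : Set α} (h : ∀ a ∈ p.support, a ∈ T → a ∈ U) :
    prob p T ≤ prob p U := by
  simp only [prob_eq_expect]
  exact expect_mono _ (fun a => abs_ind_le _) (fun a => abs_ind_le _) fun a ha => ind_mono (h a ha)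

theorem prob_union_le (p : PMF α) (T U : Set α) : prob p (T ∪ U) ≤ prob p T + prob p U := by
  simp only [prob_eq_expect]
  rw [← expect_add _ (fun a => abs_ind_le _) (fun a => abs_ind_le _)]
  refine expect_mono _ (fun a => abs_ind_le _) (C' := 1 + 1) (fun a => ?_) fun a _ => ind_or_le _ _
  exact (abs_add_le _ _).trans (add_le_add (abs_ind_le _) (abs_ind_le _))

theorem prob_singleton (p : PMF α) (a : α) : prob p {a} = (p a).toReal := by
  rw [prob, PMF.toOuterMeasure_apply_singleton]

/-- Markov's inequality for the square. -/
theorem prob_le_expect_sq (p : PMF α) {f : α → ℝ} {C c : ℝ} (hf : ∀ a, |f a| ≤ C) (hc : 0 < c)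
    {T : Set α} (hT : ∀ a ∈ p.support, a ∈ T → c ≤ |f a|) :
    prob p T ≤ expect p (fun a => f a ^ 2) / c ^ 2 := by
  rw [le_div_iff₀ (by positivity), prob_eq_expect, ← expect_mul_const]
  refine expect_mono p (C := 1 * c ^ 2) (C' := C ^ 2) (fun a => ?_) (fun a => ?_) fun a ha => ?_
  · rw [abs_mul, abs_of_nonneg (sq_nonneg c)]
    exact mul_le_mul_of_nonneg_right (abs_ind_le _) (sq_nonneg c)
  · rw [abs_of_nonneg (sq_nonneg _), ← sq_abs]
    exact pow_le_pow_left₀ (abs_nonneg _) (hf a) 2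
  · by_cases h : a ∈ T
    · rw [ind_true h, one_mul, ← sq_abs (f a)]
      exact pow_le_pow_left₀ hc.le (hT a ha h) 2
    · rw [ind_false h, zero_mul]; positivity

theorem bind_congr_support (p : PMF α) {k k' : α → PMF β} (h : ∀ a ∈ p.support, k a = k' a) :
    p.bind k = p.bind k' := by
  ext b
  simp only [PMF.bind_apply]
  refine tsum_congr fun a => ?_
  by_cases ha : a ∈ p.support
  · rw [h a ha]
  · rw [(p.apply_eq_zero_iff a).2 ha]; simp

end Expect

/-! ### Independent sequences and coin tosses -/

section Seq

variable {α β : Type}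

/-- The law of a sequence of independent samples. -/
def seqLaw : List (PMF α) → PMF (List α)
  | [] => PMF.pure []
  | p :: ps => p.bind fun x => (seqLaw ps).map fun xs => x :: xs

theorem iid_eq_seqLaw (D : PMF α) (n : ℕ) : iid D n = seqLaw (List.replicate n D) := by
  induction n with
  | zero => rfl
  | succ n ih => rw [iid, ih]; rfl

theorem seqLaw_append (ps qs : List (PMF α)) :
    seqLaw (ps ++ qs) = (seqLaw ps).bind fun xs => (seqLaw qs).map fun ys => xs ++ ys := by
  induction ps with
  | nil => rw [List.nil_append, seqLaw, PMF.pure_bind]; exact (PMF.map_id _).symm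
  | cons p ps ih =>
    simp only [List.cons_append, seqLaw, ih, PMF.map, Function.comp_def, PMF.bind_bind,
      PMF.pure_bind, List.cons_append]

theorem length_of_mem_support_seqLaw {ps : List (PMF α)} {xs : List α}
    (h : xs ∈ (seqLaw ps).support) : xs.length = ps.length := by
  induction ps generalizing xs with
  | nil => simp [seqLaw] at h; simp [h]
  | cons p ps ih =>
    simp only [seqLaw, PMF.support_bind, PMF.support_map, Set.mem_iUnion, Set.mem_image] at h
    obtain ⟨x, _, ys, hys, rfl⟩ := h
    simp [ih hys]

theorem length_of_mem_support_iid {D : PMF α} {n : ℕ} {xs : List α}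
    (h : xs ∈ (iid D n).support) : xs.length = n := by
  rw [iid_eq_seqLaw] at h
  simpa using length_of_mem_support_seqLaw h

theorem mem_support_of_mem_support_iid {D : PMF α} {n : ℕ} {xs : List α}
    (h : xs ∈ (iid D n).support) : ∀ x ∈ xs, x ∈ D.support := by
  induction n generalizing xs with
  | zero => simp [iid] at h; simp [h]
  | succ n ih =>
    simp only [iid, PMF.support_bind, PMF.support_map, Set.mem_iUnion, Set.mem_image] at h
    obtain ⟨x, hx, ys, hys, rfl⟩ := h
    exact List.forall_mem_cons.2 ⟨hx, ih hys⟩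

theorem seqLaw_map (g : α → β) (ps : List (PMF α)) :
    seqLaw (ps.map fun p => p.map g) = (seqLaw ps).map (List.map g) := by
  induction ps with
  | nil => simp [seqLaw, PMF.pure_map]
  | cons p ps ih =>
    rw [List.map_cons, seqLaw, ih]
    simp only [seqLaw, PMF.map, Function.comp_def, PMF.bind_bind, PMF.pure_bind, List.map_cons]

theorem iid_map (g : α → β) (D : PMF α) (n : ℕ) : iid (D.map g) n = (iid D n).map (List.map g) := by
  rw [iid_eq_seqLaw, iid_eq_seqLaw, ← seqLaw_map, List.map_replicate]

/-- Independent examples may be drawn in two stages: all messages first, then the encryptions,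
independently given the messages. -/
theorem iid_bind (D : PMF α) (k : α → PMF β) (n : ℕ) :
    iid (D.bind k) n = (iid D n).bind fun xs => seqLaw (xs.map k) := by
  induction n with
  | zero => simp [iid, seqLaw]
  | succ n ih =>
    simp only [iid, ih, PMF.map, Function.comp_def, PMF.bind_bind, PMF.pure_bind, List.map_cons,
      seqLaw]
    congr 1; ext1 x
    rw [PMF.bind_comm]

theorem iid_add (D : PMF α) (m n : ℕ) :
    iid D (m + n) = (iid D m).bind fun xs => (iid D n).map fun ys => xs ++ ys := by
  simp only [iid_eq_seqLaw, List.replicate_add, seqLaw_append]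

/-- Unused coin tosses do not matter; this is why a sampler may be handed more tosses than it needs.
-/
theorem map_take_iid (D : PMF α) {m n : ℕ} (h : m ≤ n) : (iid D n).map (List.take m) = iid D m := by
  obtain ⟨k, rfl⟩ := Nat.exists_eq_add_of_le h
  simp only [iid_add, PMF.map, Function.comp_def, PMF.bind_bind, PMF.pure_bind]
  conv_rhs => rw [← PMF.bind_pure (iid D m)]
  refine bind_congr_support _ fun xs hxs => ?_
  rw [← length_of_mem_support_iid hxs]
  simp [PMF.bind_const]

def coin : PMF Bool := PMF.uniformOfFintype Bool

/-- The uniform law on the bit strings of length `n`. -/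
def coins (n : ℕ) : PMF (List Bool) := iid coin n

theorem coins_succ (n : ℕ) :
    coins (n + 1) = coin.bind fun b => (coins n).map fun bs => b :: bs := rfl

theorem length_of_mem_support_coins {n : ℕ} {bs : List Bool} (h : bs ∈ (coins n).support) :
    bs.length = n := length_of_mem_support_iid h

theorem coins_apply {n : ℕ} {bs : List Bool} (h : bs.length = n) : coins n bs = 2⁻¹ ^ n := by
  induction n generalizing bs with
  | zero => rw [List.length_eq_zero_iff] at h; subst h; simp [coins, iid]
  | succ n ih =>
    rcases bs with _ | ⟨b, bs⟩
    · simp at h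
    have hb : ∀ b', ((coins n).map fun bs => b' :: bs) (b :: bs) =
        if b' = b then 2⁻¹ ^ n else 0 := by
      intro b'
      split_ifs with hbb
      · subst hbb
        rw [PMF.map_apply, tsum_eq_single bs, ih (by simpa using h)]
        · simp
        · intro c hc; simp [hc.symm]
      · rw [PMF.map_apply]
        simp [Ne.symm hbb]
    rw [coins_succ, PMF.bind_apply]
    simp only [hb, tsum_fintype, coin, PMF.uniformOfFintype_apply, Fintype.card_bool]
    cases b <;> simp [pow_succ, mul_comm]

theorem map_ofFn_uniform (n : ℕ) :
    (PMF.uniformOfFintype (Fin n → Bool)).map List.ofFn = coins n := by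
  ext bs
  by_cases h : bs.length = n
  · rw [coins_apply h]
    subst h
    rw [PMF.map_apply, tsum_eq_single bs.get]
    · simp [PMF.uniformOfFintype_apply, ENNReal.inv_pow]
    · intro f hf
      rw [if_neg]
      intro hbs
      exact hf (List.ofFn_injective (by rw [← hbs, List.ofFn_get]))
  · rw [(PMF.apply_eq_zero_iff _ _).2, (PMF.apply_eq_zero_iff _ _).2]
    · exact fun hs => h (length_of_mem_support_coins hs)
    · rw [PMF.support_map]
      rintro ⟨f, _, rfl⟩
      simp at h

theorem expect_coin (f : Bool → ℝ) : expect coin f = (f false + f true) / 2 := by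
  rw [expect, tsum_fintype]
  simp [coin, PMF.uniformOfFintype_apply]
  ring

end Seq

end PrivLearn

namespace PrivLearn

open Data

@[simp] theorem toList_ofBits (bs : List Bool) : (ofBits bs).toList = bs.map ofBool := by
  simp [ofBits]

theorem size_ofBits_le (bs : List Bool) : (ofBits bs).size ≤ 4 * bs.length + 1 := by
  induction bs with
  | nil => simp [ofBits, size]
  | cons b bs ih =>
    simp only [ofBits, List.map_cons, ofList, size, List.length_cons] at ih ⊢
    cases b <;> simp only [ofBool, size] <;> omega

/-! ### Efficiently samplable laws -/

/-- Families of laws from which one can sample in polynomial time, given polynomially many coin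
tosses. -/
class Samplable (K : (Data → Bool) → Data → PMF Data) : Prop where
  exists_sampler : ∃ F, PolyTime F ∧ ∃ p : Polynomial ℕ, ∀ O x n, p.eval x.size ≤ n →
    (coins n).map (fun bs => F O (Data.cons x (ofBits bs))) = K O x

namespace Samplable

theorem exists_alg (K : (Data → Bool) → Data → PMF Data) [h : Samplable K] :
    ∃ A : RandAlg, ∀ O x, A.run O x = K O x := by
  obtain ⟨F, hF, p, hK⟩ := h
  obtain ⟨A, hA⟩ := PolyTime.exists_alg F
  refine ⟨⟨A, p⟩, fun O x => ?_⟩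
  rw [← hK O x _ le_rfl, ← map_ofFn_uniform, PMF.map_comp, RandAlg.run]
  congr 1
  ext r
  exact hA _ _

variable {f l : (Data → Bool) → Data → Data} {K K₁ K₂ : (Data → Bool) → Data → PMF Data}
  {K' : (Data → Bool) → Data → Data → PMF Data}

instance pure [hf : PolyTime f] : Samplable fun O x => PMF.pure (f O x) := by
  refine ⟨fun O w => f O w.fst, hf.comp inferInstance, 0, fun O x n _ => ?_⟩
  exact PMF.map_const (coins n) (f O x)

instance bits [hl : PolyTime l] :
    Samplable fun O x => PMF.map ofBits (coins (l O x).toList.length) := by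
  obtain ⟨p, hp⟩ := PolyTime.size_le l
  have : PolyTime fun O w => l O w.fst := hl.comp inferInstance
  refine ⟨fun O w => ofList (w.snd.toList.take (l O w.fst).toList.length), inferInstance,
    p, fun O x n hn => ?_⟩
  rw [coins, coins, ← map_take_iid coin ((length_toList_le _).trans ((hp O x).trans hn)),
    PMF.map_comp]
  congr 1
  ext bs
  simp [ofBits, List.map_take]

instance run (A : RandAlg) [hf : PolyTime f] : Samplable fun O x => A.run noOracle (f O x) := by
  obtain ⟨p, hp⟩ := PolyTime.size_le f
  have : PolyTime fun O w => f O w.fst := hf.comp inferInstance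
  refine ⟨fun O w => A.out noOracle (.cons (f O w.fst) (ofList (w.snd.toList.take
    (unary (A.coins.eval (unary (f O w.fst).size).toList.length)).toList.length))), inferInstance,
    A.coins.comp p, fun O x n hn => ?_⟩
  have hle : A.coins.eval (f O x).size ≤ n := by
    rw [Polynomial.eval_comp] at hn
    exact (eval_mono _ (hp O x)).trans hn
  have h := map_take_iid coin hle
  change _ = coins _ at h
  rw [← map_ofFn_uniform] at h
  rw [RandAlg.run]
  have h' := congrArg (PMF.map fun bs => A.out noOracle (.cons (f O x) (ofBits bs))) h
  rw [PMF.map_comp, PMF.map_comp] at h'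
  refine Eq.trans ?_ h'
  simp [Function.comp_def, ofBits, List.map_take, coins]

/-- The first `p(|x|)` tosses serve the first sampler and all others the second one. The second
sampler's demand depends on the random value it receives, but that value has polynomial size, and
surplus tosses are harmless. -/
instance bind [hK : Samplable K] [hK' : Samplable fun O w => K' O w.fst w.snd] :
    Samplable fun O x => (K O x).bind fun y => K' O x y := by
  obtain ⟨F, hF, p, hp⟩ := hK
  obtain ⟨G, hG, q, hq⟩ := hK'
  obtain ⟨r, hr⟩ := PolyTime.size_le F
  have h₁ : PolyTime fun O w => F O (.cons w.fst (ofList (w.snd.toList.take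
      (unary (p.eval (unary w.fst.size).toList.length)).toList.length))) :=
    hF.comp inferInstance
  have h₂ : PolyTime fun O w => G O (.cons (.cons w.fst (F O (.cons w.fst (ofList (w.snd.toList.take
      (unary (p.eval (unary w.fst.size).toList.length)).toList.length)))))
      (ofList (w.snd.toList.drop
      (unary (p.eval (unary w.fst.size).toList.length)).toList.length))) :=
    hG.comp inferInstance
  let S : Polynomial ℕ := .X + r.comp (.X + (4 * p + 2)) + 1
  refine ⟨_, h₂, p + q.comp S, fun O x n hn => ?_⟩
  simp only [Polynomial.eval_add, Polynomial.eval_comp] at hn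
  obtain ⟨m, rfl⟩ := Nat.exists_eq_add_of_le (Nat.le_of_add_right_le hn)
  have hm : q.eval (S.eval x.size) ≤ m := by omega
  have hF' := hp O x _ le_rfl
  rw [← hF']
  simp only [coins] at *
  simp only [iid_add, PMF.map, PMF.bind_bind, PMF.pure_bind, Function.comp_def]
  refine bind_congr_support _ fun xs hxs => ?_
  have hlen := length_of_mem_support_iid hxs
  have hsize : (Data.cons x (F O (.cons x (ofBits xs)))).size ≤ S.eval x.size := by
    have h := hr O (.cons x (ofBits xs))
    have hx := size_ofBits_le xs
    rw [hlen] at hx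
    have h3 := eval_mono r (show (Data.cons x (ofBits xs)).size ≤ x.size + (4 * p.eval x.size + 2) by
      rw [size]; omega)
    simp only [S, size, Polynomial.eval_add, Polynomial.eval_comp, Polynomial.eval_X,
      Polynomial.eval_mul, Polynomial.eval_ofNat, Polynomial.eval_one]
    omega
  have := hq O (.cons x (F O (.cons x (ofBits xs)))) m ((eval_mono q hsize).trans hm)
  simp only [PMF.map, Function.comp_def, fst_cons, snd_cons] at this
  rw [← this]
  refine congrArg _ (funext fun ys => ?_)
  simp [ofBits, ← hlen]

theorem comp (hK : Samplable K) (hf : PolyTime f) : Samplable fun O x => K O (f O x) := by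
  obtain ⟨F, hF, p, hp⟩ := hK
  obtain ⟨r, hr⟩ := PolyTime.size_le f
  have : PolyTime fun O w => f O w.fst := hf.comp inferInstance
  refine ⟨fun O w => F O (.cons (f O w.fst) w.snd), hF.comp inferInstance, p.comp r,
    fun O x n hn => ?_⟩
  rw [Polynomial.eval_comp] at hn
  exact hp O _ n ((eval_mono p (hr O x)).trans hn)

instance map {g : (Data → Bool) → Data → Data → Data} [hK : Samplable K]
    [hg : PolyTime fun O w => g O w.fst w.snd] : Samplable fun O x => (K O x).map (g O x) :=
  bind (K' := fun O x y => PMF.pure (g O x y))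

/-- The accumulator is `(unused tosses, outputs so far)`. Every entry of the list consumes `M(|x|)`
tosses, which is enough for each of them because no entry is larger than the list. -/
instance seq [hl : PolyTime l] [hK : Samplable fun O w => K' O w.fst w.snd] :
    Samplable fun O x => PMF.map ofList (seqLaw ((l O x).toList.map fun e => K' O x e)) := by
  obtain ⟨F, hF, p, hp⟩ := hK
  obtain ⟨r, hr⟩ := PolyTime.size_le l
  obtain ⟨q, hq⟩ := PolyTime.size_le F
  obtain ⟨M, hM⟩ : ∃ M : Polynomial ℕ, M = p.comp (.X + r + 1) := ⟨_, rfl⟩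
  let u : Data → Data := fun x => unary (M.eval (unary x.size).toList.length)
  -- Each toss is normalized to a bit, so that `v` has bounded size for every accumulator: the size
  -- bound demanded by `foldl_of_add` is over all trees, not only over those that occur.
  let v : Data → Data → Data := fun w y =>
    ofList ((ofList (y.toList.take (u w).toList.length)).toList.map fun e => ofBool e.toBool)
  let g : (Data → Bool) → Data → Data → Data → Data := fun O w st e =>
    .cons (ofList (st.fst.toList.drop (u w.fst).toList.length))
      (ofList (st.snd.toList ++ (Data.cons (F O (.cons (.cons w.fst e) (v w.fst st.fst))) .nil).toList))
  have h₁ : PolyTime fun O w => F O (.cons (.cons w.fst.fst w.snd.snd)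
      (v w.fst.fst w.snd.fst.fst)) := hF.comp inferInstance
  have hg : PolyTime fun O w => g O w.fst w.snd.fst w.snd.snd := inferInstance
  have hl' : PolyTime fun O w => l O w.fst := hl.comp inferInstance
  have hstep : ∀ O x, ∀ e ∈ (l O x).toList, (Data.cons x e).size ≤ (.X + r + 1 : Polynomial ℕ).eval x.size := by
    intro O x e he
    have h₁ := size_le_of_mem he
    have h₂ := hr O x
    simp only [size, Polynomial.eval_add, Polynomial.eval_X, Polynomial.eval_one]
    omega
  have hfold := PolyTime.foldl_of_add (l := fun O w => l O w.fst)
    (z := fun O w => .cons w.snd .nil) (g := g)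
    (q.comp (.X + r + 1 + (4 * M + 2)) + 3) (fun O w st e he => ?_)
  · refine ⟨_, PolyTime.snd (hf := hfold), r * M, fun O x n hn => ?_⟩
    have key : ∀ (w : List Data) (n : ℕ) (a : Data), (∀ e ∈ w, e ∈ (l O x).toList) →
        w.length * M.eval x.size ≤ n → ∀ y, 
        (coins n).map (fun bs => (w.foldl (g O (.cons x y)) (.cons (ofBits bs) a)).snd) =
        (seqLaw (w.map fun e => K' O x e)).map fun ys => ofList (a.toList ++ ys) := by
      intro w
      induction w with
      | nil =>
        intro n a _ _ y
        simp only [List.foldl_nil, snd_cons, List.map_nil, seqLaw, PMF.pure_map, List.append_nil,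
          ofList_toList]
        exact PMF.map_const _ _
      | cons e w ih =>
        intro n a hw hn y
        rw [List.length_cons, add_mul, one_mul] at hn
        obtain ⟨m, rfl⟩ := Nat.exists_eq_add_of_le (Nat.le_of_add_left_le hn)
        have hK := hp O (.cons x e) (M.eval x.size) (by
          rw [hM, Polynomial.eval_comp]
          exact eval_mono p (hstep O x e (hw e (by simp))))
        have ih' := fun a => ih m a (fun e he => hw e (by simp [he])) (by omega) y
        simp only [fst_cons, snd_cons] at hK
        simp only [List.map_cons, seqLaw, ← hK]
        simp only [coins] at *
        simp only [iid_add, PMF.map, PMF.bind_bind, PMF.pure_bind, Function.comp_def] at *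
        refine bind_congr_support _ fun xs hxs => ?_
        have hlen := length_of_mem_support_iid hxs
        have := ih' (ofList (a.toList ++ [F O (.cons (.cons x e) (ofBits xs))]))
        simp only [toList_ofList, List.append_assoc, List.singleton_append] at this
        rw [← this]
        refine congrArg _ (funext fun ys => ?_)
        simp only [List.foldl_cons, g, v, u, fst_cons, snd_cons, length_unary, toList_ofBits,
          List.map_append, toList_cons, toList_nil]
        rw [← hlen]
        simp [ofBits, Function.comp_def]
    have h := key (l O x).toList n .nil (fun _ h => h) ?_
    · rw [← (show _ = PMF.map ofList _ from (h .nil).trans (by simp))]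
      simp only [PMF.map]
      refine bind_congr_support _ fun bs _ => ?_
      simp [g]
    · refine le_trans ?_ hn
      rw [Polynomial.eval_mul]
      gcongr
      exact (length_toList_le _).trans (hr O x)
  · have h₁ : (v w.fst st.fst).size ≤ 4 * M.eval w.fst.size + 1 := by
      have h : v w.fst st.fst = ofBits ((st.fst.toList.take (u w.fst).toList.length).map Data.toBool) := by
        simp [v, ofBits, Function.comp_def]
      rw [h]
      refine (size_ofBits_le _).trans ?_
      have := List.length_take_le (u w.fst).toList.length st.fst.toList
      simp only [u, length_unary] at this ⊢
      rw [List.length_map]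
      omega
    have h₂ := hstep O w.fst e he
    have h₃ := hq O (.cons (.cons w.fst e) (v w.fst st.fst))
    have h₄ : (Data.cons (.cons w.fst e) (v w.fst st.fst)).size ≤
        (.X + r + 1 + (4 * M + 2) : Polynomial ℕ).eval w.size := by
      refine le_trans ?_ (eval_mono _ (size_fst_le w))
      rw [size]
      simp only [Polynomial.eval_add, Polynomial.eval_mul, Polynomial.eval_ofNat] at h₂ ⊢
      omega
    have h₅ := eval_mono q h₄
    have h₆ := PolyTime.size_append st.snd
      (Data.cons (F O (.cons (.cons w.fst e) (v w.fst st.fst))) .nil)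
    have h₇ : (ofList (st.fst.toList.drop (u w.fst).toList.length)).size ≤ st.fst.size := by
      rw [size_ofList, size_eq st.fst]
      have : ((st.fst.toList.drop (u w.fst).toList.length).map size).sum ≤
          (st.fst.toList.map size).sum :=
        ((List.drop_sublist _ _).map size).sum_le_sum (by simp)
      rw [List.length_drop]
      omega
    have h₈ : st.fst.size + st.snd.size ≤ st.size + 1 := by
      cases st <;> simp [size]; omega
    rw [Polynomial.eval_add, Polynomial.eval_comp, Polynomial.eval_ofNat]
    simp only [g]
    rw [size] at h₆ ⊢
    rw [show Data.nil.size = 1 from rfl] at h₆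
    omega

end Samplable

end PrivLearn

namespace PrivLearn

open Data

/-! ### Bit strings and their order -/

/-- The number with the given bits, least significant bit first. -/
def bitsVal : List Bool → ℕ
  | [] => 0
  | b :: bs => b.toNat + 2 * bitsVal bs

theorem bitsVal_lt (bs : List Bool) : bitsVal bs < 2 ^ bs.length := by
  induction bs with
  | nil => simp [bitsVal]
  | cons b bs ih =>
    simp only [bitsVal, List.length_cons, pow_succ]
    cases b <;> simp <;> omega

theorem bitsVal_append (as bs : List Bool) :
    bitsVal (as ++ bs) = bitsVal as + 2 ^ as.length * bitsVal bs := by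
  induction as with
  | nil => simp [bitsVal]
  | cons b as ih => simp only [List.cons_append, bitsVal, ih, List.length_cons, pow_succ]; ring

@[simp] theorem length_msgBits (l m : ℕ) : (msgBits l m).length = l := by
  induction l generalizing m with
  | zero => rfl
  | succ l ih => simp [msgBits, ih]

theorem msgBits_bitsVal (bs : List Bool) : msgBits bs.length (bitsVal bs) = bs := by
  induction bs with
  | nil => rfl
  | cons b bs ih =>
    have h : (b.toNat + 2 * bitsVal bs) / 2 = bitsVal bs := by cases b <;> simp; omega
    simp only [List.length_cons, msgBits, bitsVal, h, ih]
    cases b <;> simp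

theorem bitsVal_msgBits {l m : ℕ} (h : m < 2 ^ l) : bitsVal (msgBits l m) = m := by
  induction l generalizing m with
  | zero => simp at h; simp [msgBits, bitsVal, h]
  | succ l ih =>
    rw [msgBits, bitsVal, ih (by rw [pow_succ] at h; omega)]
    have := Nat.bodd_add_div2 m
    rw [Nat.div2_val] at this
    exact this

theorem bitsVal_injective {as bs : List Bool} (hl : as.length = bs.length)
    (h : bitsVal as = bitsVal bs) : as = bs := by
  rw [← msgBits_bitsVal as, ← msgBits_bitsVal bs, h, hl]

theorem ofBits_injective : Function.Injective ofBits := by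
  intro as bs h
  have := congrArg (fun d => d.toList.map Data.toBool) h
  simpa [Function.comp_def] using this

/-- The plaintext given by a bit string. -/
def msgOf (bs : List Bool) : Fin (2 ^ bs.length) := ⟨bitsVal bs, bitsVal_lt bs⟩

theorem encodeMsg_msgOf (bs : List Bool) : encodeMsg bs.length (msgOf bs) = ofBits bs := by
  rw [encodeMsg, msgOf, msgBits_bitsVal]

theorem encodeMsg_injective (l : ℕ) : Function.Injective (encodeMsg l) := by
  intro a b h
  have h' := ofBits_injective h
  exact Fin.ext (by rw [← bitsVal_msgBits a.2, ← bitsVal_msgBits b.2, h'])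

theorem decodeMsg_encodeMsg (l : ℕ) (m : Fin (2 ^ l)) : decodeMsg l (encodeMsg l m) = some m := by
  have h : ∃ m', encodeMsg l m' = encodeMsg l m := ⟨m, rfl⟩
  rw [decodeMsg, dif_pos h, encodeMsg_injective l h.choose_spec]

/-- The accumulator is `(remaining bits of b, verdict so far)`. The least significant bits come
first, so a later difference overrides the verdict, which then becomes the bit of `b`. -/
def ltStep (st e : Data) : Data :=
  .cons st.fst.snd (bif (ofBool (e.toBool ^^ st.fst.fst.toBool)).toBool then
    ofBool st.fst.fst.toBool else st.snd)

/-- Comparison of bit strings of equal length. -/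
def ltData (a b : Data) : Data := (a.toList.foldl ltStep (.cons b .nil)).snd

instance PolyTime.ltData {f g : (Data → Bool) → Data → Data} [PolyTime f] [PolyTime g] :
    PolyTime fun O x => ltData (f O x) (g O x) := by
  have h : PolyTime fun _ w => ltStep w.snd.fst w.snd.snd := by unfold ltStep; infer_instance
  have := PolyTime.foldl_of_add (l := f) (z := fun O x => .cons (g O x) .nil)
    (g := fun _ _ st e => ltStep st e) 5 (fun O x st e _ => by
    unfold ltStep
    rcases st with _ | ⟨_ | ⟨a, b⟩, c⟩ <;>
    cases e.toBool <;> simp [ofBool, size] <;>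
    cases a.toBool <;> simp [size] <;> omega)
  exact PolyTime.snd (hf := this)

theorem toBool_ltData {as bs : List Bool} (h : as.length = bs.length) :
    (ltData (ofBits as) (ofBits bs)).toBool = decide (bitsVal as < bitsVal bs) := by
  have key : ∀ (as bs : List Bool) (r : Bool), as.length = bs.length →
      ((as.map ofBool).foldl ltStep (.cons (ofBits bs) (ofBool r))).snd =
      ofBool (bif decide (bitsVal as = bitsVal bs) then r else decide (bitsVal as < bitsVal bs)) := by
    intro as
    induction as with
    | nil =>
      intro bs r h
      cases bs with
      | nil => rfl
      | cons => simp at h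
    | cons a as ih =>
      intro bs r h
      rcases bs with _ | ⟨b, bs⟩
      · simp at h
      have := ih bs (bif a ^^ b then b else r) (by simpa using h)
      simp only [ofBits, List.map_cons, List.foldl_cons, ofList_cons, fst_cons, snd_cons, ltStep,
        toBool_ofBool] at this ⊢
      have hb : ∀ c : Bool, (bif c then ofBool b else ofBool r) = ofBool (bif c then b else r) := by
        intro c; cases c <;> rfl
      rw [hb, this]
      congr 1
      have e₁ : bitsVal (a :: as) = a.toNat + 2 * bitsVal as := rfl
      have e₂ : bitsVal (b :: bs) = b.toNat + 2 * bitsVal bs := rfl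
      have hle : a = b → ((bitsVal (a :: as) = bitsVal (b :: bs) ↔ bitsVal as = bitsVal bs) ∧
          (bitsVal (a :: as) < bitsVal (b :: bs) ↔ bitsVal as < bitsVal bs)) := by
        rintro rfl; omega
      have hne : a ≠ b → bitsVal (a :: as) ≠ bitsVal (b :: bs) ∧
          (bitsVal (a :: as) < bitsVal (b :: bs) ↔
          bitsVal as < bitsVal bs ∨ bitsVal as = bitsVal bs ∧ b = true) := by
        rw [e₁, e₂]
        cases a <;> cases b <;> simp <;> omega
      by_cases hab : a = b
      · simp only [(hle hab).1, (hle hab).2]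
        simp [hab]
      · simp only [(hne hab).1, (hne hab).2, decide_false, cond_false]
        clear ih this hb hle hne e₁ e₂ h
        rcases lt_trichotomy (bitsVal as) (bitsVal bs) with h | h | h
        · simp [h, h.ne]
        · cases a <;> cases b <;> simp [h] <;> simp at hab
        · simp [h.ne']
  have := key as bs false h
  rw [show ofBool false = Data.nil from rfl] at this
  rw [ltData, toList_ofBits, this, toBool_ofBool]
  by_cases h : bitsVal as = bitsVal bs <;> simp [h]

def eqData (a b : Data) : Data :=
  ofBool ((ofBool (!(ltData a b).toBool)).toBool && (ofBool (!(ltData b a).toBool)).toBool)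

instance PolyTime.eqData {f g : (Data → Bool) → Data → Data} [PolyTime f] [PolyTime g] :
    PolyTime fun O x => eqData (f O x) (g O x) := by
  unfold PrivLearn.eqData; infer_instance

theorem toBool_eqData {as bs : List Bool} (h : as.length = bs.length) :
    (eqData (ofBits as) (ofBits bs)).toBool = decide (as = bs) := by
  simp only [eqData, toBool_ofBool, toBool_ltData h, toBool_ltData h.symm]
  rw [Bool.eq_iff_iff]
  simp only [Bool.and_eq_true, Bool.not_eq_true', decide_eq_false_iff_not, decide_eq_true_eq]
  constructor
  · intro ⟨h₁, h₂⟩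
    exact bitsVal_injective h (by omega)
  · rintro rfl
    simp

/-! ### The list of all bit strings of a given length -/

/-- The strings come in increasing numerical order, since a bit put in front is the least
significant one. Neighbours in this list are therefore neighbouring blocks. -/
def cells : ℕ → List (List Bool)
  | 0 => [[]]
  | d + 1 => (cells d).flatMap fun c => [false :: c, true :: c]

theorem range_two_mul (n : ℕ) :
    List.range (2 * n) = (List.range n).flatMap fun i => [2 * i, 2 * i + 1] := by
  induction n with
  | zero => rfl
  | succ n ih =>
    rw [Nat.mul_succ, List.range_succ, List.range_succ, ih, List.range_succ]
    simp

theorem cells_eq (d : ℕ) : cells d = (List.range (2 ^ d)).map (msgBits d) := by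
  induction d with
  | zero => rfl
  | succ d ih =>
    rw [cells, ih, pow_succ, mul_comm, range_two_mul, List.map_flatMap, List.flatMap_map]
    congr 1
    ext1 i
    have : (2 * i + 1) / 2 = i := by omega
    simp [msgBits, this]

theorem length_cells (d : ℕ) : (cells d).length = 2 ^ d := by simp [cells_eq]

theorem length_of_mem_cells {d : ℕ} {c : List Bool} (h : c ∈ cells d) : c.length = d := by
  rw [cells_eq, List.mem_map] at h
  obtain ⟨i, _, rfl⟩ := h
  simp

theorem mem_cells {d : ℕ} {c : List Bool} : c ∈ cells d ↔ c.length = d := by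
  refine ⟨length_of_mem_cells, fun h => ?_⟩
  rw [cells_eq, List.mem_map]
  subst h
  exact ⟨bitsVal c, by simpa using bitsVal_lt c, msgBits_bitsVal c⟩

theorem getElem?_cells {d i : ℕ} (h : i < 2 ^ d) : (cells d)[i]? = some (msgBits d i) := by
  simp [cells_eq, h]

def ofLists (l : List (List Bool)) : Data := ofList (l.map ofBits)

@[simp] theorem toList_ofLists (l : List (List Bool)) : (ofLists l).toList = l.map ofBits :=
  toList_ofList _

/-- All bit strings of a length `d` for which `2 ^ d` is about the length of the given list. -/
def cellsData (q : Data) : Data :=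
  q.toList.foldl (fun S _ => bif (ofList (q.toList.drop S.toList.length)).toBool then
    ofList (S.toList.flatMap fun e => (Data.cons (.cons (ofBool false) e)
      (.cons (.cons (ofBool true) e) .nil)).toList) else S) (.cons .nil .nil)

/-- The list of strings doubles in each round as long as it is shorter than `q`, which happens
`Nat.clog 2` times; later rounds leave it unchanged. -/
theorem foldl_cellsData (q w : Data) :
    w.toList.foldl (fun S _ => bif (ofList (q.toList.drop S.toList.length)).toBool then
    ofList (S.toList.flatMap fun e => (Data.cons (.cons (ofBool false) e)
      (.cons (.cons (ofBool true) e) .nil)).toList) else S) (.cons .nil .nil) =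
    ofLists (cells (min w.toList.length (Nat.clog 2 q.toList.length))) := by
  generalize w.toList = w
  induction w using List.reverseRecOn with
  | nil => rfl
  | append_singleton w e ih =>
    rw [List.foldl_append, ih, List.foldl_cons, List.foldl_nil, toBool_eq, toList_ofList,
      toList_ofLists, List.length_map, length_cells]
    have hlt := Nat.lt_clog_iff_pow_lt (b := 2) one_lt_two
      (y := min w.length (Nat.clog 2 q.toList.length)) (x := q.toList.length)
    have hemp : (!(List.drop (2 ^ min w.length (Nat.clog 2 q.toList.length)) q.toList).isEmpty) =
        decide (min w.length (Nat.clog 2 q.toList.length) < Nat.clog 2 q.toList.length) := by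
      rw [Bool.eq_iff_iff]
      simp [← hlt]
    rw [hemp]
    by_cases h : w.length < Nat.clog 2 q.toList.length
    · have h₁ : min w.length (Nat.clog 2 q.toList.length) = w.length := by omega
      have h₂ : min (w ++ [e]).length (Nat.clog 2 q.toList.length) = w.length + 1 := by
        simp; omega
      rw [h₁, h₂, decide_eq_true h, cond_true, cells, ofLists, List.flatMap_map, List.map_flatMap]
      rfl
    · have h₁ : min w.length (Nat.clog 2 q.toList.length) = Nat.clog 2 q.toList.length := by omega
      have h₂ : min (w ++ [e]).length (Nat.clog 2 q.toList.length) =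
          Nat.clog 2 q.toList.length := by
        simp; omega
      rw [h₁, h₂]
      simp

theorem cellsData_eq (q : Data) : cellsData q = ofLists (cells (Nat.clog 2 q.toList.length)) := by
  rw [cellsData, foldl_cellsData, min_eq_right]
  exact Nat.clog_le_of_le_pow Nat.lt_two_pow_self.le

theorem two_pow_clog_le (n : ℕ) : 2 ^ Nat.clog 2 n ≤ 2 * n + 1 := by
  rcases le_or_gt n 1 with h | h
  · rw [Nat.clog_of_right_le_one h]; omega
  · have h1 := Nat.pow_pred_clog_lt_self one_lt_two h
    have h2 : 0 < Nat.clog 2 n := Nat.clog_pos one_lt_two h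
    have h3 : 2 ^ Nat.clog 2 n = 2 * 2 ^ (Nat.clog 2 n).pred := by
      rw [← pow_succ']; congr 1; exact (Nat.succ_pred_eq_of_pos h2).symm
    omega

theorem size_ofLists_le {l : List (List Bool)} {k : ℕ} (h : ∀ c ∈ l, c.length ≤ k) :
    (ofLists l).size ≤ l.length * (4 * k + 2) + 1 := by
  induction l with
  | nil => simp [ofLists, size]
  | cons c l ih =>
    have h₁ := ih fun c hc => h c (by simp [hc])
    have h₂ := size_ofBits_le c
    have h₃ := h c (by simp)
    simp only [ofLists, List.map_cons, ofList_cons, size, List.length_cons, add_mul] at h₁ ⊢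
    omega

instance PolyTime.cellsData {f : (Data → Bool) → Data → Data} [hf : PolyTime f] :
    PolyTime fun O x => cellsData (f O x) := by
  refine comp (F := fun _ q => PrivLearn.cellsData q) ?_ hf
  refine foldl (l := fun _ q => q) (z := fun _ _ => .cons .nil .nil)
    (g := fun _ q S _ => bif (ofList (q.toList.drop S.toList.length)).toBool then
    ofList (S.toList.flatMap fun e => (Data.cons (.cons (ofBool false) e)
      (.cons (.cons (ofBool true) e) .nil)).toList) else S)
    ((2 * .X + 1) * (4 * .X + 2) + 1) fun _ q k => ?_
  have h := foldl_cellsData q (ofList (q.toList.take k))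
  rw [toList_ofList] at h
  rw [h]
  have hq := length_toList_le q
  have hd : Nat.clog 2 q.toList.length ≤ q.size :=
    (Nat.clog_le_of_le_pow Nat.lt_two_pow_self.le).trans hq
  refine (size_ofLists_le (k := q.size) fun c hc => ?_).trans ?_
  · rw [length_of_mem_cells hc]
    omega
  · simp only [Polynomial.eval_add, Polynomial.eval_mul, Polynomial.eval_ofNat, Polynomial.eval_X,
      Polynomial.eval_one, length_cells]
    gcongr
    calc _ ≤ 2 ^ Nat.clog 2 q.toList.length := Nat.pow_le_pow_right (by norm_num) (min_le_right _ _)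
      _ ≤ 2 * q.toList.length + 1 := two_pow_clog_le _
      _ ≤ _ := by omega

/-! ### Sorting -/

def insertBits (m : List Bool) (l : List (List Bool)) : List (List Bool) :=
  l.filter (fun c => decide (bitsVal c < bitsVal m)) ++
    m :: l.filter (fun c => !decide (bitsVal c < bitsVal m))

def sortBits (l : List (List Bool)) : List (List Bool) := l.foldl (fun s m => insertBits m s) []

theorem insertBits_perm (m : List Bool) (l : List (List Bool)) : (insertBits m l).Perm (m :: l) :=
  List.perm_middle.trans ((List.filter_append_perm _ l).cons m)

theorem sortBits_perm (l : List (List Bool)) : (sortBits l).Perm l := by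
  have key : ∀ (l s : List (List Bool)),
      (l.foldl (fun s m => insertBits m s) s).Perm (s ++ l) := by
    intro l
    induction l with
    | nil => intro s; simp
    | cons m l ih =>
      intro s
      exact (ih _).trans (((insertBits_perm m s).append_right l).trans List.perm_middle.symm)
  exact key l []

theorem pairwise_sortBits (l : List (List Bool)) :
    (sortBits l).Pairwise fun a b => bitsVal a ≤ bitsVal b := by
  have key : ∀ (l s : List (List Bool)), s.Pairwise (fun a b => bitsVal a ≤ bitsVal b) →
      (l.foldl (fun s m => insertBits m s) s).Pairwise fun a b => bitsVal a ≤ bitsVal b := by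
    intro l
    induction l with
    | nil => intro s h; exact h
    | cons m l ih =>
      intro s h
      refine ih _ ?_
      change (insertBits m s).Pairwise _
      rw [insertBits, List.pairwise_append, List.pairwise_cons]
      refine ⟨h.filter _, ⟨fun b hb => ?_, h.filter _⟩, fun a ha b hb => ?_⟩
      · simp only [List.mem_filter, Bool.not_eq_true', decide_eq_false_iff_not] at hb
        omega
      · simp only [List.mem_cons, List.mem_filter, Bool.not_eq_true', decide_eq_false_iff_not,
          decide_eq_true_eq] at ha hb
        rcases hb with rfl | hb <;> omega
  exact key l [] List.Pairwise.nil

theorem pairwise_sortBits_lt {l : List (List Bool)} {k : ℕ} (hk : ∀ c ∈ l, c.length = k)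
    (h : l.Nodup) : (sortBits l).Pairwise fun a b => bitsVal a < bitsVal b := by
  have h' : (sortBits l).Nodup := (sortBits_perm l).nodup_iff.2 h
  refine ((pairwise_sortBits l).and h').imp_of_mem fun {a b} ha hb hab => ?_
  have hab' : bitsVal a ≠ bitsVal b := fun he => hab.2
    (bitsVal_injective ((hk a ((sortBits_perm l).mem_iff.1 ha)).trans
      (hk b ((sortBits_perm l).mem_iff.1 hb)).symm) he)
  omega

def sortData (l : Data) : Data :=
  l.toList.foldl (fun s m => ofList ((ofList (s.toList.filter fun e => (ltData e m).toBool)).toList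
    ++ (Data.cons m (ofList (s.toList.filter fun e =>
      (ofBool (!(ltData e m).toBool)).toBool))).toList)) .nil

instance PolyTime.sortData {f : (Data → Bool) → Data → Data} [hf : PolyTime f] :
    PolyTime fun O x => sortData (f O x) := by
  refine comp (F := fun _ l => PrivLearn.sortData l) ?_ hf
  refine foldl_of_add (l := fun _ l => l) (z := fun _ _ => Data.nil) (g := fun _ _ s m =>
    ofList ((ofList (s.toList.filter fun e => (PrivLearn.ltData e m).toBool)).toList
    ++ (Data.cons m (ofList (s.toList.filter fun e =>
      (ofBool (!(PrivLearn.ltData e m).toBool)).toBool))).toList)) (.X + 1) fun O l s m hm => ?_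
  have h := size_append (ofList (s.toList.filter fun e => (PrivLearn.ltData e m).toBool))
    (Data.cons m (ofList (s.toList.filter fun e =>
      (ofBool (!(PrivLearn.ltData e m).toBool)).toBool)))
  have h' := size_append (ofList (s.toList.filter fun e => (PrivLearn.ltData e m).toBool))
    (ofList (s.toList.filter fun e => (ofBool (!(PrivLearn.ltData e m).toBool)).toBool))
  have hp := List.filter_append_perm (fun e => (PrivLearn.ltData e m).toBool) s.toList
  have hs : (ofList (s.toList.filter (fun e => (PrivLearn.ltData e m).toBool) ++
      s.toList.filter fun e => !(PrivLearn.ltData e m).toBool)).size = s.size := by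
    rw [size_ofList, size_eq s, (hp.map size).sum_eq, hp.length_eq]
  have hm := size_le_of_mem hm
  simp only [toList_ofList, toBool_ofBool] at h h' hs ⊢
  rw [size] at h
  simp only [Polynomial.eval_add, Polynomial.eval_X, Polynomial.eval_one]
  omega

theorem filter_ltData {l : List (List Bool)} {m : List Bool} (h : ∀ c ∈ l, c.length = m.length) :
    (l.map ofBits).filter (fun e => (ltData e (ofBits m)).toBool) =
      (l.filter fun c => decide (bitsVal c < bitsVal m)).map ofBits := by
  rw [List.filter_map]
  congr 1
  refine List.filter_congr fun c hc => ?_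
  simp only [Function.comp, toBool_ltData (h c hc)]

theorem filter_not_ltData {l : List (List Bool)} {m : List Bool}
    (h : ∀ c ∈ l, c.length = m.length) :
    (l.map ofBits).filter (fun e => !(ltData e (ofBits m)).toBool) =
      (l.filter fun c => !decide (bitsVal c < bitsVal m)).map ofBits := by
  rw [List.filter_map]
  congr 1
  refine List.filter_congr fun c hc => ?_
  simp only [Function.comp, toBool_ltData (h c hc)]

theorem sortData_ofLists {l : List (List Bool)} {k : ℕ} (h : ∀ c ∈ l, c.length = k) :
    sortData (ofLists l) = ofLists (sortBits l) := by
  have key : ∀ (l s : List (List Bool)), (∀ c ∈ l, c.length = k) → (∀ c ∈ s, c.length = k) →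
      (l.map ofBits).foldl (fun s m => ofList ((ofList (s.toList.filter fun e =>
        (ltData e m).toBool)).toList ++ (Data.cons m (ofList (s.toList.filter fun e =>
          (ofBool (!(ltData e m).toBool)).toBool))).toList)) (ofLists s) =
      ofLists (l.foldl (fun s m => insertBits m s) s) := by
    intro l
    induction l with
    | nil => intro s _ _; rfl
    | cons m l ih =>
      intro s hl hs
      have hm := hl m (by simp)
      rw [List.map_cons, List.foldl_cons, List.foldl_cons, ← ih _ (fun c hc => hl c (by simp [hc]))]
      · congr 1
        simp only [toList_ofLists, toList_ofList, toList_cons, toBool_ofBool]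
        rw [filter_ltData (by simpa [hm] using hs), filter_not_ltData (by simpa [hm] using hs)]
        simp [ofLists, insertBits]
      · intro c hc
        rw [(insertBits_perm m s).mem_iff, List.mem_cons] at hc
        rcases hc with rfl | hc
        · exact hm
        · exact hs c hc
  rw [sortData, toList_ofLists]
  exact key l [] h (by simp)

/-- The list of the pairs of consecutive entries. -/
def consecutive (l : List (List Bool)) : List (List Bool × List Bool) := l.zip l.tail

def consecutiveData (l : Data) : Data := ofList (List.zipWith Data.cons l.toList l.snd.toList)

instance PolyTime.consecutiveData {f : (Data → Bool) → Data → Data} [PolyTime f] :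
    PolyTime fun O x => consecutiveData (f O x) := by
  unfold PrivLearn.consecutiveData; infer_instance

def pairData (j : List Bool × List Bool) : Data := .cons (ofBits j.1) (ofBits j.2)

theorem consecutiveData_ofLists (l : List (List Bool)) :
    consecutiveData (ofLists l) = ofList ((consecutive l).map pairData) := by
  rw [consecutiveData, consecutive, toList_snd, toList_ofLists, ← List.map_tail,
    List.zipWith_map, List.zip, List.map_zipWith]
  rfl

def nodupData (l : Data) : Data :=
  ofBool ((consecutiveData (sortData l)).toList.all fun e => (ltData e.fst e.snd).toBool)

instance PolyTime.nodupData {f : (Data → Bool) → Data → Data} [PolyTime f] :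
    PolyTime fun O x => nodupData (f O x) := by
  unfold PrivLearn.nodupData; infer_instance

theorem forall_consecutive_iff {l : List (List Bool)} :
    (∀ e ∈ consecutive l, bitsVal e.1 < bitsVal e.2) ↔
      l.Pairwise fun a b => bitsVal a < bitsVal b := by
  have : IsTrans (List Bool) fun a b => bitsVal a < bitsVal b := ⟨fun _ _ _ h h' => h.trans h'⟩
  rw [← List.isChain_iff_pairwise]
  induction l with
  | nil => simp [consecutive]
  | cons a l ih =>
    cases l with
    | nil => simp [consecutive]
    | cons b l =>
      have ih : (∀ e ∈ consecutive (b :: l), bitsVal e.1 < bitsVal e.2) ↔ _ := ih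
      rw [List.isChain_cons_cons, ← ih]
      simp [consecutive]

/-- After sorting, equal strings would be neighbours, so distinctness amounts to strict increase
between neighbours. -/
theorem toBool_nodupData {l : List (List Bool)} {k : ℕ} (h : ∀ c ∈ l, c.length = k) :
    (nodupData (ofLists l)).toBool = true ↔ l.Nodup := by
  have hs : ∀ c ∈ sortBits l, c.length = k := fun c hc => h c ((sortBits_perm l).mem_iff.1 hc)
  have hlt : ∀ e ∈ consecutive (sortBits l), e.1.length = e.2.length := by
    intro e he
    have := List.of_mem_zip (a := e.1) (b := e.2) he
    rw [hs _ this.1, hs _ (List.mem_of_mem_tail this.2)]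
  rw [nodupData, sortData_ofLists h, consecutiveData_ofLists, toBool_ofBool, toList_ofList,
    List.all_eq_true]
  simp only [List.mem_map, forall_exists_index, and_imp, forall_apply_eq_imp_iff₂, pairData,
    fst_cons, snd_cons]
  constructor
  · intro H
    have := forall_consecutive_iff.1 fun e he => by
      have := H e he
      rwa [toBool_ltData (hlt e he), decide_eq_true_eq] at this
    refine (sortBits_perm l).nodup_iff.1 (this.imp ?_)
    rintro a b hab rfl
    exact lt_irrefl _ hab
  · intro H e he
    rw [toBool_ltData (hlt e he), decide_eq_true_eq]
    exact forall_consecutive_iff.2 (pairwise_sortBits_lt h H) e he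

/-- A list of length `bitsVal bs`. -/
def indexData (cs b : Data) : Data := ofList (cs.toList.filter fun e => (ltData e b).toBool)

instance PolyTime.indexData {f g : (Data → Bool) → Data → Data} [PolyTime f] [hg : PolyTime g] :
    PolyTime fun O x => indexData (f O x) (g O x) := by
  have : PolyTime fun O w => g O w.fst := hg.comp inferInstance
  unfold PrivLearn.indexData; infer_instance

theorem length_indexData (bs : List Bool) :
    (indexData (ofLists (cells bs.length)) (ofBits bs)).toList.length = bitsVal bs := by
  rw [indexData, toList_ofLists, filter_ltData fun c hc => length_of_mem_cells hc, toList_ofList,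
    List.length_map, cells_eq, List.filter_map, List.length_map]
  have h : (List.range (2 ^ bs.length)).filter ((fun c => decide (bitsVal c < bitsVal bs)) ∘
      msgBits bs.length) = (List.range (2 ^ bs.length)).filter fun i => decide (i < bitsVal bs) := by
    refine List.filter_congr fun i hi => ?_
    simp only [Function.comp, bitsVal_msgBits (List.mem_range.1 hi)]
  have hr : ∀ n v, v ≤ n → ((List.range n).filter fun i => decide (i < v)).length = v := by
    intro n
    induction n with
    | zero => intro v hv; simp at hv; simp [hv]
    | succ n ih =>
      intro v hv
      rw [List.range_succ, List.filter_append, List.length_append]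
      rcases hv.eq_or_lt with rfl | hv
      · rw [List.filter_eq_self.2 fun i hi => by
          have := List.mem_range.1 hi; simp; omega]
        simp
      · rw [ih v (by omega)]
        simp
        omega
  rw [h, hr _ _ (bitsVal_lt bs).le]

end PrivLearn

/-! ### The generator of labeled examples and the tracing algorithm. -/

namespace PrivLearn

open Data

namespace ORE

variable (E : ORE)

/-- Encryption of a bit string. -/
def encBits (sk : Data) (m : List Bool) : PMF Data := E.encrypt sk (ofBits m)

/-- The value at the message `m` of the threshold half-way. -/
def label (m : List Bool) : Bool := !(m.reverse.headD false)

theorem label_append (m : List Bool) (b : Bool) : label (m ++ [b]) = !b := by simp [label]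

theorem label_eq (m : List Bool) : label m = decide (bitsVal m < 2 ^ (m.length - 1)) := by
  induction m using List.reverseRecOn with
  | nil => rfl
  | append_singleton m b _ =>
    have := bitsVal_lt m
    rw [label_append, bitsVal_append]
    cases b <;> simp [bitsVal, this]

def labelData (m : Data) : Data := ofBool (!(ofList m.toList.reverse).fst.toBool)

instance _root_.PrivLearn.PolyTime.labelData {f : (Data → Bool) → Data → Data} [PolyTime f] :
    PolyTime fun O x => labelData (f O x) := by
  unfold ORE.labelData; infer_instance

theorem labelData_ofBits (m : List Bool) : labelData (ofBits m) = ofBool (label m) := by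
  rw [labelData, label, toList_ofBits, ← List.map_reverse]
  cases m.reverse <;> simp

/-- Correct decryption turns the concept, on honest ciphertexts, into a comparison of plaintexts.
The string `m` is plaintext number `m + 1`, so the threshold `2 ^ (l - 1) + 1` selects the strings
whose most significant bit is 0. -/
theorem thresh_eq_label {s : ℕ} {m : List Bool} {keys c : Data}
    (hk : keys ∈ (E.keyLaw s m.length).support) (hc : c ∈ (E.encBits keys.fst m).support) :
    E.thresh m.length keys (2 ^ (m.length - 1) + 1) (.cons keys.snd c) = label m := by
  have h := E.correct_dec s m.length keys hk (msgOf m) c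
    (by rw [encodeMsg_msgOf]; exact hc)
  rw [label_eq]
  simp only [thresh, h, decodeMsg_encodeMsg, Option.some.injEq, exists_eq_left', true_and,
    add_lt_add_iff_right]
  exact decide_eq_decide.2 Iff.rfl

/-- The law of a uniformly random message of `l` bits and its encryption. -/
def exampleLaw (keys : Data) (l : ℕ) : PMF (List Bool × Data) :=
  (coins l).bind fun m => (E.encBits keys.fst m).map fun c => (m, c)

/-- Names in `Kernel` are for laws on trees, written so that samplability is found by instance
search; names in `Law` are for the mathematical objects that they encode. -/
def exampleKernel (x : Data) : PMF Data :=
  (PMF.map ofBits (coins x.snd.toList.length)).bind fun m =>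
    (E.enc.run noOracle (.cons x.fst.fst m)).map fun c => .cons m c

instance samplable_exampleKernel {f : (Data → Bool) → Data → Data} [hf : PolyTime f] :
    Samplable fun O x => E.exampleKernel (f O x) := by
  refine Samplable.comp (K := fun _ x => E.exampleKernel x) ?_ hf
  unfold exampleKernel; infer_instance

theorem exampleKernel_eq (keys u : Data) : E.exampleKernel (.cons keys u) =
    (E.exampleLaw keys u.toList.length).map fun e => .cons (ofBits e.1) e.2 := by
  simp only [exampleKernel, exampleLaw, encBits, encrypt, PMF.map, PMF.bind_bind, PMF.pure_bind,
    Function.comp_def, fst_cons, snd_cons]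

/-- The tuple `(key, state, junk, sample)` with key `(keys, 1ˡ)` and state `((1ⁿ, 1ˡ), (keys,
messages))`: the tracer knows the secret key and all plaintexts. The junk example decodes to `(nil,
false)`. -/
def reidOutput (n u keys ex : Data) : Data :=
  .cons (.cons keys u) (.cons (.cons (.cons n u) (.cons keys (ofList (ex.toList.map fun e => e.fst))))
    (.cons (.cons .nil .nil)
      (ofList (ex.toList.map fun e => .cons (.cons keys.snd e.snd) (labelData e.fst)))))

def reidGenKernel (A : Alg) (x : Data) : PMF Data :=
  (E.gen.run noOracle (.cons x.fst (A.out noOracle x.fst))).bind fun keys =>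
    (PMF.map ofList (seqLaw (x.snd.toList.map fun _ =>
      E.exampleKernel (.cons keys (A.out noOracle x.fst))))).map fun ex =>
        reidOutput x.snd (A.out noOracle x.fst) keys ex

instance samplable_reidGenKernel (A : Alg) : Samplable fun _ x => E.reidGenKernel A x := by
  unfold reidGenKernel
  unfold reidOutput
  infer_instance

def outputOf (l n : ℕ) (keys : Data) (ex : List (List Bool × Data)) : Data :=
  reidOutput (unary n) (unary l) keys (ofList (ex.map fun e => .cons (ofBits e.1) e.2))

theorem reidGenKernel_eq {A : Alg} {s l n : ℕ} (hA : A.out noOracle (unary s) = unary l) :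
    E.reidGenKernel A (.cons (unary s) (unary n)) = (E.keyLaw s l).bind fun keys =>
      (iid (E.exampleLaw keys l) n).map (outputOf l n keys) := by
  simp only [reidGenKernel, fst_cons, snd_cons, hA, keyLaw]
  congr 1
  ext1 keys
  rw [List.map_const', length_unary, ← iid_eq_seqLaw, exampleKernel_eq, iid_map, PMF.map_comp,
    PMF.map_comp, length_unary]
  rfl

/-! ### Tracing -/

/-- The answer of the oracle on an encryption of a random message with the given last bits. The
input is `(keys, (number of random bits, last bits))`. -/
def bitKernel (O : Data → Bool) (x : Data) : PMF Data :=
  (PMF.map ofBits (coins x.snd.fst.toList.length)).bind fun lo =>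
    (E.enc.run noOracle (.cons x.fst.fst (ofList (lo.toList ++ x.snd.snd.toList)))).map fun c =>
      ofBool (O (.cons x.fst.snd c))

instance samplable_bitKernel {f : (Data → Bool) → Data → Data} [hf : PolyTime f] :
    Samplable fun O x => E.bitKernel O (f O x) := by
  refine Samplable.comp (K := fun O x => E.bitKernel O x) ?_ hf
  unfold bitKernel; infer_instance

def bitLaw (h : Data → Bool) (keys : Data) (r : ℕ) (j : List Bool) : PMF Bool :=
  (coins r).bind fun lo => (E.encBits keys.fst (lo ++ j)).map fun c => h (.cons keys.snd c)

theorem bitKernel_eq (h : Data → Bool) (keys u : Data) (j : List Bool) :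
    E.bitKernel h (.cons keys (.cons u (ofBits j))) =
      (E.bitLaw h keys u.toList.length j).map ofBool := by
  simp only [bitKernel, bitLaw, encBits, encrypt, PMF.map, PMF.bind_bind, PMF.pure_bind,
    Function.comp_def, fst_cons, snd_cons, toList_ofBits, ← List.map_append]
  rfl

/-- Comparison of the answers of the oracle for two blocks of last bits. The input is
`((number of repetitions, threshold), (keys, (number of random bits, pair of blocks)))`. -/
def testKernel (O : Data → Bool) (x : Data) : PMF Data :=
  (PMF.map ofList (seqLaw (x.fst.fst.toList.map fun _ =>
    (E.bitKernel O (.cons x.snd.fst (.cons x.snd.snd.fst x.snd.snd.snd.fst))).bind fun a =>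
    (E.bitKernel O (.cons x.snd.fst (.cons x.snd.snd.fst x.snd.snd.snd.snd))).map fun b =>
      .cons a b))).map fun ys => ofBool (!(ofList
        ((ofList ((ofList (ys.toList.filter fun e => e.snd.toBool)).toList ++
          x.fst.snd.toList)).toList.drop
        (ofList (ys.toList.filter fun e => e.fst.toBool)).toList.length)).toBool)

instance samplable_testKernel {f : (Data → Bool) → Data → Data} [hf : PolyTime f] :
    Samplable fun O x => E.testKernel O (f O x) := by
  refine Samplable.comp (K := fun O x => E.testKernel O x) ?_ hf
  unfold testKernel; infer_instance

def pairLaw (h : Data → Bool) (keys : Data) (r : ℕ) (j : List Bool × List Bool) :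
    PMF (Bool × Bool) :=
  (E.bitLaw h keys r j.1).bind fun a => (E.bitLaw h keys r j.2).map fun b => (a, b)

def testLaw (h : Data → Bool) (keys : Data) (r T τ : ℕ) (j : List Bool × List Bool) : PMF Bool :=
  (iid (E.pairLaw h keys r j) T).map fun ys =>
    decide (ys.countP (fun e => e.2) + τ ≤ ys.countP fun e => e.1)

theorem testKernel_eq (h : Data → Bool) (keys u T τ : Data) (j : List Bool × List Bool) :
    E.testKernel h (.cons (.cons T τ) (.cons keys (.cons u (pairData j)))) =
      (E.testLaw h keys u.toList.length T.toList.length τ.toList.length j).map ofBool := by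
  have h₁ : ((E.bitLaw h keys u.toList.length j.1).map ofBool).bind (fun a =>
      ((E.bitLaw h keys u.toList.length j.2).map ofBool).map fun b => Data.cons a b) =
      (E.pairLaw h keys u.toList.length j).map fun e => .cons (ofBool e.1) (ofBool e.2) := by
    simp only [pairLaw, PMF.map, PMF.bind_bind, PMF.pure_bind, Function.comp_def]
  simp only [testKernel, fst_cons, snd_cons, pairData, bitKernel_eq, h₁, List.map_const']
  rw [← iid_eq_seqLaw, iid_map, testLaw, PMF.map_comp, PMF.map_comp, PMF.map_comp]
  congr 1
  ext1 ys
  simp only [Function.comp_apply, toList_ofList]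
  congr 1
  rw [toBool_eq, toList_ofList, Bool.not_not, Bool.eq_iff_iff]
  simp [← List.countP_eq_length_filter, List.countP_map, Function.comp_def]

/-- Whether the last bits of the message belong to a pair of blocks with a positive test. The
tests are given as a list of pairs `((block, next block), result)`. -/
def accusedData (r tests m : Data) : Data :=
  ofBool (tests.toList.any fun e => (ofBool (e.snd.toBool && (ofBool
    ((eqData (ofList (m.toList.drop r.toList.length)) e.fst.fst).toBool ||
     (eqData (ofList (m.toList.drop r.toList.length)) e.fst.snd).toBool)).toBool)).toBool)

def verdictStep (r tests st m : Data) : Data :=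
  bif st.fst.toBool then st else .cons (accusedData r tests m) (.cons .nil st.snd)

/-- The index of the first accused message. -/
def verdictData (r tests ms : Data) : Data :=
  bif (ms.toList.foldl (verdictStep r tests) (.cons .nil .nil)).fst.toBool then
    (ms.toList.foldl (verdictStep r tests) (.cons .nil .nil)).snd else .nil

instance _root_.PrivLearn.PolyTime.verdictData {f g h : (Data → Bool) → Data → Data} [hf : PolyTime f]
    [hg : PolyTime g] [hh : PolyTime h] : PolyTime fun O x => verdictData (f O x) (g O x) (h O x) := by
  have h₁ : PolyTime fun O w => f O w.fst := hf.comp inferInstance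
  have h₂ : PolyTime fun O w => g O w.fst := hg.comp inferInstance
  have h₁' : PolyTime fun O w => f O w.fst.fst := h₁.comp inferInstance
  have h₂' : PolyTime fun O w => g O w.fst.fst := h₂.comp inferInstance
  have hs : PolyTime fun O w => verdictStep (f O w.fst) (g O w.fst) w.snd.fst w.snd.snd := by
    unfold ORE.verdictStep ORE.accusedData; infer_instance
  have := PolyTime.foldl_of_add (l := h) (z := fun _ _ => .cons .nil .nil)
    (g := fun O x st m => verdictStep (f O x) (g O x) st m) 8 (fun O x st m _ => by
      have hb : ∀ b, (ofBool b).size ≤ 3 := by intro b; cases b <;> simp [ofBool, size]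
      have : (accusedData (f O x) (g O x) m).size ≤ 3 := hb _
      rcases st with _ | ⟨_ | _, c⟩
      · simp [verdictStep, size]; omega
      · simp [verdictStep, size]; omega
      · simp [verdictStep])
  exact PolyTime.cond (hf := PolyTime.fst (hf := this)) (hg := PolyTime.snd (hf := this))

/-- `cellsData (unary (Q n))` encodes all blocks: its length is the number `2 ^ d` of blocks, and
the length of its first entry is `d`. The polynomials `8X³` and `8X²` are evaluated at `2 ^ d * P
n`. -/
def traceKernel (P Q : Polynomial ℕ) (O : Data → Bool) (x : Data) : PMF Data :=
  (PMF.map ofList (seqLaw ((consecutiveData (cellsData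
      (unary (Q.eval x.fst.fst.toList.length)))).toList.map fun j =>
    (E.testKernel O (.cons (.cons
      (unary ((8 * .X ^ 3 : Polynomial ℕ).eval (unary ((cellsData
        (unary (Q.eval x.fst.fst.toList.length))).toList.length *
        (unary (P.eval x.fst.fst.toList.length)).toList.length)).toList.length))
      (unary ((8 * .X ^ 2 : Polynomial ℕ).eval (unary ((cellsData
        (unary (Q.eval x.fst.fst.toList.length))).toList.length *
        (unary (P.eval x.fst.fst.toList.length)).toList.length)).toList.length)))
      (.cons x.snd.fst (.cons (ofList (x.fst.snd.toList.drop (cellsData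
        (unary (Q.eval x.fst.fst.toList.length))).fst.toList.length)) j)))).map fun b =>
          .cons j b))).map fun tests =>
    verdictData (ofList (x.fst.snd.toList.drop (cellsData
        (unary (Q.eval x.fst.fst.toList.length))).fst.toList.length)) tests x.snd.snd

instance samplable_traceKernel (P Q : Polynomial ℕ) :
    Samplable fun O x => E.traceKernel P Q O x := by
  unfold traceKernel; infer_instance

theorem unary_injective : Function.Injective unary := by
  intro a b h
  rw [← length_unary a, h, length_unary]

/-- The accumulator is `(flag, counter)`; the counter advances with every message until the flag is
raised and is frozen afterwards. It thus stops at `i + 1` when message `i` is the first accused one,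
which is the encoding of the index `i`. -/
theorem foldl_verdictStep (r tests : Data) (ms : List Data) (n : ℕ) :
    ((∀ m ∈ ms, (accusedData r tests m).toBool = false) ∧
      (ms.foldl (verdictStep r tests) (.cons .nil (unary n))).fst.toBool = false) ∨
    ∃ i m, ms[i]? = some m ∧ (accusedData r tests m).toBool = true ∧
      ∃ d, d.toBool = true ∧
      ms.foldl (verdictStep r tests) (.cons .nil (unary n)) = .cons d (unary (n + i + 1)) := by
  induction ms generalizing n with
  | nil => exact Or.inl ⟨by simp, rfl⟩
  | cons m ms ih =>
    have hstep : verdictStep r tests (.cons .nil (unary n)) m =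
      .cons (accusedData r tests m) (unary (n + 1)) := rfl
    rw [List.foldl_cons, hstep]
    cases h : (accusedData r tests m).toBool with
    | true =>
      refine Or.inr ⟨0, m, by simp, h, _, h, ?_⟩
      have : ∀ ms : List Data, ms.foldl (verdictStep r tests)
          (.cons (accusedData r tests m) (unary (n + 1))) =
          .cons (accusedData r tests m) (unary (n + 1)) := by
        intro ms
        induction ms with
        | nil => rfl
        | cons m' ms ih' =>
          rw [List.foldl_cons, verdictStep, fst_cons, h, cond_true, ih']
      exact this ms
    | false =>
      have h0 : accusedData r tests m = .nil := by
        cases h' : accusedData r tests m with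
        | nil => rfl
        | cons a b => rw [h'] at h; simp at h
      rw [h0]
      rcases ih (n + 1) with ⟨h₁, h₂⟩ | ⟨i, m', h₁, h₂, d, hd, h₃⟩
      · exact Or.inl ⟨by simpa [h] using h₁, h₂⟩
      · exact Or.inr ⟨i + 1, m', by simpa using h₁, h₂, d, hd, by rw [h₃]; congr 2; omega⟩

theorem accusedData_of_accuses {r tests ms : Data} {i : ℕ}
    (h : ReidScheme.Accuses (verdictData r tests ms) i) :
    ∃ m, ms.toList[i]? = some m ∧ (accusedData r tests m).toBool = true := by
  rw [ReidScheme.Accuses, verdictData] at h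
  rcases foldl_verdictStep r tests ms.toList 0 with ⟨h₁, h₂⟩ | ⟨i', m, h₁, h₂, d, hd, h₃⟩
  · have h₂ : (ms.toList.foldl (verdictStep r tests) (.cons .nil .nil)).fst.toBool = false := h₂
    rw [h₂, cond_false] at h
    cases h
  · have h₃ : ms.toList.foldl (verdictStep r tests) (.cons .nil .nil) = _ := h₃
    rw [h₃, fst_cons, hd, cond_true, snd_cons] at h
    have := unary_injective h
    obtain rfl : i' = i := by omega
    exact ⟨m, h₁, h₂⟩

theorem accusedData_of_not_accuses {r tests ms : Data}
    (h : ∀ i < ms.toList.length, ¬ ReidScheme.Accuses (verdictData r tests ms) i) :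
    ∀ m ∈ ms.toList, (accusedData r tests m).toBool = false := by
  rcases foldl_verdictStep r tests ms.toList 0 with ⟨h₁, h₂⟩ | ⟨i', m, h₁, h₂, d, hd, h₃⟩
  · exact h₁
  · have h₃ : ms.toList.foldl (verdictStep r tests) (.cons .nil .nil) = _ := h₃
    refine absurd ?_ (h i' (List.getElem?_eq_some_iff.1 h₁).1)
    rw [ReidScheme.Accuses, verdictData, h₃, fst_cons, hd, cond_true, snd_cons, Nat.zero_add]

/-- The number of blocks of last bits, as a power of two. -/
def depth (Q : Polynomial ℕ) (n : ℕ) : ℕ := Nat.clog 2 (Q.eval n)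

/-- Whether the last bits of `m` belong to a pair of blocks with a positive test. -/
def accused (r : ℕ) (tests : List ((List Bool × List Bool) × Bool)) (m : List Bool) : Prop :=
  ∃ e ∈ tests, e.2 = true ∧ (m.drop r = e.1.1 ∨ m.drop r = e.1.2)

def testsData (tests : List ((List Bool × List Bool) × Bool)) : Data :=
  ofList (tests.map fun e => .cons (pairData e.1) (ofBool e.2))

theorem toBool_accusedData {r : Data} {tests : List ((List Bool × List Bool) × Bool)}
    {m : List Bool}
    (h : ∀ e ∈ tests, (m.drop r.toList.length).length = e.1.1.length ∧
      (m.drop r.toList.length).length = e.1.2.length) :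
    (accusedData r (testsData tests) (ofBits m)).toBool = true ↔
      accused r.toList.length tests m := by
  simp only [accusedData, testsData, toBool_ofBool, toList_ofList, List.any_eq_true, List.mem_map,
    accused, exists_exists_and_eq_and]
  refine exists_congr fun e => and_congr_right fun he => ?_
  have hd : ofList (List.drop r.toList.length (ofBits m).toList) =
      ofBits (m.drop r.toList.length) := by
    rw [toList_ofBits, ← List.map_drop]; rfl
  rw [hd]
  simp only [pairData, fst_cons, snd_cons, toBool_ofBool, toBool_eqData (h e he).1,
    toBool_eqData (h e he).2, Bool.and_eq_true, Bool.or_eq_true, decide_eq_true_eq]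

/-- The law of the tests of all pairs of consecutive blocks. -/
def testsLaw (P Q : Polynomial ℕ) (h : Data → Bool) (keys : Data) (l n : ℕ) :
    PMF (List ((List Bool × List Bool) × Bool)) :=
  seqLaw ((consecutive (cells (depth Q n))).map fun j =>
    -- With `N = 2 ^ depth Q n * P n` there are `8N³` repetitions and the threshold is `8N²`: a test
    -- is positive when the observed drop is at least `1/N`, which separates true drops of at most
    -- `1/(2N)` from those of at least `2/N`.
    (E.testLaw h keys (l - depth Q n) (8 * (2 ^ depth Q n * P.eval n) ^ 3)
      (8 * (2 ^ depth Q n * P.eval n) ^ 2) j).map fun b => (j, b))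

theorem traceKernel_eq (P Q : Polynomial ℕ) (h : Data → Bool) (keys : Data) (l n : ℕ)
    (ms : List (List Bool)) :
    E.traceKernel P Q h (.cons (.cons (unary n) (unary l)) (.cons keys (ofLists ms))) =
      (E.testsLaw P Q h keys l n).map fun tests =>
        verdictData (unary (l - depth Q n)) (testsData tests) (ofLists ms) := by
  have hfst : (ofLists (cells (depth Q n))).fst.toList.length = depth Q n := by
    have h0 : 0 < (cells (depth Q n)).length := by rw [length_cells]; positivity
    cases hc : cells (depth Q n) with
    | nil => rw [hc] at h0; simp at h0
    | cons c cs =>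
      have := length_of_mem_cells (d := depth Q n) (c := c) (by simp [hc])
      simp [ofLists, this]
  have hr : ofList ((unary l).toList.drop (depth Q n)) = unary (l - depth Q n) := by
    rw [unary, toList_ofList, List.drop_replicate]; rfl
  simp only [traceKernel, fst_cons, snd_cons, length_unary, cellsData_eq, toList_ofLists,
    List.length_map, length_cells]
  rw [show Nat.clog 2 (Q.eval n) = depth Q n from rfl, hfst, hr, consecutiveData_ofLists,
    toList_ofList, List.map_map, testsLaw]
  simp only [Function.comp_def, testKernel_eq, length_unary, PMF.map_comp, Polynomial.eval_mul,
    Polynomial.eval_pow, Polynomial.eval_X, Polynomial.eval_ofNat]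
  have := seqLaw_map (fun e : (List Bool × List Bool) × Bool => Data.cons (pairData e.1) (ofBool e.2))
    ((consecutive (cells (depth Q n))).map fun j =>
    (E.testLaw h keys (l - depth Q n) (8 * (2 ^ depth Q n * P.eval n) ^ 3)
      (8 * (2 ^ depth Q n * P.eval n) ^ 2) j).map fun b => (j, b))
  simp only [List.map_map, Function.comp_def, PMF.map_comp] at this
  rw [this, PMF.map_comp]
  rfl

end ORE

end PrivLearn

namespace PrivLearn

open Data

namespace ORE

variable (E : ORE)

/-! ### Hypotheses learned from encryptions of given messages -/

/-- The probability that `h` accepts an encryption of the message `m`. -/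
def accept (h : Data → Bool) (keys : Data) (m : List Bool) : ℝ :=
  expect (E.encBits keys.fst m) fun c => ind (h (.cons keys.snd c) = true)

theorem accept_nonneg (h : Data → Bool) (keys : Data) (m : List Bool) : 0 ≤ E.accept h keys m :=
  expect_nonneg _ fun _ => ind_nonneg _

theorem accept_le_one (h : Data → Bool) (keys : Data) (m : List Bool) : E.accept h keys m ≤ 1 :=
  expect_le _ (fun _ => abs_ind_le _) fun _ _ => ind_le_one _

theorem abs_accept_le (h : Data → Bool) (keys : Data) (m : List Bool) : |E.accept h keys m| ≤ 1 :=
  abs_expect_le _ fun _ => abs_ind_le _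

/-- A labeled example with the given message; the empty string stands for the junk example. -/
def exLaw (keys : Data) (m : List Bool) : PMF (Data × Bool) :=
  if m = [] then PMF.pure (.nil, false)
  else (E.encBits keys.fst m).map fun c => (.cons keys.snd c, label m)

def hypLaw (L : Learner) (s : ℕ) (keys : Data) (ms : List (List Bool)) : PMF (Data → Bool) :=
  (seqLaw (ms.map (E.exLaw keys))).bind (L.hyp s)

/-- The probability that the hypothesis learned from the messages `ms` accepts encryptions of both
`m` and `m'`. -/
def acceptBoth (L : Learner) (s l : ℕ) (ms : List (List Bool)) (m m' : List Bool) : ℝ :=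
  expect (E.keyLaw s l) fun keys => expect (E.hypLaw L s keys ms) fun h =>
    E.accept h keys m * E.accept h keys m'

theorem abs_accept_mul_le (h : Data → Bool) (keys : Data) (m m' : List Bool) :
    |E.accept h keys m * E.accept h keys m'| ≤ 1 := by
  rw [abs_mul]
  exact mul_le_one₀ (E.abs_accept_le _ _ _) (abs_nonneg _) (E.abs_accept_le _ _ _)

theorem acceptBoth_comm (L : Learner) (s l : ℕ) (ms : List (List Bool)) (m m' : List Bool) :
    E.acceptBoth L s l ms m m' = E.acceptBoth L s l ms m' m := by
  simp only [acceptBoth, mul_comm]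

theorem acceptBoth_nonneg (L : Learner) (s l : ℕ) (ms : List (List Bool)) (m m' : List Bool) :
    0 ≤ E.acceptBoth L s l ms m m' :=
  expect_nonneg _ fun _ => expect_nonneg _ fun _ =>
    mul_nonneg (E.accept_nonneg _ _ _) (E.accept_nonneg _ _ _)

theorem acceptBoth_le_one (L : Learner) (s l : ℕ) (ms : List (List Bool)) (m m' : List Bool) :
    E.acceptBoth L s l ms m m' ≤ 1 :=
  (abs_le.1 (abs_expect_le _ fun _ => abs_expect_le _ fun _ => E.abs_accept_mul_le _ _ _ _)).2

/-! ### Looking up ciphertexts -/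

def look : List (List Bool) → List Data → List Bool → Data
  | m :: l, c :: cs => Function.update (look l cs) m c
  | _, _ => fun _ => .nil

/-- The law of a table of encryptions of the messages in a list. -/
def lookLaw (sk : Data) : List (List Bool) → PMF (List Bool → Data)
  | [] => PMF.pure fun _ => .nil
  | m :: l => (E.encBits sk m).bind fun c => (lookLaw sk l).map fun φ => Function.update φ m c

theorem encryptAll_map_look (sk : Data) (l : List (List Bool)) :
    (E.encryptAll sk (l.map ofBits)).map (look l) = E.lookLaw sk l := by
  induction l with
  | nil => exact PMF.pure_map _ _
  | cons m l ih =>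
    simp only [List.map_cons, encryptAll, lookLaw, ← ih, PMF.map, PMF.bind_bind, PMF.pure_bind,
      Function.comp_def, look]
    rfl

/-- The adversary receives its ciphertexts in the order of the plaintexts, while the learner's
sample is in random order; a table indexed by plaintexts forgets the order. Distinctness is
essential, because two updates at the same message do not commute. -/
theorem lookLaw_perm (sk : Data) {l l' : List (List Bool)} (h : l.Perm l') (hn : l.Nodup) :
    E.lookLaw sk l = E.lookLaw sk l' := by
  induction h with
  | nil => rfl
  | cons m _ ih => rw [lookLaw, lookLaw, ih hn.of_cons]
  | swap m m' l =>
    have hne : m' ≠ m := by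
      have := (List.nodup_cons.1 hn).1
      simp at this
      tauto
    simp only [lookLaw, PMF.map, PMF.bind_bind, PMF.pure_bind, Function.comp_def]
    rw [PMF.bind_comm]
    simp only [Function.update_comm hne]
  | trans h _ ih₁ ih₂ => rw [ih₁ hn, ih₂ (h.nodup_iff.1 hn)]

/-- The messages in a list in which the empty string marks the place of the junk example. -/
def real (ms : List (List Bool)) : List (List Bool) := ms.filter fun m => !m.isEmpty

theorem mem_real {ms : List (List Bool)} {m : List Bool} : m ∈ real ms ↔ m ∈ ms ∧ m ≠ [] := by
  simp [real]

def exOf (keys : Data) (φ : List Bool → Data) (m : List Bool) : Data × Bool :=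
  if m = [] then (.nil, false) else (.cons keys.snd (φ m), label m)

theorem exOf_congr {keys : Data} {φ ψ : List Bool → Data} {ms : List (List Bool)}
    (h : ∀ m ∈ real ms, φ m = ψ m) : ms.map (exOf keys φ) = ms.map (exOf keys ψ) := by
  refine List.map_congr_left fun m hm => ?_
  unfold exOf
  split_ifs with h0
  · rfl
  · rw [h m (mem_real.2 ⟨hm, h0⟩)]

/-- For distinct messages, reading the examples off the table gives independent encryptions. A
repeated message would receive the same ciphertext twice instead of two fresh ones. -/
theorem lookLaw_map_exOf (keys : Data) (ms : List (List Bool)) (h : (real ms).Nodup) :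
    (E.lookLaw keys.fst (real ms)).map (fun φ => ms.map (exOf keys φ)) =
      seqLaw (ms.map (E.exLaw keys)) := by
  induction ms with
  | nil => exact PMF.pure_map _ _
  | cons m ms ih =>
    by_cases hm : m = []
    · have hr : real (m :: ms) = real ms := by simp [real, hm]
      rw [hr] at h ⊢
      rw [List.map_cons, seqLaw, exLaw, if_pos hm, PMF.pure_bind, ← ih h, PMF.map_comp]
      have h0 : ∀ φ, exOf keys φ m = (.nil, false) := fun φ => if_pos hm
      simp only [List.map_cons, Function.comp_def, h0]
    · have hr : real (m :: ms) = m :: real ms := by simp [real, hm]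
      rw [hr] at h ⊢
      rw [List.map_cons, seqLaw, exLaw, if_neg hm, ← ih h.of_cons, lookLaw]
      simp only [PMF.map, PMF.bind_bind, PMF.pure_bind, Function.comp_def, List.map_cons]
      congr 1
      ext1 c
      congr 1
      ext1 φ
      have h₁ : exOf keys (Function.update φ m c) m = (.cons keys.snd c, label m) := by
        simp [exOf, hm]
      rw [h₁, exOf_congr (ψ := φ)]
      intro m' hm'
      rw [Function.update_of_ne]
      rintro rfl
      exact (List.nodup_cons.1 h).1 hm'

/-- In the application `f` is the message to be compared with, and `g₀`, `g₁` are the two extreme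
messages, whose ciphertexts are requested only to make the challenge legal and are then ignored. The
ciphertext of `f` is independent of the sample. -/
theorem lookLaw_bind {β : Type} (keys : Data) (ms l : List (List Bool)) (f g₀ g₁ : List Bool)
    (hl : l.Perm (f :: g₀ :: g₁ :: real ms)) (h : l.Nodup)
    (Ψ : Data → List (Data × Bool) → PMF β) :
    (E.lookLaw keys.fst l).bind (fun φ => Ψ (φ f) (ms.map (exOf keys φ))) =
      (E.encBits keys.fst f).bind fun c => (seqLaw (ms.map (E.exLaw keys))).bind fun S => Ψ c S := by
  have h' : (f :: g₀ :: g₁ :: real ms).Nodup := hl.nodup_iff.1 h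
  rw [E.lookLaw_perm _ hl h]
  have hr : (real ms).Nodup := h'.of_cons.of_cons.of_cons
  have hf : f ∉ real ms := fun hm => (List.nodup_cons.1 h').1 (by simp [hm])
  have hg₀ : g₀ ∉ real ms := fun hm => (List.nodup_cons.1 h'.of_cons).1 (by simp [hm])
  have hg₁ : g₁ ∉ real ms := (List.nodup_cons.1 h'.of_cons.of_cons).1
  have hex : ∀ (φ : List Bool → Data) c c₀ c₁, ms.map (exOf keys (Function.update (Function.update
      (Function.update φ g₁ c₁) g₀ c₀) f c)) = ms.map (exOf keys φ) := by
    intro φ c c₀ c₁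
    refine exOf_congr fun m hm => ?_
    rw [Function.update_of_ne, Function.update_of_ne, Function.update_of_ne]
    · rintro rfl; exact hg₁ hm
    · rintro rfl; exact hg₀ hm
    · rintro rfl; exact hf hm
  rw [← E.lookLaw_map_exOf keys ms hr]
  simp only [lookLaw, PMF.map, PMF.bind_bind, PMF.pure_bind, Function.comp_def, hex,
    Function.update_self, PMF.bind_const]

def lookData (tbl m : Data) : Data :=
  (ofList (tbl.toList.flatMap fun e =>
    (bif (eqData e.fst m).toBool then Data.cons e.snd .nil else .nil).toList)).fst

theorem lookData_eq {l : List (List Bool)} {cs : List Data} {m : List Bool}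
    (h : ∀ c ∈ l, c.length = m.length) :
    lookData (ofList (List.zipWith Data.cons (l.map ofBits) cs)) (ofBits m) = look l cs m := by
  induction l generalizing cs with
  | nil => rfl
  | cons a l ih =>
    cases cs with
    | nil => rfl
    | cons c cs =>
      have ih := ih (cs := cs) fun c hc => h c (by simp [hc])
      simp only [lookData, toList_ofList] at ih
      simp only [lookData, List.map_cons, List.zipWith_cons_cons, toList_ofList, List.flatMap_cons,
        fst_cons, snd_cons, toBool_eqData (h a (by simp)), look]
      by_cases ham : a = m
      · subst ham; simp
      · simp [ham, ih, Function.update_of_ne (Ne.symm ham)]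

def sampleData (params tbl ms : Data) : Data :=
  ofList (ms.toList.map fun m =>
    bif m.toBool then .cons (.cons params (lookData tbl m)) (labelData m) else .cons .nil .nil)

theorem sampleData_eq {l ms : List (List Bool)} {cs : List Data} {k : ℕ} (keys : Data)
    (hl : ∀ c ∈ l, c.length = k) (hms : ∀ m ∈ ms, m ≠ [] → m.length = k) :
    sampleData keys.snd (ofList (List.zipWith Data.cons (l.map ofBits) cs)) (ofLists ms) =
      encodeSample (ms.map (exOf keys (look l cs))) := by
  rw [sampleData, encodeSample, toList_ofLists, List.map_map, List.map_map]
  congr 1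
  refine List.map_congr_left fun m hm => ?_
  simp only [Function.comp_apply, exOf]
  split_ifs with h
  · subst h; rfl
  · have : (ofBits m).toBool = true := by
      rw [toBool_eq, toList_ofBits]; simpa using h
    rw [this, cond_true, lookData_eq fun c hc => (hl c hc).trans (hms m hm h).symm,
      labelData_ofBits]

/-! ### The adversary's guess -/

/-- The input is `(state, (params, (ciphertexts, challenge)))`, with
`state = (1ˢ, (messages, (sorted messages, (fixed message, sign))))`. -/
def guessKernel (L : Learner) (x : Data) : PMF Data :=
  (L.learn.run noOracle (.cons x.fst.fst (sampleData x.snd.fst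
    (ofList (List.zipWith Data.cons x.fst.snd.snd.fst.toList x.snd.snd.fst.toList))
    x.fst.snd.fst))).map fun w =>
      ofBool ((ofBool ((L.eval.out noOracle (.cons w (.cons x.snd.fst (lookData
        (ofList (List.zipWith Data.cons x.fst.snd.snd.fst.toList x.snd.snd.fst.toList))
          x.fst.snd.snd.snd.fst)))).toBool &&
        (L.eval.out noOracle (.cons w (.cons x.snd.fst x.snd.snd.snd))).toBool)).toBool ^^
          x.fst.snd.snd.snd.snd.toBool)

instance samplable_guessKernel (L : Learner) : Samplable fun _ x => guessKernel L x := by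
  unfold guessKernel sampleData lookData; infer_instance

def guessState (s : ℕ) (ms l : List (List Bool)) (f : List Bool) (sign : Bool) : Data :=
  .cons (unary s) (.cons (ofLists ms) (.cons (ofLists l) (.cons (ofBits f) (ofBool sign))))

theorem guessKernel_eq (L : Learner) (s : ℕ) {ms l : List (List Bool)} {f : List Bool}
    (sign : Bool) (keys c : Data) (cs : List Data)
    (hl : ∀ c ∈ l, c.length = f.length) (hms : ∀ m ∈ ms, m ≠ [] → m.length = f.length) :
    (guessKernel L (.cons (guessState s ms l f sign) (.cons keys.snd (.cons (ofList cs) c)))).map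
      Data.toBool = (L.hyp s (ms.map (exOf keys (look l cs)))).map fun h =>
        (h (.cons keys.snd (look l cs f)) && h (.cons keys.snd c)) ^^ sign := by
  simp only [guessKernel, guessState, fst_cons, snd_cons, toList_ofLists, toList_ofList,
    sampleData_eq keys hl hms, lookData_eq hl, Learner.hyp, PMF.map_comp, toBool_ofBool,
    Function.comp_def]

/-- Given the keys and the sample, the ciphertexts of `f` and `m` and the hypothesis are
independent, so the event that the hypothesis accepts both has the mean of the product of the two
acceptance probabilities. The bit `sign` complements the guess and so reverses the direction of the
advantage. -/
theorem prob_guess (L : Learner) (s k : ℕ) {ms l : List (List Bool)} {f g₀ g₁ m : List Bool}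
    (sign : Bool) (hl : l.Perm (f :: g₀ :: g₁ :: real ms)) (hn : l.Nodup)
    (hlen : ∀ c ∈ l, c.length = f.length) (hms : ∀ m ∈ ms, m ≠ [] → m.length = f.length) :
    prob ((E.keyLaw s k).bind fun keys => (E.encryptAll keys.fst (l.map ofBits)).bind fun cs =>
      (E.encrypt keys.fst (ofBits m)).bind fun c => (guessKernel L (.cons (guessState s ms l f sign)
        (.cons keys.snd (.cons (ofList cs) c)))).map Data.toBool) {true} =
    bif sign then 1 - E.acceptBoth L s k ms f m else E.acceptBoth L s k ms f m := by
  have hkey : ∀ keys : Data, prob ((E.encryptAll keys.fst (l.map ofBits)).bind fun cs =>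
      (E.encrypt keys.fst (ofBits m)).bind fun c => (guessKernel L (.cons (guessState s ms l f sign)
        (.cons keys.snd (.cons (ofList cs) c)))).map Data.toBool) {true} =
      bif sign then 1 - expect (E.hypLaw L s keys ms) (fun h =>
        E.accept h keys f * E.accept h keys m) else expect (E.hypLaw L s keys ms) fun h =>
        E.accept h keys f * E.accept h keys m := by
    intro keys
    simp only [guessKernel_eq L s sign keys _ _ hlen hms]
    have h₁ := E.lookLaw_bind keys ms l f g₀ g₁ hl hn fun cf S =>
      (E.encrypt keys.fst (ofBits m)).bind fun c => (L.hyp s S).map fun h =>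
        (h (.cons keys.snd cf) && h (.cons keys.snd c)) ^^ sign
    rw [← E.encryptAll_map_look] at h₁
    rw [PMF.bind_map] at h₁
    simp only [Function.comp_def] at h₁
    rw [h₁]
    have hind : ∀ a b : Bool, ind (((a && b) ^^ sign) ∈ ({true} : Set Bool)) =
        bif sign then 1 - ind (a = true) * ind (b = true) else ind (a = true) * ind (b = true) := by
      intro a b
      cases a <;> cases b <;> cases sign <;> simp [ind]
    have hb : ∀ P Q : Prop, |ind P * ind Q| ≤ 1 := fun P Q => by
      rw [← ind_and]; exact abs_ind_le _
    have main : expect (E.encBits keys.fst f) (fun cf =>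
        expect (seqLaw (ms.map (E.exLaw keys))) fun S => expect (E.encrypt keys.fst (ofBits m))
          fun c => expect (L.hyp s S) fun h =>
          ind (h (.cons keys.snd cf) = true) * ind (h (.cons keys.snd c) = true)) =
        expect (E.hypLaw L s keys ms) fun h => E.accept h keys f * E.accept h keys m := by
      rw [hypLaw, expect_bind _ _ fun h => E.abs_accept_mul_le h keys f m]
      rw [expect_comm _ _ fun a b => abs_expect_le _ fun c => abs_expect_le _ fun h => hb _ _]
      congr 1
      ext1 S
      have : ∀ cf, expect (E.encrypt keys.fst (ofBits m)) (fun c => expect (L.hyp s S) fun h =>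
          ind (h (.cons keys.snd cf) = true) * ind (h (.cons keys.snd c) = true)) =
          expect (L.hyp s S) fun h => ind (h (.cons keys.snd cf) = true) * E.accept h keys m := by
        intro cf
        rw [expect_comm _ _ fun a b => hb _ _]
        simp only [expect_const_mul]
        rfl
      simp only [this]
      rw [expect_comm (C := 1 * 1) _ _ fun a b => ?_]
      · simp only [expect_mul_const]
        rfl
      · rw [abs_mul]
        exact mul_le_mul (abs_ind_le _) (E.abs_accept_le _ _ _) (abs_nonneg _) zero_le_one
    rw [prob_bind]
    simp only [prob_bind]
    simp only [prob_eq_expect, expect_map _ _ fun b : Bool => abs_ind_le _, hind]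
    cases sign with
    | false => exact main
    | true =>
      simp only [cond_true]
      rw [← main]
      have hs : ∀ {α : Type} (p : PMF α) (f : α → ℝ), (∀ a, |f a| ≤ 1) →
          expect p (fun a => 1 - f a) = 1 - expect p f := fun p f hf => by
        rw [expect_sub (C := |1|) _ (fun _ => le_rfl) hf, expect_const]
      simp only [hs _ _ fun _ => hb _ _]
      simp only [hs _ _ fun _ => abs_expect_le _ fun _ => hb _ _]
      simp only [hs _ _ fun _ => abs_expect_le _ fun _ => abs_expect_le _ fun _ => hb _ _]
      simp only [hs _ _ fun _ => abs_expect_le _ fun _ => abs_expect_le _ fun _ => abs_expect_le _ fun _ => hb _ _]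
  rw [prob_bind]
  simp only [hkey]
  cases sign with
  | false => rfl
  | true =>
    simp only [cond_true]
    rw [expect_sub (C := |1|) _ (fun _ => le_rfl)
      fun _ => abs_expect_le _ fun _ => E.abs_accept_mul_le _ _ _ _, expect_const]
    rfl

end ORE

end PrivLearn

namespace PrivLearn

open Data

/-! ### The adversary's challenge -/

def realData (ms : Data) : Data := ofList (ms.toList.filter fun e => e.toBool)

/-- The smallest and the largest message. -/
def edgeData (l : Data) : Data :=
  .cons (ofList (l.toList.map fun _ => .nil)) (.cons (ofList (l.toList.map fun _ => .cons .nil .nil)) .nil)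

/-- Whether no message has its last bits in a pair of blocks. -/
def clearData (r j ms : Data) : Data :=
  ofBool ((realData ms).toList.all fun m => (ofBool (!(ofBool (
    (eqData (ofList (m.toList.drop r.toList.length)) j.fst).toBool ||
    (eqData (ofList (m.toList.drop r.toList.length)) j.snd).toBool)).toBool)).toBool)

def freshData (l ms t : Data) : Data :=
  nodupData (ofList (t.toList ++ (ofList ((realData ms).toList ++ (edgeData l).toList)).toList))

/-- The message to be compared with, followed by the pair of challenge messages. -/
def roleData (b w : Data) : Data :=
  bif (ofBool (b.snd.fst.toBool ^^ b.fst.toBool)).toBool then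
    .cons w.snd.snd.fst (.cons w.fst w.snd.fst)
  else .cons w.fst (.cons w.snd.fst w.snd.snd.fst)

/-- `b` consists of three coin tosses `[side, c₁, c₂]`. Refusing the case `c₁ = c₂ = true` makes `c₁
= false` twice as likely as `c₁ = true` among the admitted cases; these are the weights that
`sum_gain_eq` needs. -/
def legalData (l r j b ms t : Data) : Data :=
  ofBool ((ofBool ((ltData j.fst j.snd).toBool &&
      (ofBool (!(ofBool (b.snd.fst.toBool && b.snd.snd.fst.toBool)).toBool)).toBool)).toBool &&
    (ofBool ((clearData r j ms).toBool && (freshData l ms t).toBool)).toBool)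

/-- The smallest and the largest plaintext are requested as well, so that the challenge messages
always have requested messages on both sides. -/
def queryData (l ms o : Data) : Data :=
  sortData (.cons o.fst (ofList ((edgeData l).toList ++ (realData ms).toList)))

/-- The output `nil` is not a legal challenge, so in the bad cases both experiments end with the
guess 0 and nothing is gained or lost. -/
def challengeData (s l r j b ms t : Data) : Data :=
  bif (legalData l r j b ms t).toBool then
    .cons (.cons s (.cons ms (.cons (queryData l ms (roleData b (sortData t)))
        (.cons (roleData b (sortData t)).fst b.fst))))
      (.cons (roleData b (sortData t)).snd.fst (.cons (roleData b (sortData t)).snd.snd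
        (queryData l ms (roleData b (sortData t)))))
  else .nil

section

variable {f₁ f₂ f₃ f₄ f₅ f₆ f₇ : (Data → Bool) → Data → Data}

instance PolyTime.realData [PolyTime f₁] : PolyTime fun O x => realData (f₁ O x) := by
  unfold PrivLearn.realData; infer_instance

instance PolyTime.edgeData [PolyTime f₁] : PolyTime fun O x => edgeData (f₁ O x) := by
  unfold PrivLearn.edgeData; infer_instance

instance PolyTime.clearData [h₁ : PolyTime f₁] [h₂ : PolyTime f₂] [PolyTime f₃] :
    PolyTime fun O x => clearData (f₁ O x) (f₂ O x) (f₃ O x) := by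
  have : PolyTime fun O w => f₁ O w.fst := h₁.comp inferInstance
  have : PolyTime fun O w => f₂ O w.fst := h₂.comp inferInstance
  unfold PrivLearn.clearData; infer_instance

instance PolyTime.freshData [PolyTime f₁] [PolyTime f₂] [PolyTime f₃] :
    PolyTime fun O x => freshData (f₁ O x) (f₂ O x) (f₃ O x) := by
  unfold PrivLearn.freshData; infer_instance

instance PolyTime.roleData [PolyTime f₁] [PolyTime f₂] :
    PolyTime fun O x => roleData (f₁ O x) (f₂ O x) := by
  unfold PrivLearn.roleData; infer_instance

instance PolyTime.legalData [PolyTime f₁] [PolyTime f₂] [PolyTime f₃] [PolyTime f₄] [PolyTime f₅]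
    [PolyTime f₆] :
    PolyTime fun O x => legalData (f₁ O x) (f₂ O x) (f₃ O x) (f₄ O x) (f₅ O x) (f₆ O x) := by
  unfold PrivLearn.legalData; infer_instance

instance PolyTime.queryData [PolyTime f₁] [PolyTime f₂] [PolyTime f₃] :
    PolyTime fun O x => queryData (f₁ O x) (f₂ O x) (f₃ O x) := by
  unfold PrivLearn.queryData; infer_instance

instance PolyTime.challengeData [PolyTime f₁] [PolyTime f₂] [PolyTime f₃] [PolyTime f₄]
    [PolyTime f₅] [PolyTime f₆] [PolyTime f₇] : PolyTime fun O x =>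
      challengeData (f₁ O x) (f₂ O x) (f₃ O x) (f₄ O x) (f₅ O x) (f₆ O x) (f₇ O x) := by
  unfold PrivLearn.challengeData; infer_instance

end

theorem bitsVal_replicate_false (l : ℕ) : bitsVal (List.replicate l false) = 0 := by
  induction l with
  | zero => rfl
  | succ l ih => simp [List.replicate_succ, bitsVal, ih]

theorem bitsVal_replicate_true (l : ℕ) : bitsVal (List.replicate l true) + 1 = 2 ^ l := by
  induction l with
  | zero => rfl
  | succ l ih => simp [List.replicate_succ, bitsVal, pow_succ]; omega

theorem bitsVal_replicate_false_le (m : List Bool) :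
    bitsVal (List.replicate m.length false) ≤ bitsVal m := by
  rw [bitsVal_replicate_false]; exact Nat.zero_le _

theorem bitsVal_le_replicate_true (m : List Bool) :
    bitsVal m ≤ bitsVal (List.replicate m.length true) := by
  have := bitsVal_lt m
  have := bitsVal_replicate_true m.length
  omega

/-- The list starts below `x`, ends above `y` and has nothing in between, so at some place it jumps
over the whole interval. -/
theorem exists_gap {α : Type*} {f : α → ℕ} {S : List α} {a b : α} {x y : ℕ}
    (ha : a ∈ S) (hb : b ∈ S) (hax : f a < x) (hyb : y < f b)
    (hS : S.Pairwise fun a b => f a < f b) (hxy : x ≤ y) (h : ∀ c ∈ S, f c < x ∨ y < f c) :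
    ∃ (i : ℕ) (hi : i + 1 < S.length), f S[i] < x ∧ y < f S[i + 1] := by
  induction S generalizing a with
  | nil => simp at ha
  | cons c S ih =>
    have hc : f c < x := by
      rcases List.mem_cons.1 ha with rfl | ha
      · exact hax
      · have := (List.pairwise_cons.1 hS).1 a ha; omega
    have hbS : b ∈ S := by
      rcases List.mem_cons.1 hb with rfl | hb
      · omega
      · exact hb
    cases S with
    | nil => simp at hbS
    | cons d S =>
      rcases h d (by simp) with hd | hd
      · obtain ⟨i, hi, h₁, h₂⟩ := ih (a := d) (by simp) hbS hd (List.pairwise_cons.1 hS).2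
          fun e he => h e (List.mem_cons_of_mem _ he)
        exact ⟨i + 1, by simpa using hi, h₁, h₂⟩
      · exact ⟨0, by simp, hc, hd⟩

theorem legalChallenge {l : ℕ} {mL mR a b : List Bool} {S : List (List Bool)}
    (hL : mL.length = l) (hR : mR.length = l) (hl : ∀ c ∈ S, c.length = l)
    (hS : S.Pairwise fun a b => bitsVal a < bitsVal b) (hlt : bitsVal mL < bitsVal mR)
    (h : ∀ c ∈ S, bitsVal c < bitsVal mL ∨ bitsVal mR < bitsVal c)
    (ha : a ∈ S) (hb : b ∈ S) (haL : bitsVal a < bitsVal mL) (hbR : bitsVal mR < bitsVal b) :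
    LegalChallenge l (.cons (ofBits mL) (.cons (ofBits mR) (ofLists S))) := by
  have hval : ∀ m : List Bool, m.length = l → bitsVal m < 2 ^ l := by
    rintro m rfl
    exact bitsVal_lt m
  have henc : ∀ m : List Bool, ∀ hm : m.length = l,
      encodeMsg l ⟨bitsVal m, hval m hm⟩ = ofBits m := by
    rintro m rfl
    exact encodeMsg_msgOf m
  obtain ⟨i, hi, h₁, h₂⟩ := exists_gap ha hb haL hbR hS hlt.le h
  refine ⟨⟨bitsVal mL, hval _ hL⟩, ⟨bitsVal mR, hval _ hR⟩,
    S.pmap (fun c hc => ⟨bitsVal c, hval c hc⟩) hl, ?_, ?_, i, by simpa using hi, ?_⟩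
  · rw [henc _ hL, henc _ hR, List.map_pmap, List.pmap_congr_left (g := fun c _ => ofBits c)
      (H₂ := hl) S fun c _ hc _ => henc c hc, List.pmap_eq_map]
    rfl
  · rw [List.pairwise_pmap]
    exact hS.imp fun h _ _ => h
  · simpa using ⟨h₁, hlt, h₂⟩

namespace ORE

/-- No message of `ms` has its last bits in the pair `j` of blocks. -/
def Clear (r : ℕ) (ms : List (List Bool)) (j : List Bool × List Bool) : Prop :=
  ∀ m ∈ real ms, m.drop r ≠ j.1 ∧ m.drop r ≠ j.2

def edges (l : ℕ) : List (List Bool) := [List.replicate l false, List.replicate l true]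

theorem length_of_mem_edges {l : ℕ} {m : List Bool} (h : m ∈ edges l) : m.length = l := by
  simp [edges] at h; rcases h with rfl | rfl <;> simp

theorem realData_ofLists (ms : List (List Bool)) : realData (ofLists ms) = ofLists (real ms) := by
  rw [realData, toList_ofLists, List.filter_map, ofLists, real]
  congr 3
  ext1 m
  simp [toBool_eq]

theorem edgeData_unary (l : ℕ) : edgeData (unary l) = ofLists (edges l) := by
  simp only [edgeData, List.map_const', length_unary, edges, ofLists, ofList, List.map_cons,
    List.map_nil, ofBits, List.map_replicate]
  rfl

theorem toBool_clearData {u : Data} {d : ℕ} {j : List Bool × List Bool} {ms : List (List Bool)}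
    (h₁ : j.1.length = d) (h₂ : j.2.length = d)
    (h : ∀ m ∈ real ms, m.length = u.toList.length + d) :
    (clearData u (pairData j) (ofLists ms)).toBool = true ↔ Clear u.toList.length ms j := by
  rw [clearData, realData_ofLists, toBool_ofBool, toList_ofLists, List.all_map, List.all_eq_true]
  refine forall₂_congr fun m hm => ?_
  have hd : ofList (List.drop u.toList.length (ofBits m).toList) =
      ofBits (m.drop u.toList.length) := by
    rw [toList_ofBits, ← List.map_drop]; rfl
  have hl : (m.drop u.toList.length).length = d := by simp [h m hm]
  simp only [Function.comp_apply, pairData, fst_cons, snd_cons, hd, toBool_ofBool,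
    toBool_eqData (hl.trans h₁.symm), toBool_eqData (hl.trans h₂.symm)]
  simp

/-- The messages `t` are distinct, and different from those of `ms` and from the extreme ones. -/
def Fresh (l : ℕ) (ms t : List (List Bool)) : Prop := (t ++ (real ms ++ edges l)).Nodup

theorem toBool_freshData {l : ℕ} {ms t : List (List Bool)} (h : ∀ m ∈ real ms, m.length = l)
    (ht : ∀ m ∈ t, m.length = l) :
    (freshData (unary l) (ofLists ms) (ofLists t)).toBool = true ↔ Fresh l ms t := by
  have : freshData (unary l) (ofLists ms) (ofLists t) =
      nodupData (ofLists (t ++ (real ms ++ edges l))) := by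
    rw [freshData, realData_ofLists, edgeData_unary]
    simp only [toList_ofList, ofLists, List.map_append]
  rw [this, toBool_nodupData (k := l), Fresh]
  intro c hc
  simp only [List.mem_append] at hc
  rcases hc with hc | hc | hc
  · exact ht c hc
  · exact h c hc
  · exact length_of_mem_edges hc

/-- The messages whose encryptions the adversary asks for. -/
def queries (l : ℕ) (ms : List (List Bool)) (f : List Bool) : List (List Bool) :=
  sortBits (f :: (edges l ++ real ms))

open Classical in
-- After sorting, the fixed message is the least or the greatest of the three, hence never between
-- the two challenge messages. The bit `c₁ ^^ side` decides which of the two.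
theorem challengeData_eq {s l d : ℕ} {u : Data} {j : List Bool × List Bool} {side c₁ c₂ : Bool}
    {ms t : List (List Bool)} {w₁ w₂ w₃ : List Bool} (hj₁ : j.1.length = d) (hj₂ : j.2.length = d)
    (hl : u.toList.length + d = l) (hms : ∀ m ∈ real ms, m.length = l)
    (ht : ∀ m ∈ t, m.length = l) (hw : sortBits t = [w₁, w₂, w₃]) :
    challengeData (unary s) (unary l) u (pairData j) (ofBits [side, c₁, c₂]) (ofLists ms)
      (ofLists t) =
    if bitsVal j.1 < bitsVal j.2 ∧ ¬ (c₁ = true ∧ c₂ = true) ∧ Clear u.toList.length ms j ∧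
        Fresh l ms t then
      bif c₁ ^^ side then .cons (guessState s ms (queries l ms w₃) w₃ side)
        (.cons (ofBits w₁) (.cons (ofBits w₂) (ofLists (queries l ms w₃))))
      else .cons (guessState s ms (queries l ms w₁) w₁ side)
        (.cons (ofBits w₂) (.cons (ofBits w₃) (ofLists (queries l ms w₁))))
    else .nil := by
  have hlegal : (legalData (unary l) u (pairData j) (ofBits [side, c₁, c₂]) (ofLists ms)
      (ofLists t)).toBool = true ↔ bitsVal j.1 < bitsVal j.2 ∧ ¬ (c₁ = true ∧ c₂ = true) ∧
        Clear u.toList.length ms j ∧ Fresh l ms t := by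
    rw [← toBool_clearData hj₁ hj₂ fun m hm => (hms m hm).trans hl.symm,
      ← toBool_freshData hms ht]
    have hb : ∀ b c, (ofBits [side, b, c]).snd.fst = ofBool b := fun _ _ => rfl
    have hc : (ofBits [side, c₁, c₂]).snd.snd.fst = ofBool c₂ := rfl
    rw [legalData, hb, hc]
    have hp : (pairData j).fst = ofBits j.1 ∧ (pairData j).snd = ofBits j.2 := ⟨rfl, rfl⟩
    rw [hp.1, hp.2]
    simp only [toBool_ofBool, toBool_ltData (hj₁.trans hj₂.symm)]
    cases c₁ <;> cases c₂ <;> simp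
  have hperm := sortBits_perm t
  rw [hw] at hperm
  have hq : ∀ w ∈ t, ∀ p, queryData (unary l) (ofLists ms) (.cons (ofBits w) p) =
      ofLists (queries l ms w) := by
    intro w hwt p
    have : Data.cons (ofBits w) (ofList ((edgeData (unary l)).toList ++
        (realData (ofLists ms)).toList)) = ofLists (w :: (edges l ++ real ms)) := by
      rw [edgeData_unary, realData_ofLists]
      simp only [toList_ofList, ofLists, List.map_append, List.map_cons, ofList]
    rw [queryData, fst_cons, this, sortData_ofLists (k := l), queries]
    intro c hc
    simp only [List.mem_cons, List.mem_append] at hc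
    rcases hc with rfl | hc | hc
    · exact ht _ hwt
    · exact length_of_mem_edges hc
    · exact hms c hc
  rw [challengeData]
  by_cases h : (legalData (unary l) u (pairData j) (ofBits [side, c₁, c₂]) (ofLists ms)
      (ofLists t)).toBool = true
  · rw [h, if_pos (hlegal.1 h), cond_true, sortData_ofLists ht, hw]
    have hb₁ : (ofBits [side, c₁, c₂]).fst = ofBool side := rfl
    have hb₂ : (ofBits [side, c₁, c₂]).snd.fst = ofBool c₁ := rfl
    have hr : roleData (ofBits [side, c₁, c₂]) (ofLists [w₁, w₂, w₃]) =
        bif c₁ ^^ side then .cons (ofBits w₃) (.cons (ofBits w₁) (ofBits w₂)) else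
          .cons (ofBits w₁) (.cons (ofBits w₂) (ofBits w₃)) := by
      rw [roleData, hb₁, hb₂]; simp only [toBool_ofBool]; rfl
    rw [hr, hb₁]
    cases c₁ ^^ side
    · simp only [cond_false, hq w₁ (hperm.mem_iff.1 (by simp)), fst_cons, snd_cons, guessState]
    · simp only [cond_true, hq w₃ (hperm.mem_iff.1 (by simp)), fst_cons, snd_cons, guessState]
  · rw [if_neg fun h' => h (hlegal.2 h'), Bool.eq_false_iff.2 h, cond_false]

end ORE

end PrivLearn

namespace PrivLearn

open Data

theorem sortBits_eq {l t : List (List Bool)} (h : l.Perm t)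
    (hl : l.Pairwise fun a b => bitsVal a < bitsVal b) {k : ℕ} (hk : ∀ c ∈ t, c.length = k) :
    sortBits t = l := by
  have hp : (sortBits t).Perm l := (sortBits_perm t).trans h.symm
  refine hp.eq_of_pairwise (le := fun a b => bitsVal a ≤ bitsVal b) ?_ (pairwise_sortBits t)
    (hl.imp fun h => h.le)
  intro a b ha hb h₁ h₂
  refine bitsVal_injective ?_ (le_antisymm h₁ h₂)
  rw [hk a ((sortBits_perm t).mem_iff.1 ha), hk b (h.mem_iff.1 hb)]

/-- Bits are stored least significant first, so the last bits are the leading ones, and strings of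
equal length that agree in them form an interval. -/
theorem bitsVal_drop {r : ℕ} {m : List Bool} (h : r ≤ m.length) :
    bitsVal (m.drop r) = bitsVal m / 2 ^ r := by
  have h₁ : (m.take r).length = r := by simp [h]
  conv_rhs => rw [← List.take_append_drop r m, bitsVal_append]
  have h₂ := bitsVal_lt (m.take r)
  rw [h₁] at h₂ ⊢
  rw [Nat.add_mul_div_left _ _ (by positivity), Nat.div_eq_of_lt h₂, Nat.zero_add]

namespace ORE

variable (E : ORE)

/-! ### The gain of a challenge -/

open Classical in
/-- The guess of the adversary that learns with `L`, when its challenge and state are `q`. -/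
def reply (L : Learner) (s l : ℕ) (b : Bool) (q : Data) : PMF Bool :=
  if LegalChallenge l q.snd then
    (E.keyLaw s l).bind fun keys =>
    (E.encryptAll keys.fst q.snd.snd.snd.toList).bind fun cs =>
    (E.encrypt keys.fst (if b then q.snd.snd.fst else q.snd.fst)).bind fun c =>
    (guessKernel L (.cons q.fst (.cons keys.snd (.cons (.ofList cs) c)))).map Data.toBool
  else PMF.pure false

def gain (L : Learner) (s l : ℕ) (q : Data) : ℝ :=
  prob (E.reply L s l false q) {true} - prob (E.reply L s l true q) {true}

theorem abs_gain_le (L : Learner) (s l : ℕ) (q : Data) : |E.gain L s l q| ≤ 1 := by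
  rw [gain, abs_le]
  have h₁ := prob_nonneg (E.reply L s l false q) {true}
  have h₂ := prob_nonneg (E.reply L s l true q) {true}
  have h₃ := prob_le_one (E.reply L s l false q) {true}
  have h₄ := prob_le_one (E.reply L s l true q) {true}
  constructor <;> linarith

theorem gain_nil (L : Learner) (s l : ℕ) : E.gain L s l .nil = 0 := by
  have h : ¬ LegalChallenge l Data.nil := by
    rintro ⟨mL, mR, ms, h, _⟩
    cases h
  rw [gain, reply, reply, snd_nil, if_neg h, if_neg h, sub_self]

theorem queries_perm (l : ℕ) (ms : List (List Bool)) (f : List Bool) :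
    (queries l ms f).Perm
      (f :: List.replicate l false :: List.replicate l true :: real ms) := sortBits_perm _

/-- The content is that the challenge is legal; the value is then given by `prob_guess`. The fixed
message lies outside the interval from `mL` to `mR` by `hfm`, the extreme messages by `hmL` and
`hmR`, and the messages of the sample because they avoid both blocks and the blocks are adjacent. -/
theorem gain_eq (L : Learner) (s : ℕ) {l r : ℕ} (side : Bool) {j : List Bool × List Bool}
    {ms : List (List Bool)} {f mL mR : List Bool} (hr : r ≤ l)
    (hms : ∀ m ∈ real ms, m.length = l) (hf : f.length = l) (hL : mL.length = l)
    (hR : mR.length = l) (hj₁ : j.1.length = l - r) (hj₂ : j.2.length = l - r)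
    (hj : bitsVal j.2 = bitsVal j.1 + 1) (hLj : mL.drop r = j.1 ∨ mL.drop r = j.2)
    (hRj : mR.drop r = j.1 ∨ mR.drop r = j.2) (hlt : bitsVal mL < bitsVal mR)
    (hfm : bitsVal f < bitsVal mL ∨ bitsVal mR < bitsVal f) (hc : Clear r ms j)
    (hn : (f :: (real ms ++ edges l)).Nodup) (hmL : mL ∉ edges l) (hmR : mR ∉ edges l) :
    E.gain L s l (.cons (guessState s ms (queries l ms f) f side)
      (.cons (ofBits mL) (.cons (ofBits mR) (ofLists (queries l ms f))))) =
    bif side then E.acceptBoth L s l ms f mR - E.acceptBoth L s l ms f mL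
      else E.acceptBoth L s l ms f mL - E.acceptBoth L s l ms f mR := by
  have hperm := queries_perm l ms f
  have hlen : ∀ c ∈ queries l ms f, c.length = l := by
    intro c hcm
    have := hperm.mem_iff.1 hcm
    simp only [List.mem_cons] at this
    rcases this with rfl | rfl | rfl | h
    · exact hf
    · simp
    · simp
    · exact hms c h
  have hnod : (queries l ms f).Nodup := by
    refine hperm.nodup_iff.2 (List.Perm.nodup_iff ?_ |>.1 hn)
    exact List.Perm.cons _ List.perm_append_comm
  have hlegal : LegalChallenge l (.cons (ofBits mL) (.cons (ofBits mR)
      (ofLists (queries l ms f)))) := by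
    have h0 : bitsVal (List.replicate l false) < bitsVal mL := by
      subst hL
      refine lt_of_le_of_ne (bitsVal_replicate_false_le mL) fun h => hmL ?_
      rw [← bitsVal_injective (by simp) h]
      simp [edges]
    have h1 : bitsVal mR < bitsVal (List.replicate l true) := by
      subst hR
      refine lt_of_le_of_ne (bitsVal_le_replicate_true mR) fun h => hmR ?_
      rw [bitsVal_injective (by simp) h]
      simp [edges]
    refine legalChallenge hL hR hlen ?_ hlt (fun c hcm => ?_)
      (a := List.replicate l false) (b := List.replicate l true)
      (hperm.mem_iff.2 (by simp)) (hperm.mem_iff.2 (by simp)) h0 h1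
    · refine pairwise_sortBits_lt (k := l) (fun c hc => ?_) ?_
      · exact hlen c ((sortBits_perm _).mem_iff.2 hc)
      · exact (sortBits_perm _).nodup_iff.1 hnod
    · have := hperm.mem_iff.1 hcm
      simp only [List.mem_cons] at this
      rcases this with rfl | rfl | rfl | h
      · exact hfm
      · exact Or.inl h0
      · exact Or.inr h1
      -- A message of the sample between `mL` and `mR` would have its leading part between `j.1` and
      -- `j.2`, which are consecutive numbers; so it would lie in one of the two blocks, against
      -- `Clear`.
      · by_contra! hcon
        have hcl := hms c h
        have e₁ := Nat.div_le_div_right (c := 2 ^ r) hcon.1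
        have e₂ := Nat.div_le_div_right (c := 2 ^ r) hcon.2
        rw [← bitsVal_drop (hr.trans_eq hL.symm), ← bitsVal_drop (hr.trans_eq hcl.symm)] at e₁
        rw [← bitsVal_drop (hr.trans_eq hR.symm), ← bitsVal_drop (hr.trans_eq hcl.symm)] at e₂
        have e₃ : bitsVal j.1 ≤ bitsVal (mL.drop r) := by rcases hLj with h | h <;> rw [h]; omega
        have e₄ : bitsVal (mR.drop r) ≤ bitsVal j.2 := by rcases hRj with h | h <;> rw [h]; omega
        have hdl : (c.drop r).length = l - r := by simp [hcl]
        have : bitsVal (c.drop r) = bitsVal j.1 ∨ bitsVal (c.drop r) = bitsVal j.2 := by omega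
        rcases this with h' | h'
        · exact (hc c h).1 (bitsVal_injective (hdl.trans hj₁.symm) h')
        · exact (hc c h).2 (bitsVal_injective (hdl.trans hj₂.symm) h')
  have hms' : ∀ m ∈ ms, m ≠ [] → m.length = f.length := fun m hm h0 =>
    (hms m (mem_real.2 ⟨hm, h0⟩)).trans hf.symm
  have hlen' : ∀ c ∈ queries l ms f, c.length = f.length := fun c hc => (hlen c hc).trans hf.symm
  have hlegal' : LegalChallenge l (Data.cons (guessState s ms (queries l ms f) f side)
      (.cons (ofBits mL) (.cons (ofBits mR) (ofLists (queries l ms f))))).snd := hlegal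
  rw [gain, reply, reply, if_pos hlegal', if_pos hlegal']
  simp only [snd_cons, fst_cons, toList_ofLists, if_true, Bool.false_eq_true, if_false]
  rw [E.prob_guess L s l side hperm hnod hlen' hms', E.prob_guess L s l side hperm hnod hlen' hms']
  cases side
  · rfl
  · simp only [cond_true]; ring

/-- Write F for `acceptBoth`, α = F(w₁, w₂) - F(w₁, w₃) and β = F(w₃, w₁) - F(w₃, w₂). For `side =
false` the four cases of `(c₁, c₂)` contribute α, α, β and 0, and 2α + β = 2F(w₁, w₂) - F(w₁, w₃) -
F(w₂, w₃). For `side = true` the signs are reversed and α occurs once, β twice. -/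
theorem sum_gain_eq (L : Learner) (s : ℕ) {l r : ℕ} (side : Bool) {j : List Bool × List Bool}
    {ms t : List (List Bool)} {w₁ w₂ w₃ : List Bool} (hr : r ≤ l)
    (hms : ∀ m ∈ real ms, m.length = l)
    (ht : ∀ m ∈ t, m.length = l) (hj₁ : j.1.length = l - r) (hj₂ : j.2.length = l - r)
    (hj : bitsVal j.2 = bitsVal j.1 + 1)
    (htj : ∀ m ∈ t, m.drop r = j.1 ∨ m.drop r = j.2) (hw : sortBits t = [w₁, w₂, w₃])
    (hc : Clear r ms j) (hn : Fresh l ms t) :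
    (∑ c₁ : Bool, ∑ c₂ : Bool, E.gain L s l (challengeData (unary s) (unary l) (unary r)
      (pairData j) (ofBits [side, c₁, c₂]) (ofLists ms) (ofLists t))) =
    bif side then 2 * E.acceptBoth L s l ms w₂ w₃ - E.acceptBoth L s l ms w₁ w₂ -
        E.acceptBoth L s l ms w₁ w₃
      else 2 * E.acceptBoth L s l ms w₁ w₂ - E.acceptBoth L s l ms w₁ w₃ -
        E.acceptBoth L s l ms w₂ w₃ := by
  have hperm := sortBits_perm t
  have htn : t.Nodup := (List.nodup_append.1 hn).1
  have hlt := pairwise_sortBits_lt ht htn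
  rw [hw] at hperm hlt
  simp only [List.pairwise_cons, List.mem_cons, forall_eq_or_imp, List.not_mem_nil, false_imp_iff,
    implies_true, and_true] at hlt
  obtain ⟨⟨h₁₂, h₁₃⟩, h₂₃, -⟩ := hlt
  have m₁ : w₁ ∈ t := hperm.mem_iff.1 (by simp)
  have m₂ : w₂ ∈ t := hperm.mem_iff.1 (by simp)
  have m₃ : w₃ ∈ t := hperm.mem_iff.1 (by simp)
  have hnf : ∀ w ∈ t, (w :: (real ms ++ edges l)).Nodup := fun w hwt => by
    refine List.nodup_cons.2 ⟨fun h => ?_, (List.nodup_append.1 hn).2.1⟩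
    exact (List.nodup_append.1 hn).2.2 w hwt w h rfl
  have hedge : ∀ w ∈ t, w ∉ edges l := fun w hwt h =>
    (List.nodup_append.1 hn).2.2 w hwt w (List.mem_append_right _ h) rfl
  have hlen : (unary r).toList.length + (l - r) = l := by rw [length_unary]; omega
  have hα := E.gain_eq L s side hr hms (ht _ m₁) (ht _ m₂) (ht _ m₃) hj₁ hj₂ hj (htj _ m₂)
    (htj _ m₃) h₂₃ (Or.inl h₁₂) hc (hnf _ m₁) (hedge _ m₂) (hedge _ m₃)
  have hβ := E.gain_eq L s side hr hms (ht _ m₃) (ht _ m₁) (ht _ m₂) hj₁ hj₂ hj (htj _ m₁)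
    (htj _ m₂) h₁₂ (Or.inr h₂₃) hc (hnf _ m₃) (hedge _ m₁) (hedge _ m₂)
  have hjlt : bitsVal j.1 < bitsVal j.2 := by omega
  simp only [Fintype.sum_bool, challengeData_eq hj₁ hj₂ hlen hms ht hw, length_unary, hjlt, hc, hn]
  rw [E.acceptBoth_comm L s l ms w₃ w₁, E.acceptBoth_comm L s l ms w₃ w₂] at hβ
  cases side
  · simp only [cond_false] at hα hβ
    simp [gain_nil, hα, hβ]
    ring
  · simp only [cond_true] at hα hβ
    simp [gain_nil, hα, hβ]
    ring

/-- The combination is symmetric in `a` and `b`, so their order does not matter; only `c` has to be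
on one side of both. If the messages are not fresh, the gains vanish while the combination may be as
large as 2, whence the last term on the left. -/
theorem le_sum_gain (L : Learner) (s : ℕ) {l r : ℕ} (side : Bool) {j : List Bool × List Bool}
    {ms t : List (List Bool)} {a b c : List Bool} (hr : r ≤ l) (hms : ∀ m ∈ real ms, m.length = l)
    (ht : ∀ m ∈ t, m.length = l) (hj₁ : j.1.length = l - r) (hj₂ : j.2.length = l - r)
    (hj : bitsVal j.2 = bitsVal j.1 + 1)
    (htj : ∀ m ∈ t, m.drop r = j.1 ∨ m.drop r = j.2) (hperm : [a, b, c].Perm t)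
    (hside : bif side then bitsVal c < bitsVal a ∧ bitsVal c < bitsVal b
      else bitsVal a < bitsVal c ∧ bitsVal b < bitsVal c) :
    ind (Clear r ms j) * (2 * E.acceptBoth L s l ms a b - E.acceptBoth L s l ms a c -
      E.acceptBoth L s l ms b c) - 2 * ind (¬ Fresh l ms t) ≤
    ∑ c₁ : Bool, ∑ c₂ : Bool, E.gain L s l (challengeData (unary s) (unary l) (unary r)
      (pairData j) (ofBits [side, c₁, c₂]) (ofLists ms) (ofLists t)) := by
  have hlen : (unary r).toList.length + (l - r) = l := by rw [length_unary]; omega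
  have hzero : ¬ (Clear r ms j ∧ Fresh l ms t) → ∑ c₁ : Bool, ∑ c₂ : Bool, E.gain L s l
      (challengeData (unary s) (unary l) (unary r)
      (pairData j) (ofBits [side, c₁, c₂]) (ofLists ms) (ofLists t)) = 0 := by
    intro h
    have hsl : (sortBits t).length = 3 :=
      ((sortBits_perm t).trans hperm.symm).length_eq
    obtain ⟨w₁, w₂, w₃, hw⟩ := List.length_eq_three.1 hsl
    simp only [challengeData_eq hj₁ hj₂ hlen hms ht hw, length_unary, h, and_false, if_false,
      gain_nil, Finset.sum_const_zero]
  by_cases hc : Clear r ms j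
  · by_cases hn : Fresh l ms t
    · rw [ind_true hc, ind_false (not_not.2 hn), one_mul, mul_zero, sub_zero]
      have htn : [a, b, c].Nodup := hperm.nodup_iff.2 (List.nodup_append.1 hn).1
      have hab : bitsVal a ≠ bitsVal b := fun h => by
        have := bitsVal_injective ((ht a (hperm.mem_iff.1 (by simp))).trans
          (ht b (hperm.mem_iff.1 (by simp))).symm) h
        simp [this] at htn
      have key := fun w₁ w₂ w₃ hw => E.sum_gain_eq L s (w₁ := w₁) (w₂ := w₂) (w₃ := w₃) side hr hms
        ht hj₁ hj₂ hj htj hw hc hn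
      have hsw : [b, a, c].Perm t := (List.Perm.swap _ _ _).trans hperm
      have hrot : [c, a, b].Perm t := (List.perm_append_comm (l₁ := [c]) (l₂ := [a, b])).trans hperm
      have hrot' : [c, b, a].Perm t :=
        (List.perm_append_comm (l₁ := [c]) (l₂ := [b, a])).trans hsw
      cases side
      · simp only [cond_false] at hside key
        rcases lt_or_gt_of_ne hab with h | h
        · rw [key a b c (sortBits_eq hperm (by simp [h, hside]) ht)]
        · rw [key b a c (sortBits_eq hsw (by simp [h, hside]) ht), E.acceptBoth_comm L s l ms b a]
          linarith
      · simp only [cond_true] at hside key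
        rw [E.acceptBoth_comm L s l ms a c, E.acceptBoth_comm L s l ms b c]
        rcases lt_or_gt_of_ne hab with h | h
        · rw [key c a b (sortBits_eq hrot (by simp [h, hside]) ht)]
        · rw [key c b a (sortBits_eq hrot' (by simp [h, hside]) ht), E.acceptBoth_comm L s l ms b a]
          linarith
    · rw [hzero fun h => hn h.2, ind_true hc, ind_true hn]
      have h₁ := E.acceptBoth_le_one L s l ms a b
      have h₂ := E.acceptBoth_nonneg L s l ms a c
      have h₃ := E.acceptBoth_nonneg L s l ms b c
      linarith
  · rw [hzero fun h => hc h.1, ind_false hc, zero_mul]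
    have := ind_nonneg (¬ Fresh l ms t)
    linarith

end ORE

end PrivLearn

/-! ### Random challenges: messages, blocks and parameters drawn by the adversary. -/

namespace PrivLearn

open Data

/-- The list `M` with the entry at a position replaced by the mark of the junk example. -/
def eraseData (u M : Data) : Data :=
  ofList ((ofList (M.toList.take u.toList.length)).toList ++
    (bif (ofList (M.toList.drop u.toList.length)).toBool then
      Data.cons .nil (ofList (M.toList.drop u.toList.length)).snd else .nil).toList)

theorem eraseData_ofLists (u : Data) (ms : List (List Bool)) :
    eraseData u (ofLists ms) = ofLists (ms.set u.toList.length []) := by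
  have key : ∀ (n : ℕ) (l : List Data), ofList ((ofList (l.take n)).toList ++
      (bif (ofList (l.drop n)).toBool then Data.cons .nil (ofList (l.drop n)).snd else
        .nil).toList) = ofList (l.set n .nil) := by
    intro n l
    induction l generalizing n with
    | nil => simp
    | cons a l ih =>
      cases n with
      | zero => simp
      | succ n => simpa using ih n
  rw [eraseData, toList_ofLists, key, ofLists, List.map_set]
  rfl

/-- Messages with given last bits: the first two, or the last two, of the three agree there. -/
def tripleData (j b a₁ a₂ a₃ : Data) : Data :=
  .cons (ofList (a₃.toList ++ j.snd.toList)) (.cons (ofList (a₂.toList ++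
    (bif b.fst.toBool then j.snd else j.fst).toList)) (.cons (ofList (a₁.toList ++ j.fst.toList))
      .nil))

def triple (j : List Bool × List Bool) (side : Bool) (a₁ a₂ a₃ : List Bool) : List (List Bool) :=
  [a₃ ++ j.2, a₂ ++ (bif side then j.2 else j.1), a₁ ++ j.1]

theorem tripleData_eq (j : List Bool × List Bool) (side : Bool) (l a₁ a₂ a₃ : List Bool) :
    tripleData (pairData j) (ofBits (side :: l)) (ofBits a₁) (ofBits a₂) (ofBits a₃) =
      ofLists (triple j side a₁ a₂ a₃) := by
  have : (ofBits (side :: l)).fst = ofBool side := rfl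
  rw [tripleData, this]
  cases side <;> simp [pairData, triple, ofLists, ofBits]

instance PolyTime.eraseData {f₁ f₂ : (Data → Bool) → Data → Data} [PolyTime f₁] [PolyTime f₂] :
    PolyTime fun O x => eraseData (f₁ O x) (f₂ O x) := by
  unfold PrivLearn.eraseData; infer_instance

instance PolyTime.tripleData {f₁ f₂ f₃ f₄ f₅ : (Data → Bool) → Data → Data} [PolyTime f₁]
    [PolyTime f₂] [PolyTime f₃] [PolyTime f₄] [PolyTime f₅] :
    PolyTime fun O x => tripleData (f₁ O x) (f₂ O x) (f₃ O x) (f₄ O x) (f₅ O x) := by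
  unfold PrivLearn.tripleData; infer_instance

/-- The law of the challenge for the pair `j` of blocks, with example number `u` of a sample of
size `n` being replaced by the junk example; there are `r` random bits before the last ones. -/
def challengeLaw (s l r : ℕ) (j : Data) (n u : ℕ) : PMF Data :=
  (iid (coins l) n).bind fun ms => (coins r).bind fun a₁ => (coins r).bind fun a₂ =>
    (coins r).bind fun a₃ => (coins 3).map fun b =>
      challengeData (unary s) (unary l) (unary r) j (ofBits b) (ofLists (ms.set u []))
        (tripleData j (ofBits b) (ofBits a₁) (ofBits a₂) (ofBits a₃))

def restData (Q : Polynomial ℕ) (l n : Data) : Data :=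
  ofList (l.toList.drop (cellsData (unary (Q.eval n.toList.length))).fst.toList.length)

/-- For `v` past the end of the list this is `nil`, whose two components are equal; the strict
comparison in `legalData` then fails, and the challenge is void. -/
def blockPairData (Q : Polynomial ℕ) (n v : Data) : Data :=
  (ofList ((consecutiveData (cellsData (unary (Q.eval n.toList.length)))).toList.drop
    v.toList.length)).fst

instance PolyTime.restData {f₁ f₂ : (Data → Bool) → Data → Data} (Q : Polynomial ℕ) [PolyTime f₁]
    [PolyTime f₂] : PolyTime fun O x => restData Q (f₁ O x) (f₂ O x) := by
  unfold PrivLearn.restData; infer_instance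

instance PolyTime.blockPairData {f₁ f₂ : (Data → Bool) → Data → Data} (Q : Polynomial ℕ)
    [PolyTime f₁] [PolyTime f₂] : PolyTime fun O x => blockPairData Q (f₁ O x) (f₂ O x) := by
  unfold PrivLearn.blockPairData; infer_instance

/-- The input is `((1ˢ, 1ˡ), (1ⁿ, (1ᵘ, 1ᵛ)))`. -/
def challengeKernel (Q : Polynomial ℕ) (x : Data) : PMF Data :=
  (PMF.map ofList (seqLaw (x.snd.fst.toList.map fun _ =>
    PMF.map ofBits (coins x.fst.snd.toList.length)))).bind fun M =>
  (PMF.map ofBits (coins (restData Q x.fst.snd x.snd.fst).toList.length)).bind fun a₁ =>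
  (PMF.map ofBits (coins (restData Q x.fst.snd x.snd.fst).toList.length)).bind fun a₂ =>
  (PMF.map ofBits (coins (restData Q x.fst.snd x.snd.fst).toList.length)).bind fun a₃ =>
  (PMF.map ofBits (coins (unary 3).toList.length)).map fun b =>
    challengeData x.fst.fst x.fst.snd (restData Q x.fst.snd x.snd.fst)
      (blockPairData Q x.snd.fst x.snd.snd.snd) b (eraseData x.snd.snd.fst M)
      (tripleData (blockPairData Q x.snd.fst x.snd.snd.snd) b a₁ a₂ a₃)

set_option synthInstance.maxHeartbeats 400000 in
set_option synthInstance.maxSize 1000 in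
instance samplable_challengeKernel (Q : Polynomial ℕ) {f : (Data → Bool) → Data → Data}
    [hf : PolyTime f] : Samplable fun O x => challengeKernel Q (f O x) := by
  refine Samplable.comp (K := fun _ x => challengeKernel Q x) ?_ hf
  unfold challengeKernel; infer_instance

theorem challengeKernel_eq (Q : Polynomial ℕ) (s l n u v : ℕ) :
    challengeKernel Q (.cons (.cons (unary s) (unary l))
      (.cons (unary n) (.cons (unary u) (unary v)))) =
    challengeLaw s l (l - ORE.depth Q n)
      (((consecutive (cells (ORE.depth Q n))).map pairData)[v]?.getD .nil) n u := by
  have hfst : (ofLists (cells (ORE.depth Q n))).fst.toList.length = ORE.depth Q n := by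
    have h0 : 0 < (cells (ORE.depth Q n)).length := by rw [length_cells]; positivity
    cases hc : cells (ORE.depth Q n) with
    | nil => rw [hc] at h0; simp at h0
    | cons c cs =>
      have := length_of_mem_cells (d := ORE.depth Q n) (c := c) (by simp [hc])
      simp [ofLists, this]
  have hr : restData Q (unary l) (unary n) = unary (l - ORE.depth Q n) := by
    rw [restData, length_unary, cellsData_eq, length_unary,
      show Nat.clog 2 (Q.eval n) = ORE.depth Q n from rfl, hfst, unary, toList_ofList,
      List.drop_replicate]
    rfl
  have hj : blockPairData Q (unary n) (unary v) =
      ((consecutive (cells (ORE.depth Q n))).map pairData)[v]?.getD .nil := by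
    rw [blockPairData, length_unary, cellsData_eq, length_unary, length_unary,
      show Nat.clog 2 (Q.eval n) = ORE.depth Q n from rfl, consecutiveData_ofLists,
      toList_ofList]
    have key : ∀ (L : List Data), (ofList (L.drop v)).fst = L[v]?.getD .nil := by
      intro L
      rw [← List.head?_drop]
      cases L.drop v <;> rfl
    exact key _
  have hiid : PMF.map ofList (seqLaw ((unary n).toList.map fun _ => PMF.map ofBits (coins l))) =
      (iid (coins l) n).map ofLists := by
    rw [List.map_const', length_unary, ← iid_eq_seqLaw, iid_map, PMF.map_comp]
    rfl
  simp only [challengeKernel, fst_cons, snd_cons, length_unary, hr, hj, hiid, challengeLaw]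
  simp only [PMF.map, PMF.bind_bind, PMF.pure_bind, Function.comp_def, eraseData_ofLists,
    length_unary]

/-- The input is `(1ˢ, 1ˡ)`. The parameters of the challenge are random. -/
def chooseKernel (B Q : Polynomial ℕ) (x : Data) : PMF Data :=
  (PMF.map ofBits (coins (cellsData (unary (B.eval x.fst.toList.length))).fst.toList.length)).bind
    fun b₁ =>
  (PMF.map ofBits (coins (cellsData (unary (B.eval x.fst.toList.length))).fst.toList.length)).bind
    fun b₂ =>
  (PMF.map ofBits (coins (cellsData (unary (B.eval x.fst.toList.length))).fst.toList.length)).bind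
    fun b₃ => challengeKernel Q (.cons x (.cons
      (ofList ((indexData (cellsData (unary (B.eval x.fst.toList.length))) b₁).toList.map
        fun _ => .nil)) (.cons
      (ofList ((indexData (cellsData (unary (B.eval x.fst.toList.length))) b₂).toList.map
        fun _ => .nil))
      (ofList ((indexData (cellsData (unary (B.eval x.fst.toList.length))) b₃).toList.map
        fun _ => .nil)))))

instance samplable_chooseKernel (B Q : Polynomial ℕ) :
    Samplable fun _ x => chooseKernel B Q x := by
  unfold chooseKernel; infer_instance

end PrivLearn

/-! ### Products, coincidences and mean squares; the mean gain of a random challenge. -/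

namespace PrivLearn

open Data

section

variable {α β : Type}

theorem hasSum_expect (p : PMF α) {f : α → ℝ} {C : ℝ} (hf : ∀ a, |f a| ≤ C) :
    HasSum (fun a => (p a).toReal * f a) (expect p f) := (summable_expect p hf).hasSum

theorem expect_add_sub_two_mul (p : PMF α) {f g h : α → ℝ} {C : ℝ} (hf : ∀ a, |f a| ≤ C)
    (hg : ∀ a, |g a| ≤ C) (hh : ∀ a, |h a| ≤ C) :
    expect p (fun a => f a + h a - 2 * g a) = expect p f + expect p h - 2 * expect p g := by
  have := ((hasSum_expect p hf).add (hasSum_expect p hh)).sub ((hasSum_expect p hg).mul_left 2)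
  rw [← this.tsum_eq]
  exact tsum_congr fun a => by ring

theorem abs_mul_le_one {x y : ℝ} (hx : |x| ≤ 1) (hy : |y| ≤ 1) : |x * y| ≤ 1 := by
  rw [abs_mul]
  exact mul_le_one₀ hx (abs_nonneg _) hy

/-- Two independent pieces of randomness and a shared one. -/
theorem expect_mul_indep (q : PMF β) (p p' : PMF α) {f g : β → α → ℝ} (hf : ∀ b a, |f b a| ≤ 1)
    (hg : ∀ b a, |g b a| ≤ 1) :
    expect p (fun a => expect p' fun a' => expect q fun b => f b a * g b a') =
      expect q fun b => expect p (f b) * expect p' (g b) := by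
  have h₁ : ∀ a, expect p' (fun a' => expect q fun b => f b a * g b a') =
      expect q fun b => f b a * expect p' (g b) := by
    intro a
    rw [expect_comm (C := 1) _ _ fun a' b => abs_mul_le_one (hf b a) (hg b a')]
    simp only [expect_const_mul]
  simp only [h₁]
  rw [expect_comm (C := 1) _ _ fun a b => abs_mul_le_one (hf b a) (abs_expect_le _ (hg b))]
  simp only [expect_mul_const]

theorem expect_ind_mem_le [DecidableEq α] (p : PMF β) {g : β → α} (hg : Function.Injective g) {ρ : ℝ}
    (hρ : ∀ b, (p b).toReal ≤ ρ) (h0 : 0 ≤ ρ) (B : List α) :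
    expect p (fun b => ind (g b ∈ B)) ≤ B.length * ρ := by
  induction B with
  | nil => simp [ind, expect_const]
  | cons a B ih =>
    have h₁ : expect p (fun b => ind (g b = a)) ≤ ρ := by
      by_cases h : ∃ b, g b = a
      · obtain ⟨b, rfl⟩ := h
        have : expect p (fun b' => ind (g b' = g b)) = prob p {b} := by
          rw [prob_eq_expect]
          simp only [hg.eq_iff, Set.mem_singleton_iff]
        rw [this, prob_singleton]
        exact hρ b
      · have : ∀ b, ind (g b = a) = 0 := fun b => ind_false fun h' => h ⟨b, h'⟩
        simp only [this, expect_const]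
        exact h0
    have h₂ : expect p (fun b => ind (g b ∈ a :: B)) ≤
        expect p fun b => ind (g b = a) + ind (g b ∈ B) := by
      refine expect_mono (C := 1) (C' := 1 + 1) _ (fun _ => abs_ind_le _) (fun b => ?_) fun b _ => ?_
      · exact (abs_add_le _ _).trans (add_le_add (abs_ind_le _) (abs_ind_le _))
      · simp only [List.mem_cons]; exact ind_or_le _ _
    rw [expect_add _ (fun _ => abs_ind_le _) fun _ => abs_ind_le _] at h₂
    push_cast [List.length_cons]
    linarith

theorem expect_not_nodup_cons_le (p : PMF β) {g : β → α} (hg : Function.Injective g) {ρ : ℝ}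
    (hρ : ∀ b, (p b).toReal ≤ ρ) (h0 : 0 ≤ ρ) (B : List α) :
    expect p (fun b => ind (¬ (g b :: B).Nodup)) ≤ ind (¬ B.Nodup) + B.length * ρ := by
  classical
  have h : expect p (fun b => ind (¬ (g b :: B).Nodup)) ≤
      expect p fun b => ind (¬ B.Nodup) + ind (g b ∈ B) := by
    refine expect_mono (C := 1) (C' := 1 + 1) _ (fun _ => abs_ind_le _) (fun b => ?_) fun b _ => ?_
    · exact (abs_add_le _ _).trans (add_le_add (abs_ind_le _) (abs_ind_le _))
    · refine le_trans (ind_mono fun h => ?_) (ind_or_le _ _)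
      rw [List.nodup_cons] at h
      tauto
  rw [expect_add _ (fun _ => abs_ind_le _) fun _ => abs_ind_le _, expect_const] at h
  linarith [expect_ind_mem_le p hg hρ h0 B]

theorem expect_iid_not_nodup_le (p : PMF α) {ρ : ℝ} (hρ : ∀ b, (p b).toReal ≤ ρ) (h0 : 0 ≤ ρ)
    {B : List α} (hB : B.Nodup) (n : ℕ) :
    expect (iid p n) (fun xs => ind (¬ (xs ++ B).Nodup)) ≤ n * (n + B.length) * ρ := by
  induction n with
  | zero => simp [iid, expect_pure, hB, ind]
  | succ n ih =>
    -- The new element is drawn last, so that it is compared with a list that is already fixed.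
    have h : iid p (n + 1) = (iid p n).bind fun xs => p.map fun x => x :: xs := by
      rw [iid]
      exact PMF.bind_comm _ _ _
    rw [h, expect_bind _ _ fun _ => abs_ind_le _]
    have h₁ : expect (iid p n) (fun xs => expect (p.map fun x => x :: xs)
        fun xs => ind (¬ (xs ++ B).Nodup)) ≤
        expect (iid p n) fun xs => ind (¬ (xs ++ B).Nodup) + (n + B.length) * ρ := by
      refine expect_mono (C := 1) (C' := 1 + |(n + B.length) * ρ|) _
        (fun _ => abs_expect_le _ fun _ => abs_ind_le _)
        (fun b => (abs_add_le _ _).trans (add_le_add (abs_ind_le _) le_rfl)) fun xs hxs => ?_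
      rw [expect_map _ _ fun _ => abs_ind_le _]
      have := expect_not_nodup_cons_le p Function.injective_id hρ h0 (xs ++ B)
      rw [List.length_append, length_of_mem_support_iid hxs, Nat.cast_add] at this
      exact this
    rw [expect_add _ (fun _ => abs_ind_le _) fun _ => le_rfl, expect_const] at h₁
    refine h₁.trans ((add_le_add_left ih _).trans ?_)
    push_cast
    nlinarith [mul_nonneg (Nat.cast_nonneg (α := ℝ) n) h0]

theorem toReal_coins_apply_le (r : ℕ) (b : List Bool) : (coins r b).toReal ≤ (2⁻¹ : ℝ) ^ r := by
  by_cases h : b.length = r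
  · rw [coins_apply h]; simp
  · have : coins r b = 0 := by
      by_contra h0
      exact h (length_of_mem_support_coins ((PMF.mem_support_iff _ _).2 h0))
    rw [this]; simp

theorem expect_coins_three (f : List Bool → ℝ) (hf : ∀ b, |f b| ≤ 1) : expect (coins 3) f =
    (∑ a : Bool, ∑ b : Bool, ∑ c : Bool, f [a, b, c]) / 8 := by
  have h : ∀ (n : ℕ) (f : List Bool → ℝ), (∀ b, |f b| ≤ 1) → expect (coins (n + 1)) f =
      (∑ a : Bool, expect (coins n) fun l => f (a :: l)) / 2 := by
    intro n f hf
    rw [coins_succ, expect_bind _ _ hf, expect_coin, Fintype.sum_bool, expect_map _ _ hf,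
      expect_map _ _ hf, add_comm]
  have h0 : ∀ f : List Bool → ℝ, expect (coins 0) f = f [] := fun f => expect_pure _ _
  rw [h 2 f hf]
  simp only [h 1 _ fun _ => hf _, h 0 _ fun _ => hf _, h0, Fintype.sum_bool]
  ring

end

namespace ORE

variable (E : ORE)

/-! ### Blocks of last bits that the learner does not see -/

/-- The probability that `h` accepts an encryption of a random message with the last bits `j`. -/
def blockProb (h : Data → Bool) (keys : Data) (r : ℕ) (j : List Bool) : ℝ :=
  expect (coins r) fun a => E.accept h keys (a ++ j)

theorem abs_blockProb_le (h : Data → Bool) (keys : Data) (r : ℕ) (j : List Bool) :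
    |E.blockProb h keys r j| ≤ 1 := abs_expect_le _ fun _ => E.abs_accept_le _ _ _

/-- The square is used rather than the absolute value, because it expands into probabilities that
the hypothesis accepts two ciphertexts at once, and these are what a single-challenge adversary can
compare. -/
def spread (L : Learner) (s l r : ℕ) (j : List Bool × List Bool) (ms : List (List Bool)) : ℝ :=
  expect (E.keyLaw s l) fun keys => expect (E.hypLaw L s keys ms) fun h =>
    (E.blockProb h keys r j.1 - E.blockProb h keys r j.2) ^ 2

theorem spread_nonneg (L : Learner) (s l r : ℕ) (j : List Bool × List Bool)
    (ms : List (List Bool)) : 0 ≤ E.spread L s l r j ms :=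
  expect_nonneg _ fun _ => expect_nonneg _ fun _ => sq_nonneg _

theorem sq_sub_le {x y : ℝ} (hx : |x| ≤ 1) (hy : |y| ≤ 1) : |(x - y) ^ 2| ≤ 4 := by
  rw [abs_of_nonneg (sq_nonneg _)]
  have := abs_le.1 hx
  have := abs_le.1 hy
  nlinarith

theorem abs_spread_le (L : Learner) (s l r : ℕ) (j : List Bool × List Bool)
    (ms : List (List Bool)) : |E.spread L s l r j ms| ≤ 4 :=
  abs_expect_le _ fun _ => abs_expect_le _ fun _ =>
    sq_sub_le (E.abs_blockProb_le _ _ _ _) (E.abs_blockProb_le _ _ _ _)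

/-- The mean squared difference of the acceptance probabilities on two blocks not seen by the
learner, which gets a sample of size `n` with example number `u` replaced by the junk example. -/
def unseen (L : Learner) (s l r : ℕ) (j : List Bool × List Bool) (n u : ℕ) : ℝ :=
  expect (iid (coins l) n) fun ms =>
    ind (Clear r (ms.set u []) j) * E.spread L s l r j (ms.set u [])

def corr (L : Learner) (s l r : ℕ) (ms : List (List Bool)) (i j : List Bool) : ℝ :=
  expect (E.keyLaw s l) fun keys => expect (E.hypLaw L s keys ms) fun h =>
    E.blockProb h keys r i * E.blockProb h keys r j

/-- Given keys and hypothesis, the two random messages are independent, so the mean of the product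
factors into the two block probabilities. -/
theorem expect_acceptBoth (L : Learner) (s l r : ℕ) (ms : List (List Bool)) (i j : List Bool) :
    expect (coins r) (fun a => expect (coins r) fun b =>
      E.acceptBoth L s l ms (a ++ i) (b ++ j)) = E.corr L s l r ms i j := by
  have h : ∀ f : Data → (Data → Bool) → ℝ, (∀ k h, |f k h| ≤ 1) →
      expect (E.keyLaw s l) (fun keys => expect (E.hypLaw L s keys ms) (f keys)) =
      expect ((E.keyLaw s l).bind fun keys => (E.hypLaw L s keys ms).map fun h => (keys, h))
        fun z => f z.1 z.2 := by
    intro f hf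
    rw [expect_bind _ _ fun z : Data × (Data → Bool) => hf z.1 z.2]
    simp only [expect_map _ _ fun z : Data × (Data → Bool) => hf z.1 z.2]
  simp only [acceptBoth, corr]
  rw [h _ fun k h => abs_mul_le_one (E.abs_blockProb_le h k r i) (E.abs_blockProb_le h k r j)]
  simp only [fun a b => h _ fun k h => E.abs_accept_mul_le h k a b]
  exact expect_mul_indep (f := fun z : Data × (Data → Bool) => fun a => E.accept z.2 z.1 (a ++ i))
    (g := fun z : Data × (Data → Bool) => fun a => E.accept z.2 z.1 (a ++ j)) _ _ _
    (fun _ _ => E.abs_accept_le _ _ _) fun _ _ => E.abs_accept_le _ _ _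

theorem spread_eq (L : Learner) (s l r : ℕ) (ms : List (List Bool)) (j : List Bool × List Bool) :
    E.spread L s l r j ms = E.corr L s l r ms j.1 j.1 + E.corr L s l r ms j.2 j.2 -
      2 * E.corr L s l r ms j.1 j.2 := by
  have hb := fun (h : Data → Bool) (keys : Data) (i j : List Bool) =>
    abs_mul_le_one (E.abs_blockProb_le h keys r i) (E.abs_blockProb_le h keys r j)
  simp only [corr]
  rw [← expect_add_sub_two_mul (C := 1) _ (fun _ => abs_expect_le _ fun _ => hb _ _ _ _)
    (fun _ => abs_expect_le _ fun _ => hb _ _ _ _) fun _ => abs_expect_le _ fun _ => hb _ _ _ _]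
  rw [spread]
  congr 1
  ext1 keys
  rw [← expect_add_sub_two_mul (C := 1) _ (fun _ => hb _ _ _ _) (fun _ => hb _ _ _ _)
    fun _ => hb _ _ _ _]
  congr 1
  ext1 h
  ring

def tripleLaw (r : ℕ) : PMF (List Bool × List Bool × List Bool) :=
  (coins r).bind fun a => (coins r).bind fun b => (coins r).map fun c => (a, b, c)

theorem expect_tripleLaw (r : ℕ) {f : List Bool × List Bool × List Bool → ℝ} {C : ℝ}
    (hf : ∀ z, |f z| ≤ C) : expect (tripleLaw r) f =
      expect (coins r) fun a => expect (coins r) fun b => expect (coins r) fun c => f (a, b, c) := by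
  rw [tripleLaw, expect_bind _ _ hf]
  simp only [expect_bind _ _ hf, expect_map _ _ hf]

theorem mem_support_tripleLaw {r : ℕ} {z : List Bool × List Bool × List Bool}
    (h : z ∈ (tripleLaw r).support) :
    z.1.length = r ∧ z.2.1.length = r ∧ z.2.2.length = r := by
  simp only [tripleLaw, PMF.mem_support_bind_iff, PMF.mem_support_map_iff] at h
  obtain ⟨a, ha, b, hb, c, hc, rfl⟩ := h
  exact ⟨length_of_mem_support_coins ha, length_of_mem_support_coins hb,
    length_of_mem_support_coins hc⟩

/-- The three messages are added one after the other. Each has `r` random bits of its own and must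
avoid the strings already present, whose numbers are m + 2, m + 3 and m + 4 for a sample of m
messages; the sum is 3(m + 2) + 3. -/
theorem expect_not_fresh_le (l r : ℕ) (ms : List (List Bool)) (j : List Bool × List Bool)
    (side : Bool) : expect (tripleLaw r) (fun z => ind (¬ Fresh l ms (triple j side z.1 z.2.1 z.2.2)))
      ≤ ind (¬ (real ms ++ edges l).Nodup) + (3 * ((real ms).length + 2) + 3) * (2⁻¹ : ℝ) ^ r := by
  rw [expect_tripleLaw r fun _ => abs_ind_le _]
  have h0 : (0 : ℝ) ≤ 2⁻¹ ^ r := by positivity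
  have hlen : (real ms ++ edges l).length = (real ms).length + 2 := by simp [edges]
  have key := fun (j : List Bool) (B : List (List Bool)) =>
    expect_not_nodup_cons_le (coins r) (List.append_left_injective j) (toReal_coins_apply_le r) h0 B
  have step : ∀ {f : List Bool → ℝ} (j : List Bool) (B : List (List Bool)) (c : ℝ) (m : ℕ),
      B.length = m → (∀ a, |f a| ≤ 1) → (∀ a, f a ≤ ind (¬ ((a ++ j) :: B).Nodup) + c) →
      expect (coins r) f ≤ ind (¬ B.Nodup) + (m * (2⁻¹ : ℝ) ^ r + c) := by
    rintro f j B c _ rfl h₁ h₂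
    have h₃ : expect (coins r) f ≤
        expect (coins r) fun a => ind (¬ ((a ++ j) :: B).Nodup) + c :=
      expect_mono (C' := 1 + |c|) _ h₁ (fun _ => (abs_add_le _ _).trans
        (add_le_add (abs_ind_le _) le_rfl)) fun a _ => h₂ a
    rw [expect_add _ (fun _ => abs_ind_le _) fun _ => le_rfl, expect_const] at h₃
    linarith [key j B]
  refine (step j.1 (real ms ++ edges l) _ _ hlen (fun _ => abs_expect_le _ fun _ =>
    abs_expect_le _ fun _ => abs_ind_le _) fun a => step (bif side then j.2 else j.1)
    ((a ++ j.1) :: (real ms ++ edges l)) _ _ (by rw [List.length_cons, hlen])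
    (fun _ => abs_expect_le _ fun _ => abs_ind_le _) fun b =>
    step j.2 ((b ++ bif side then j.2 else j.1) :: (a ++ j.1) :: (real ms ++ edges l)) 0 _
      (by rw [List.length_cons, List.length_cons, hlen]) (fun _ => abs_ind_le _) fun c => ?_).trans ?_
  · rw [add_zero]; rfl
  · push_cast
    linarith

/-- Averaging `le_sum_gain` over the messages gives 2(corr₁₁ - corr₁₂) for `side = false`, where two
messages lie in the first block, and 2(corr₂₂ - corr₁₂) for `side = true`. The sum is twice
`spread`, and division by the 8 outcomes of three coins leaves 1/4. The terms for messages that are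
not fresh add up to (2 + 2)/8 = 1/2. -/
theorem expect_gain_triple_le (L : Learner) (s : ℕ) {l r : ℕ} {j : List Bool × List Bool}
    {ms : List (List Bool)} (hr : r ≤ l) (hms : ∀ m ∈ real ms, m.length = l)
    (hj₁ : j.1.length = l - r) (hj₂ : j.2.length = l - r) (hj : bitsVal j.2 = bitsVal j.1 + 1) :
    1 / 4 * (ind (Clear r ms j) * E.spread L s l r j ms) - 1 / 2 *
      (ind (¬ (real ms ++ edges l).Nodup) + (3 * ((real ms).length + 2) + 3) * (2⁻¹ : ℝ) ^ r) ≤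
    expect (tripleLaw r) fun z => expect (coins 3) fun b => E.gain L s l (challengeData (unary s)
      (unary l) (unary r) (pairData j) (ofBits b) (ofLists ms)
      (tripleData (pairData j) (ofBits b) (ofBits z.1) (ofBits z.2.1) (ofBits z.2.2))) := by
  have hF : ∀ a b, |E.acceptBoth L s l ms a b| ≤ 1 := fun a b => by
    rw [abs_of_nonneg (E.acceptBoth_nonneg L s l ms a b)]
    exact E.acceptBoth_le_one L s l ms a b
  have hH := fun (f : List Bool × List Bool × List Bool → List Bool × List Bool) =>
    hasSum_expect (tripleLaw r) fun z => hF (f z).1 (f z).2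
  have hI := fun side => hasSum_expect (tripleLaw r) fun z =>
    abs_ind_le (¬ Fresh l ms (triple j side z.1 z.2.1 z.2.2))
  have h₁₂ : ∀ i j, expect (tripleLaw r) (fun z => E.acceptBoth L s l ms (z.1 ++ i) (z.2.1 ++ j)) =
      E.corr L s l r ms i j := by
    intro i j
    rw [expect_tripleLaw _ fun _ => hF _ _]
    simp only [expect_const, expect_acceptBoth]
  have h₁₃ : ∀ i j, expect (tripleLaw r) (fun z => E.acceptBoth L s l ms (z.1 ++ i) (z.2.2 ++ j)) =
      E.corr L s l r ms i j := by
    intro i j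
    rw [expect_tripleLaw _ fun _ => hF _ _]
    simp only [expect_const, expect_acceptBoth]
  have h₂₃ : ∀ i j, expect (tripleLaw r) (fun z => E.acceptBoth L s l ms (z.2.1 ++ i) (z.2.2 ++ j)) =
      E.corr L s l r ms i j := by
    intro i j
    rw [expect_tripleLaw _ fun _ => hF _ _]
    simp only [expect_const, expect_acceptBoth]
  have hlow := (((((((((hH fun z => (z.1 ++ j.1, z.2.1 ++ j.1)).mul_left 2).sub
    (hH fun z => (z.1 ++ j.1, z.2.2 ++ j.2))).sub
    (hH fun z => (z.2.1 ++ j.1, z.2.2 ++ j.2))).mul_left (ind (Clear r ms j))).sub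
    ((hI false).mul_left 2)).add (((((hH fun z => (z.2.1 ++ j.2, z.2.2 ++ j.2)).mul_left 2).sub
    (hH fun z => (z.1 ++ j.1, z.2.1 ++ j.2))).sub
    (hH fun z => (z.1 ++ j.1, z.2.2 ++ j.2))).mul_left (ind (Clear r ms j)))).sub
    ((hI true).mul_left 2)).mul_left (1 / 8))
  simp only [h₁₂, h₁₃, h₂₃] at hlow
  have hgain := fun q => E.abs_gain_le L s l q
  refine le_trans ?_ (hasSum_le (fun z => ?_) hlow
    (hasSum_expect (tripleLaw r) fun z => abs_expect_le (coins 3) fun b => hgain _))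
  · have h₁ := expect_not_fresh_le l r ms j false
    have h₂ := expect_not_fresh_le l r ms j true
    rw [E.spread_eq]
    linarith
  · by_cases hz : z ∈ (tripleLaw r).support
    · obtain ⟨l₁, l₂, l₃⟩ := mem_support_tripleLaw hz
      have hlen : ∀ side, ∀ m ∈ triple j side z.1 z.2.1 z.2.2, m.length = l := by
        intro side m hm
        simp only [triple, List.mem_cons, List.not_mem_nil, or_false] at hm
        rcases hm with rfl | rfl | rfl
        · rw [List.length_append]; omega
        · rw [List.length_append]; cases side <;> simp only [cond_true, cond_false] <;> omega
        · rw [List.length_append]; omega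
      have hdrop : ∀ side, ∀ m ∈ triple j side z.1 z.2.1 z.2.2, m.drop r = j.1 ∨ m.drop r = j.2 := by
        intro side m hm
        simp only [triple, List.mem_cons, List.not_mem_nil, or_false] at hm
        rcases hm with rfl | rfl | rfl
        · right; rw [← l₃, List.drop_left]
        · rw [← l₂, List.drop_left]; cases side <;> simp
        · left; rw [← l₁, List.drop_left]
      have hlt : ∀ a b : List Bool, a.length = r → b.length = r →
          bitsVal (a ++ j.1) < bitsVal (b ++ j.2) := by
        intro a b ha hb
        have := bitsVal_lt a
        rw [bitsVal_append, bitsVal_append, hj, ha, hb]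
        rw [ha] at this
        rw [mul_add]
        omega
      have hL := E.le_sum_gain L s false hr hms (hlen false) hj₁ hj₂ hj (hdrop false)
        (a := z.1 ++ j.1) (b := z.2.1 ++ j.1) (c := z.2.2 ++ j.2)
        (List.reverse_perm _).symm ⟨hlt _ _ l₁ l₃, hlt _ _ l₂ l₃⟩
      have hR := E.le_sum_gain L s true hr hms (hlen true) hj₁ hj₂ hj (hdrop true)
        (a := z.2.1 ++ j.2) (b := z.2.2 ++ j.2) (c := z.1 ++ j.1)
        (List.Perm.swap _ _ _) ⟨hlt _ _ l₁ l₂, hlt _ _ l₁ l₃⟩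
      rw [E.acceptBoth_comm L s l ms _ (z.1 ++ j.1), E.acceptBoth_comm L s l ms _ (z.1 ++ j.1)] at hR
      rw [expect_coins_three _ fun _ => hgain _]
      simp only [tripleData_eq]
      rw [Fintype.sum_bool (fun side => _)]
      have hp : 0 ≤ (tripleLaw r z).toReal := ENNReal.toReal_nonneg
      refine le_trans (le_of_eq ?_) (mul_le_mul_of_nonneg_left
        (div_le_div_of_nonneg_right (add_le_add hR hL) (by norm_num : (0 : ℝ) ≤ 8)) hp)
      ring
    · rw [PMF.mem_support_iff, not_not] at hz
      simp [hz]

theorem real_set_sublist (ms : List (List Bool)) (u : ℕ) : (real (ms.set u [])).Sublist ms := by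
  induction ms generalizing u with
  | nil => simp [real]
  | cons m ms ih =>
    cases u with
    | zero => simp [real]
    | succ u =>
      by_cases hm : m = []
      · simpa [real, hm] using (ih u).cons []
      · simpa [real, hm] using (ih u).cons_cons m

/-- The mean gain of the adversary that picks the right parameters. -/
theorem le_expect_gain_challengeLaw (L : Learner) (s : ℕ) {l r : ℕ} {j : List Bool × List Bool}
    (n u : ℕ) (hr : r ≤ l) (hl : 1 ≤ l)
    (hj₁ : j.1.length = l - r) (hj₂ : j.2.length = l - r) (hj : bitsVal j.2 = bitsVal j.1 + 1) :
    1 / 4 * E.unseen L s l r j n u - 1 / 2 * ((n + 4) ^ 2 * (2⁻¹ : ℝ) ^ r) ≤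
      expect (challengeLaw s l r (pairData j) n u) (E.gain L s l) := by
  have hgain := fun q => E.abs_gain_le L s l q
  have hlaw : challengeLaw s l r (pairData j) n u = (iid (coins l) n).bind fun ms =>
      (tripleLaw r).bind fun z => (coins 3).map fun b => challengeData (unary s) (unary l) (unary r)
        (pairData j) (ofBits b) (ofLists (ms.set u []))
        (tripleData (pairData j) (ofBits b) (ofBits z.1) (ofBits z.2.1) (ofBits z.2.2)) := by
    simp only [challengeLaw, tripleLaw, PMF.map, PMF.bind_bind, PMF.pure_bind, Function.comp_def]
  rw [hlaw, expect_bind _ _ hgain]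
  simp only [expect_bind _ _ hgain, expect_map _ _ hgain]
  have hsub := fun ms => real_set_sublist ms u
  have hnod := expect_iid_not_nodup_le (coins l) (ρ := (2⁻¹ : ℝ) ^ r) (B := edges l)
    (fun b => (toReal_coins_apply_le l b).trans
      (pow_le_pow_of_le_one (by norm_num) (by norm_num) hr)) (by positivity) (by
      cases l with
      | zero => omega
      | succ l => simp [edges, List.replicate_succ]) n
  have h₁ := hasSum_expect (iid (coins l) n) (f := fun ms => ind (Clear r (ms.set u []) j) *
    E.spread L s l r j (ms.set u [])) (C := 4) fun ms => by
      rw [abs_mul]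
      have := E.abs_spread_le L s l r j (ms.set u [])
      have := abs_ind_le (Clear r (ms.set u []) j)
      nlinarith [abs_nonneg (ind (Clear r (ms.set u []) j)),
        abs_nonneg (E.spread L s l r j (ms.set u []))]
  have h₂ := hasSum_expect (iid (coins l) n) fun ms => abs_ind_le (¬ (ms ++ edges l).Nodup)
  have h₃ := hasSum_expect (iid (coins l) n) (f := fun _ => (3 * (n + 2) + 3) * (2⁻¹ : ℝ) ^ r)
    fun _ => le_rfl
  rw [expect_const] at h₃
  refine le_trans ?_ (hasSum_le (fun ms => ?_)
    ((h₁.mul_left (1 / 4)).sub ((h₂.add h₃).mul_left (1 / 2)))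
    (hasSum_expect (iid (coins l) n) fun z => abs_expect_le _ fun _ => abs_expect_le _ fun b =>
      hgain _))
  · have h0 : (0 : ℝ) ≤ 2⁻¹ ^ r := by positivity
    have hl2 : ((edges l).length : ℝ) = 2 := by simp [edges]
    rw [hl2] at hnod
    rw [unseen]
    nlinarith [mul_nonneg (Nat.cast_nonneg (α := ℝ) n) h0]
  · by_cases hz : ms ∈ (iid (coins l) n).support
    · have hreal : ∀ m ∈ real (ms.set u []), m.length = l := fun m hm =>
        length_of_mem_support_coins (mem_support_of_mem_support_iid hz m ((hsub ms).subset hm))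
      have hp : 0 ≤ (iid (coins l) n ms).toReal := ENNReal.toReal_nonneg
      have h := E.expect_gain_triple_le L s hr hreal hj₁ hj₂ hj
      have hle : ((real (ms.set u [])).length : ℝ) ≤ n := by
        rw [← length_of_mem_support_iid hz]
        exact_mod_cast (hsub ms).length_le
      have hind : ind (¬ (real (ms.set u []) ++ edges l).Nodup) ≤ ind (¬ (ms ++ edges l).Nodup) :=
        ind_mono fun h h' => h (h'.sublist ((hsub ms).append_right _))
      have h0 : (0 : ℝ) ≤ 2⁻¹ ^ r := by positivity
      refine le_trans ?_ (mul_le_mul_of_nonneg_left h hp)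
      have : (3 * ((real (ms.set u [])).length + 2) + 3) * (2⁻¹ : ℝ) ^ r ≤
          (3 * (n + 2) + 3) * (2⁻¹ : ℝ) ^ r := by gcongr
      nlinarith
    · rw [PMF.mem_support_iff, not_not] at hz
      simp [hz]

theorem expect_gain_challengeLaw_nil (L : Learner) (s l r n u : ℕ) :
    expect (challengeLaw s l r .nil n u) (E.gain L s l) = 0 := by
  have h : ∀ q ∈ (challengeLaw s l r .nil n u).support, E.gain L s l q = 0 := by
    intro q hq
    simp only [challengeLaw, PMF.mem_support_bind_iff, PMF.mem_support_map_iff] at hq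
    obtain ⟨_, _, _, _, _, _, _, _, _, _, rfl⟩ := hq
    exact E.gain_nil L s l
  rw [expect_congr _ h, expect_const]

end ORE

end PrivLearn

/-! ### From security to unseen blocks: guessing the parameters of the challenge. -/

namespace PrivLearn

open Data Filter

theorem mem_consecutive_cells {d : ℕ} {j : List Bool × List Bool} (h : j ∈ consecutive (cells d)) :
    ∃ v, v + 1 < 2 ^ d ∧ (consecutive (cells d))[v]? = some j ∧
      j = (msgBits d v, msgBits d (v + 1)) := by
  obtain ⟨v, hv⟩ := List.mem_iff_getElem?.1 h
  have hv' := hv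
  rw [consecutive, List.getElem?_zip_eq_some, List.getElem?_tail] at hv'
  have hlt := (List.getElem?_eq_some_iff.1 hv'.2).1
  rw [length_cells] at hlt
  rw [getElem?_cells (by omega), getElem?_cells hlt] at hv'
  exact ⟨v, hlt, hv, Prod.ext (Option.some.inj hv'.1).symm (Option.some.inj hv'.2).symm⟩

theorem Negligible.tendsto_mul {f : ℕ → ℝ} (hf : Negligible f) (P : Polynomial ℕ) :
    Tendsto (fun s => ((P.eval s : ℕ) : ℝ) * f s) atTop (nhds 0) := by
  have h := Asymptotics.SuperpolynomialDecay.polynomial_mul hf (P.map (Nat.castRingHom ℝ)) 0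
  simpa using h

theorem mul_apply_le_expect {α : Type} (p : PMF α) {f : α → ℝ} {C : ℝ} (hf : ∀ a, |f a| ≤ C)
    (h0 : ∀ a ∈ p.support, 0 ≤ f a) (a : α) : (p a).toReal * f a ≤ expect p f := by
  refine (summable_expect p hf).le_tsum a fun b _ => ?_
  by_cases hb : b ∈ p.support
  · exact mul_nonneg ENNReal.toReal_nonneg (h0 b hb)
  · rw [PMF.mem_support_iff, not_not] at hb
    simp [hb]

/-- Isolating the right value of a random parameter of `D` bits costs the factor `2 ^ D`, provided
that the wrong values contribute nothing negative. -/
theorem coins_mul_le_expect {f : List Bool → ℝ} {C : ℝ} {D : ℕ} (hf : ∀ a, |f a| ≤ C)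
    (h0 : ∀ a ∈ (coins D).support, 0 ≤ f a) {b : List Bool} (hb : b.length = D) :
    (2⁻¹ : ℝ) ^ D * f b ≤ expect (coins D) f := by
  have := mul_apply_le_expect (coins D) hf h0 b
  rwa [coins_apply hb, ENNReal.toReal_pow, ENNReal.toReal_inv, ENNReal.toReal_ofNat] at this

theorem chooseKernel_eq (B Q : Polynomial ℕ) (s l : ℕ) :
    chooseKernel B Q (.cons (unary s) (unary l)) =
      (coins (ORE.depth B s)).bind fun b₁ => (coins (ORE.depth B s)).bind fun b₂ =>
        (coins (ORE.depth B s)).bind fun b₃ =>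
          challengeLaw s l (l - ORE.depth Q (bitsVal b₁)) (((consecutive (cells (ORE.depth Q
            (bitsVal b₁)))).map pairData)[bitsVal b₃]?.getD .nil) (bitsVal b₁) (bitsVal b₂) := by
  have hfst : (ofLists (cells (ORE.depth B s))).fst.toList.length = ORE.depth B s := by
    have h0 : 0 < (cells (ORE.depth B s)).length := by rw [length_cells]; positivity
    cases hc : cells (ORE.depth B s) with
    | nil => rw [hc] at h0; simp at h0
    | cons c cs =>
      have := length_of_mem_cells (d := ORE.depth B s) (c := c) (by simp [hc])
      simp [ofLists, this]
  have hidx : ∀ b ∈ (coins (ORE.depth B s)).support, ofList ((indexData (ofLists (cells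
      (ORE.depth B s))) (ofBits b)).toList.map fun _ => Data.nil) = unary (bitsVal b) := by
    intro b hb
    rw [List.map_const', ← length_of_mem_support_coins hb, length_indexData]
    rfl
  simp only [chooseKernel, fst_cons, length_unary, cellsData_eq]
  rw [show Nat.clog 2 (B.eval s) = ORE.depth B s from rfl, hfst]
  simp only [PMF.bind_map, Function.comp_def]
  refine bind_congr_support _ fun b₁ h₁ => bind_congr_support _ fun b₂ h₂ =>
    bind_congr_support _ fun b₃ h₃ => ?_
  rw [hidx _ h₁, hidx _ h₂, hidx _ h₃, challengeKernel_eq]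

namespace ORE

variable (E : ORE)

theorem depth_mono (Q : Polynomial ℕ) : Monotone (depth Q) := fun _ _ h =>
  Nat.clog_mono_right 2 (eval_mono Q h)

/-- `2 ^ ℓ` outgrows every polynomial, while the number of blocks is polynomial. Thus plaintexts are
eventually long enough to be cut into blocks. -/
theorem eventually_depth_le {ℓ : ℕ → ℕ} (hN : Negligible fun s => 1 / (2 : ℝ) ^ ℓ s)
    (b Q : Polynomial ℕ) :
    ∀ᶠ s in atTop, 1 ≤ ℓ s ∧ ∀ n ≤ b.eval s, depth Q n ≤ ℓ s := by
  have h := hN.tendsto_mul (2 * Q.comp b + 2)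
  filter_upwards [h.eventually (gt_mem_nhds zero_lt_one)] with s hs
  rw [mul_one_div, div_lt_one (by positivity)] at hs
  have hs : 2 * Q.eval (b.eval s) + 2 < 2 ^ ℓ s := by
    simpa [Polynomial.eval_comp] using (by exact_mod_cast hs :
      (2 * Q.comp b + 2).eval s < 2 ^ ℓ s)
  constructor
  · by_contra! h0
    have : ℓ s = 0 := by omega
    rw [this] at hs
    omega
  · intro n hn
    refine (depth_mono Q hn).trans ?_
    have h₂ := two_pow_clog_le (Q.eval (b.eval s))
    exact (Nat.pow_lt_pow_iff_right (by norm_num : 1 < 2)).1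
      (show 2 ^ depth Q (b.eval s) < 2 ^ ℓ s from lt_of_le_of_lt h₂ (by omega)) |>.le

/-- Security makes blocks that the learner has not seen look alike to its hypothesis. -/
theorem eventually_unseen_le {ℓ : ℕ → ℕ} (hN : Negligible fun s => 1 / (2 : ℝ) ^ ℓ s)
    (hsec : E.StaticallySingleChallengeSecure ℓ) (L : Learner) (b Q Z : Polynomial ℕ) :
    ∀ᶠ s in atTop, ∀ n ≤ b.eval s, ∀ u ≤ n, ∀ j ∈ consecutive (cells (depth Q n)),
      ((Z.eval s : ℕ) : ℝ) * E.unseen L s (ℓ s) (ℓ s - depth Q n) j n u ≤ 1 := by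
  -- Each parameter is drawn from `2 ^ D` values with `D = depth B s`. By the choice of `B` this
  -- number exceeds `n`, `u` and the index `v` of the pair, which is less than `2 * Q n + 1`; and it
  -- is at most `M`.
  set B : Polynomial ℕ := b + 2 * Q.comp b + 2 with hB
  set M : Polynomial ℕ := 2 * B + 1 with hM
  obtain ⟨A₁, hA₁⟩ := Samplable.exists_alg fun _ x => chooseKernel B Q x
  obtain ⟨A₂, hA₂⟩ := Samplable.exists_alg fun _ x => guessKernel L x
  -- The final estimate is `Z * 4 * M ^ 3 * (adv + loss)`; each of the two summands is eventually
  -- below 1/2, the first by security and the second because `2 ^ (-ℓ)` is negligible. The factor 2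
  -- in the second is 4 times the 1/2 in `loss`.
  have hneg := (hsec ⟨A₁, A₂⟩).tendsto_mul (Z * 4 * M ^ 3)
  have hneg' := hN.tendsto_mul (Z * 2 * M ^ 3 * (M + 4) ^ 2 * (2 * Q.comp M + 1))
  filter_upwards [hneg.eventually (gt_mem_nhds (show (0 : ℝ) < 1 / 2 by norm_num)),
    hneg'.eventually (gt_mem_nhds (show (0 : ℝ) < 1 / 2 by norm_num)),
    eventually_depth_le hN M Q] with s h₁ h₂ ⟨hl, hd⟩ n hn u hu j hj
  obtain ⟨v, hv, hvj, hjv⟩ := mem_consecutive_cells hj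
  set D := depth B s with hD
  have hDM : 2 ^ D ≤ M.eval s := by
    have : 2 ^ D ≤ 2 * B.eval s + 1 := two_pow_clog_le (B.eval s)
    rw [hM]
    simpa using this
  have hBD : b.eval s + 2 * Q.eval (b.eval s) + 2 ≤ 2 ^ D := by
    have : B.eval s ≤ 2 ^ D := Nat.le_pow_clog (by norm_num) _
    rw [hB] at this
    simpa [Polynomial.eval_comp] using this
  -- A bound for the coincidence term that holds for all sample sizes up to `M(s)` at once, so also
  -- for the wrong guesses of `n`.
  set loss : ℝ := 1 / 2 * (((M.eval s : ℕ) + 4) ^ 2 * ((2 * (Q.eval (M.eval s) : ℕ) + 1) *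
    (1 / 2 ^ ℓ s))) with hloss
  have hloss0 : 0 ≤ loss := by positivity
  have hle : ∀ n, n ≤ M.eval s →
      1 / 2 * ((n + 4) ^ 2 * (2⁻¹ : ℝ) ^ (ℓ s - depth Q n)) ≤ loss := by
    intro n hn
    have h2 : ((2 : ℝ) ^ depth Q n) ≤ 2 * (Q.eval (M.eval s) : ℕ) + 1 := by
      have h3 := (two_pow_clog_le (Q.eval n)).trans (add_le_add_left
        (Nat.mul_le_mul_left 2 (eval_mono Q hn)) 1)
      exact_mod_cast h3
    have h4 : (2⁻¹ : ℝ) ^ (ℓ s - depth Q n) = 2 ^ depth Q n * (1 / 2 ^ ℓ s) := by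
      rw [inv_pow, pow_sub₀ _ (by norm_num) (hd n hn)]
      field_simp
    rw [h4, hloss]
    gcongr
  set T : List Bool → List Bool → List Bool → ℝ := fun b₁ b₂ b₃ =>
    expect (challengeLaw s (ℓ s) (ℓ s - depth Q (bitsVal b₁)) (((consecutive (cells (depth Q
      (bitsVal b₁)))).map pairData)[bitsVal b₃]?.getD .nil) (bitsVal b₁) (bitsVal b₂))
      (E.gain L s (ℓ s)) with hT
  have hTle : ∀ b₁ b₂ b₃, |T b₁ b₂ b₃| ≤ 1 := fun _ _ _ =>
    abs_expect_le _ fun _ => E.abs_gain_le L s _ _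
  have hpair : ∀ n u, n ≤ M.eval s → ∀ j ∈ consecutive (cells (depth Q n)),
      1 / 4 * E.unseen L s (ℓ s) (ℓ s - depth Q n) j n u - loss ≤
        expect (challengeLaw s (ℓ s) (ℓ s - depth Q n) (pairData j) n u) (E.gain L s (ℓ s)) := by
    intro n u hn j hj
    obtain ⟨v, hv, -, rfl⟩ := mem_consecutive_cells hj
    have hsub : ℓ s - (ℓ s - depth Q n) = depth Q n := by have := hd n hn; omega
    have := E.le_expect_gain_challengeLaw L s n u (r := ℓ s - depth Q n) (Nat.sub_le _ _) hl
      (j := (msgBits (depth Q n) v, msgBits (depth Q n) (v + 1)))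
      (by rw [length_msgBits, hsub]) (by rw [length_msgBits, hsub])
      (by rw [bitsVal_msgBits hv, bitsVal_msgBits (by omega)])
    linarith [hle n hn]
  -- Wrong parameters cost at most `loss`: a pair past the end of the list gives mean gain 0, and
  -- for every actual pair the mean gain is at least a nonnegative mean square minus `loss`.
  have hT0 : ∀ b₁ b₂ b₃, bitsVal b₁ ≤ M.eval s → 0 ≤ T b₁ b₂ b₃ + loss := by
    intro b₁ b₂ b₃ h
    rw [hT]
    cases hc : (consecutive (cells (depth Q (bitsVal b₁))))[bitsVal b₃]? with
    | none =>
      simp only [List.getElem?_map, hc, Option.map_none, Option.getD_none,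
        E.expect_gain_challengeLaw_nil]
      linarith
    | some j =>
      simp only [List.getElem?_map, hc, Option.map_some, Option.getD_some]
      have := hpair _ (bitsVal b₂) h j (List.mem_of_getElem? hc)
      have h0 : 0 ≤ E.unseen L s (ℓ s) (ℓ s - depth Q (bitsVal b₁)) j (bitsVal b₁) (bitsVal b₂) :=
        expect_nonneg _ fun _ => mul_nonneg (ind_nonneg _) (E.spread_nonneg _ _ _ _ _ _)
      linarith
  have hadv : expect (coins D) (fun b₁ => expect (coins D) fun b₂ => expect (coins D) fun b₃ =>
      T b₁ b₂ b₃ + loss) ≤ |prob (E.experiment ⟨A₁, A₂⟩ s (ℓ s) false) {true} -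
        prob (E.experiment ⟨A₁, A₂⟩ s (ℓ s) true) {true}| + loss := by
    have hexp : ∀ b, E.experiment ⟨A₁, A₂⟩ s (ℓ s) b =
        (chooseKernel B Q (.cons (unary s) (unary (ℓ s)))).bind (E.reply L s (ℓ s) b) := by
      intro b
      rw [experiment, hA₁ noOracle]
      simp only [hA₂ noOracle]
      rfl
    rw [hexp, hexp, prob_bind, prob_bind,
      ← expect_sub _ (fun _ => abs_prob_le _ _) fun _ => abs_prob_le _ _]
    have hg := fun q => E.abs_gain_le L s (ℓ s) q
    have : expect (chooseKernel B Q (.cons (unary s) (unary (ℓ s)))) (E.gain L s (ℓ s)) =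
        expect (coins D) fun b₁ => expect (coins D) fun b₂ => expect (coins D) fun b₃ =>
          T b₁ b₂ b₃ := by
      rw [chooseKernel_eq, expect_bind _ _ hg]
      simp only [expect_bind _ _ hg]
      rfl
    have hsum : expect (coins D) (fun b₁ => expect (coins D) fun b₂ => expect (coins D) fun b₃ =>
        T b₁ b₂ b₃ + loss) = expect (chooseKernel B Q (.cons (unary s) (unary (ℓ s))))
          (E.gain L s (ℓ s)) + loss := by
      simp only [expect_add _ (hTle _ _) fun _ => le_refl |loss|, expect_const]
      simp only [expect_add _ (fun b₂ => abs_expect_le (coins D) (hTle _ b₂))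
        fun _ => le_refl |loss|, expect_const]
      rw [expect_add _ (fun b₁ => abs_expect_le (coins D) fun b₂ => abs_expect_le (coins D)
        (hTle b₁ b₂)) fun _ => le_refl |loss|, expect_const, this]
    rw [hsum]
    exact add_le_add_left (le_abs_self _) _
  have hb1 : bitsVal (msgBits D n) = n := bitsVal_msgBits (by omega)
  have hb2 : bitsVal (msgBits D u) = u := bitsVal_msgBits (by omega)
  have hb3 : bitsVal (msgBits D v) = v := bitsVal_msgBits (by
    have h2 := two_pow_clog_le (Q.eval n)
    have h3 := eval_mono Q hn
    have : v + 1 < 2 ^ Nat.clog 2 (Q.eval n) := hv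
    omega)
  have hTC : ∀ b₁ b₂ b₃, |T b₁ b₂ b₃ + loss| ≤ 1 + |loss| := fun b₁ b₂ b₃ =>
    (abs_add_le _ _).trans (add_le_add (hTle _ _ _) le_rfl)
  have hbv : ∀ b₁ ∈ (coins D).support, bitsVal b₁ ≤ M.eval s := by
    intro b hb
    have := bitsVal_lt b
    rw [length_of_mem_support_coins hb] at this
    omega
  have hnM : n ≤ M.eval s := by omega
  have hpow0 : (0 : ℝ) ≤ 2⁻¹ ^ D := by positivity
  -- Only the right values of the three parameters are kept; the others contribute nonnegative
  -- amounts after `loss` has been added.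
  have hlow : (2⁻¹ : ℝ) ^ D * ((2⁻¹ : ℝ) ^ D * ((2⁻¹ : ℝ) ^ D *
      (T (msgBits D n) (msgBits D u) (msgBits D v) + loss))) ≤
      expect (coins D) (fun b₁ => expect (coins D) fun b₂ => expect (coins D) fun b₃ =>
      T b₁ b₂ b₃ + loss) := by
    refine le_trans (mul_le_mul_of_nonneg_left ?_ hpow0) (coins_mul_le_expect
      (fun b₁ => abs_expect_le _ fun b₂ => abs_expect_le _ fun b₃ => hTC b₁ b₂ b₃)
      (fun b₁ h => le_expect _ (fun b₂ => abs_expect_le _ fun b₃ => hTC b₁ b₂ b₃) fun b₂ _ =>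
        le_expect _ (hTC b₁ b₂) fun b₃ _ => hT0 b₁ b₂ b₃ (hbv b₁ h)) (length_msgBits D n))
    refine le_trans (mul_le_mul_of_nonneg_left ?_ hpow0) (coins_mul_le_expect
      (fun b₂ => abs_expect_le _ fun b₃ => hTC _ b₂ b₃)
      (fun b₂ _ => le_expect _ (hTC _ b₂) fun b₃ _ => hT0 _ b₂ b₃ (by rw [hb1]; exact hnM))
      (length_msgBits D u))
    exact coins_mul_le_expect (hTC _ _) (fun b₃ _ => hT0 _ _ b₃ (by rw [hb1]; exact hnM))
      (length_msgBits D v)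
  have hmain : 1 / 4 * E.unseen L s (ℓ s) (ℓ s - depth Q n) j n u ≤
      T (msgBits D n) (msgBits D u) (msgBits D v) + loss := by
    have := hpair n u hnM j hj
    rw [hT]
    simp only [hb1, hb2, hb3, List.getElem?_map, hvj, Option.map_some, Option.getD_some]
    linarith
  set adv := |prob (E.experiment ⟨A₁, A₂⟩ s (ℓ s) false) {true} -
        prob (E.experiment ⟨A₁, A₂⟩ s (ℓ s) true) {true}|
  have hfin : E.unseen L s (ℓ s) (ℓ s - depth Q n) j n u ≤
      4 * (2 ^ D) ^ 3 * (adv + loss) := by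
    have h3 := (mul_le_mul_of_nonneg_left hmain (pow_nonneg hpow0 3)).trans
      ((le_of_eq (by ring)).trans (hlow.trans hadv))
    have h4 : ((2⁻¹ : ℝ) ^ D) ^ 3 * (2 ^ D) ^ 3 = 1 := by
      rw [← mul_pow, ← mul_pow]; norm_num
    have h5 := mul_le_mul_of_nonneg_left h3 (by positivity : (0 : ℝ) ≤ 4 * (2 ^ D) ^ 3)
    calc _ = 4 * (2 ^ D) ^ 3 * (((2⁻¹ : ℝ) ^ D) ^ 3 *
          (1 / 4 * E.unseen L s (ℓ s) (ℓ s - depth Q n) j n u)) := by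
            linear_combination (-E.unseen L s (ℓ s) (ℓ s - depth Q n) j n u) * h4
      _ ≤ _ := h5
  have hDM' : ((2 : ℝ) ^ D) ≤ (M.eval s : ℕ) := by exact_mod_cast hDM
  calc ((Z.eval s : ℕ) : ℝ) * E.unseen L s (ℓ s) (ℓ s - depth Q n) j n u
      ≤ ((Z.eval s : ℕ) : ℝ) * (4 * (M.eval s : ℕ) ^ 3 * (adv + loss)) := by
        refine mul_le_mul_of_nonneg_left (hfin.trans ?_) (Nat.cast_nonneg _)
        gcongr
    _ ≤ 1 := by
        simp only [Polynomial.eval_mul, Polynomial.eval_pow, Polynomial.eval_add,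
          Polynomial.eval_ofNat, Polynomial.eval_comp, Polynomial.eval_one, Nat.cast_mul,
          Nat.cast_pow, Nat.cast_add, Nat.cast_ofNat, Nat.cast_one] at h₁ h₂
        rw [hloss]
        linarith

end ORE

end PrivLearn

namespace PrivLearn

open Data Filter

section

variable {α β : Type}

/-! ### Sums of independent random variables -/

/-- The truncation to `n` entries makes the sum bounded on all lists, as the lemmas on `expect`
require. On the support of `iid D n` it changes nothing. -/
theorem abs_sum_take_le {Y : α → ℝ} {C : ℝ} (hC : 0 ≤ C) (hY : ∀ a, |Y a| ≤ C) (n : ℕ)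
    (xs : List α) : |((xs.take n).map Y).sum| ≤ n * C := by
  induction n generalizing xs with
  | zero => simp
  | succ n ih =>
    cases xs with
    | nil => simp; positivity
    | cons x xs =>
      rw [List.take_succ_cons, List.map_cons, List.sum_cons]
      refine (abs_add_le _ _).trans ((add_le_add (hY x) (ih xs)).trans_eq ?_)
      push_cast; ring

theorem expect_iid_sum (D : PMF α) {Y : α → ℝ} {C v : ℝ} (hC : 0 ≤ C) (hY : ∀ a, |Y a| ≤ C)
    (h0 : expect D Y = 0) (hv : expect D (fun a => Y a ^ 2) ≤ v) (n : ℕ) :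
    expect (iid D n) (fun xs => ((xs.take n).map Y).sum) = 0 ∧
      expect (iid D n) (fun xs => ((xs.take n).map Y).sum ^ 2) ≤ n * v := by
  have hsq : ∀ n, ∀ xs : List α, |((xs.take n).map Y).sum ^ 2| ≤ (n * C) ^ 2 := fun n xs => by
    rw [abs_pow]
    exact pow_le_pow_left₀ (abs_nonneg _) (abs_sum_take_le hC hY n xs) 2
  induction n with
  | zero => simp [iid, expect_pure]
  | succ n ih =>
    have hS := abs_sum_take_le hC hY n
    constructor
    · rw [iid, expect_bind _ _ (abs_sum_take_le hC hY (n + 1))]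
      simp only [expect_map _ _ (abs_sum_take_le hC hY (n + 1)), List.take_succ_cons,
        List.map_cons, List.sum_cons]
      simp only [expect_add _ (fun _ => le_refl |Y _|) hS, expect_const, ih.1, add_zero, h0]
    · rw [iid, expect_bind _ _ (hsq (n + 1))]
      simp only [expect_map _ _ (hsq (n + 1)), List.take_succ_cons, List.map_cons, List.sum_cons]
      have h₁ : ∀ x, expect (iid D n) (fun xs => (Y x + ((xs.take n).map Y).sum) ^ 2) =
          Y x ^ 2 + expect (iid D n) fun xs => ((xs.take n).map Y).sum ^ 2 := by
        intro x
        have := ((hasSum_expect (iid D n) fun _ => le_refl |Y x ^ 2|).add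
          ((hasSum_expect (iid D n) hS).mul_left (2 * Y x))).add (hasSum_expect (iid D n) (hsq n))
        rw [ih.1, expect_const, mul_zero, add_zero] at this
        rw [← this.tsum_eq]
        exact tsum_congr fun xs => by ring
      simp only [h₁]
      rw [expect_add _ (C := C ^ 2) (fun a => by
        rw [abs_pow]; exact pow_le_pow_left₀ (abs_nonneg _) (hY a) 2) fun _ => le_rfl, expect_const]
      push_cast
      linarith [ih.2]

/-- Deviations of a sum of independent random variables. -/
theorem prob_iid_deviation_le (D : PMF α) {X : α → ℝ} (hX : ∀ a, |X a| ≤ 1) (n : ℕ) {c : ℝ}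
    (hc : 0 < c) :
    prob (iid D n) {xs | c ≤ |(xs.map X).sum - n * expect D X|} ≤ n / c ^ 2 := by
  set μ := expect D X with hμ
  have hμ1 : |μ| ≤ 1 := abs_expect_le _ hX
  have hY : ∀ a, |X a - μ| ≤ 2 := fun a => (abs_sub _ _).trans (by linarith [hX a])
  have h0 : expect D (fun a => X a - μ) = 0 := by
    rw [expect_sub _ hX fun _ => hμ1, expect_const, sub_self]
  have hv : expect D (fun a => (X a - μ) ^ 2) ≤ 1 := by
    have := ((hasSum_expect D (f := fun a => X a ^ 2) (C := 1) fun a => by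
      rw [abs_pow]; exact pow_le_one₀ (abs_nonneg _) (hX a)).sub
      ((hasSum_expect D hX).mul_left (2 * μ))).add (hasSum_expect D fun _ => le_refl |μ ^ 2|)
    have h2 : expect D (fun a => X a ^ 2) ≤ 1 := expect_le (C := 1) _ (fun a => by
      rw [abs_pow]; exact pow_le_one₀ (abs_nonneg _) (hX a)) fun a _ => by
        rw [← sq_abs]; exact pow_le_one₀ (abs_nonneg _) (hX a)
    have h3 : expect D (fun a => (X a - μ) ^ 2) = expect D (fun a => X a ^ 2) - 2 * μ * μ + μ ^ 2 := by
      rw [expect_const, ← hμ] at this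
      rw [← this.tsum_eq]
      exact tsum_congr fun xs => by ring
    rw [h3]
    nlinarith [sq_nonneg μ]
  have hS := expect_iid_sum D (by norm_num) hY h0 hv n
  rw [mul_one] at hS
  refine (prob_le_expect_sq _ (abs_sum_take_le (by norm_num) hY n) hc fun xs hxs h => ?_).trans
    (div_le_div_of_nonneg_right hS.2 (by positivity))
  have hlen := length_of_mem_support_iid hxs
  have : ((xs.take n).map fun a => X a - μ).sum = (xs.map X).sum - n * μ := by
    rw [List.take_of_length_le hlen.le, ← hlen]
    clear h hxs hlen
    induction xs with
    | nil => simp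
    | cons x xs ih => simp only [List.map_cons, List.sum_cons, ih, List.length_cons]; push_cast; ring
  rw [this]
  exact h

theorem prob_seqLaw_exists_le (l : List β) (K : β → PMF α) (A : Set α) :
    prob (seqLaw (l.map K)) {xs | ∃ x ∈ xs, x ∈ A} ≤ (l.map fun b => prob (K b) A).sum := by
  induction l with
  | nil => simp [seqLaw, prob_pure, ind]
  | cons b l ih =>
    rw [List.map_cons, seqLaw, List.map_cons, List.sum_cons, prob_bind]
    simp only [prob_map]
    have h : ∀ x, prob (seqLaw (l.map K)) ((fun xs => x :: xs) ⁻¹' {xs | ∃ x ∈ xs, x ∈ A}) ≤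
        ind (x ∈ A) + (l.map fun b => prob (K b) A).sum := by
      intro x
      by_cases hx : x ∈ A
      · rw [ind_true hx]
        have : 0 ≤ (l.map fun b => prob (K b) A).sum := (prob_nonneg _ _).trans ih
        linarith [prob_le_one (seqLaw (l.map K)) ((fun xs => x :: xs) ⁻¹' {xs | ∃ x ∈ xs, x ∈ A})]
      · rw [ind_false hx, zero_add]
        refine (prob_mono _ fun xs _ h => ?_).trans ih
        simpa [hx] using h
    refine (expect_mono (C' := 1 + |(l.map fun b => prob (K b) A).sum|) _
      (fun _ => abs_prob_le _ _) (fun _ => (abs_add_le _ _).trans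
      (add_le_add (abs_ind_le _) le_rfl)) fun x _ => h x).trans ?_
    rw [expect_add _ (fun _ => abs_ind_le _) fun _ => le_rfl, expect_const, ← prob_eq_expect]

theorem prob_seqLaw_forall_le {l : List β} (K : β → PMF α) (A : Set α) {b : β} (hb : b ∈ l) :
    prob (seqLaw (l.map K)) {xs | ∀ x ∈ xs, x ∈ A} ≤ prob (K b) A := by
  induction l with
  | nil => simp at hb
  | cons b' l ih =>
    rw [List.map_cons, seqLaw]
    rcases List.mem_cons.1 hb with rfl | hb
    · rw [prob_bind, prob_eq_expect (K b)]
      refine expect_mono _ (fun _ => abs_prob_le _ _) (fun _ => abs_ind_le _) fun x _ => ?_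
      rw [prob_map]
      by_cases hx : x ∈ A
      · rw [ind_true hx]; exact prob_le_one _ _
      · rw [ind_false hx, prob_eq_expect]
        refine (expect_congr _ fun xs _ => ind_false fun h => hx ?_).trans_le (expect_const _ 0).le
        exact (List.forall_mem_cons.1 h).1
    · rw [prob_bind]
      refine expect_le _ (fun _ => abs_prob_le _ _) fun x _ => ?_
      rw [prob_map]
      exact (prob_mono _ fun xs _ h => (List.forall_mem_cons.1 h).2).trans (ih hb)

/-- The chance that one of several independent random objects is related to a given one. -/
theorem expect_iid_exists_le (D : PMF α) {R : α → α → Prop} {ρ : ℝ}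
    (hρ : ∀ x, expect D (fun y => ind (R x y)) ≤ ρ) (x : α) (n : ℕ) :
    expect (iid D n) (fun ys => ind (∃ y ∈ ys, R x y)) ≤ n * ρ := by
  have h := prob_seqLaw_exists_le (List.replicate n ()) (fun _ => D) {y | R x y}
  rw [List.map_replicate, ← iid_eq_seqLaw, List.map_replicate, List.sum_replicate, nsmul_eq_mul,
    prob_eq_expect, prob_eq_expect] at h
  exact h.trans (mul_le_mul_of_nonneg_left (hρ x) (Nat.cast_nonneg _))

/-- Union bound over the entries other than number `u`. Entries in front of `u` are peeled off one
by one, each at the price `ρ`, until `u` comes first and `expect_iid_exists_le` applies. -/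
theorem expect_iid_collision_le (D : PMF α) {R : α → α → Prop} {ρ : ℝ}
    (hρ : ∀ x, expect D (fun y => ind (R x y)) ≤ ρ) (h0 : 0 ≤ ρ) (u n : ℕ) :
    expect (iid D n) (fun xs => ind (∃ x, xs[u]? = some x ∧ ∃ y ∈ xs.eraseIdx u, R x y)) ≤
      n * ρ := by
  induction n generalizing u with
  | zero => simp [iid, expect_pure, ind]
  | succ n ih =>
    have hb : ∀ xs : List α, |ind (∃ x, xs[u]? = some x ∧ ∃ y ∈ xs.eraseIdx u, R x y)| ≤ 1 :=
      fun _ => abs_ind_le _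
    cases u with
    | zero =>
      rw [iid, expect_bind _ _ fun _ => abs_ind_le _]
      simp only [expect_map _ _ fun xs : List α =>
        abs_ind_le (∃ x, xs[0]? = some x ∧ ∃ y ∈ xs.eraseIdx 0, R x y)]
      refine expect_le _ (fun _ => abs_expect_le _ fun _ => abs_ind_le _) fun x _ => ?_
      simp only [List.getElem?_cons_zero, Option.some.injEq, exists_eq_left', List.eraseIdx_cons_zero]
      refine (expect_iid_exists_le D hρ x n).trans ?_
      push_cast; nlinarith
    | succ u =>
      -- The front entry is drawn last, so that entry `u`, with which it is compared, is already
      -- fixed.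
      have h : iid D (n + 1) = (iid D n).bind fun xs => D.map fun x => x :: xs := by
        rw [iid]; exact PMF.bind_comm _ _ _
      rw [h, expect_bind _ _ fun _ => abs_ind_le _]
      simp only [expect_map _ _ fun xs : List α =>
        abs_ind_le (∃ x, xs[u + 1]? = some x ∧ ∃ y ∈ xs.eraseIdx (u + 1), R x y)]
      have h₁ : ∀ xs : List α, expect D (fun x => ind (∃ x_1, (x :: xs)[u + 1]? = some x_1 ∧
          ∃ y ∈ (x :: xs).eraseIdx (u + 1), R x_1 y)) ≤
          ρ + ind (∃ x, xs[u]? = some x ∧ ∃ y ∈ xs.eraseIdx u, R x y) := by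
        intro xs
        simp only [List.getElem?_cons_succ, List.eraseIdx_cons_succ, List.mem_cons,
          exists_eq_or_imp]
        cases hz : xs[u]? with
        | none => simp [ind, expect_const, h0]
        | some z =>
          simp only [Option.some.injEq, exists_eq_left']
          refine (expect_mono (C := 1) (C' := 1 + 1) _ (fun _ => abs_ind_le _) (fun _ => (abs_add_le _ _).trans
            (add_le_add (abs_ind_le _) (abs_ind_le _))) fun x _ => ind_or_le _ _).trans ?_
          rw [expect_add _ (fun _ => abs_ind_le _) fun _ => abs_ind_le _, expect_const]
          linarith [hρ z]
      refine (expect_mono (C' := |ρ| + 1) _ (fun _ => abs_expect_le _ fun _ => abs_ind_le _)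
        (fun _ => (abs_add_le _ _).trans (add_le_add le_rfl (abs_ind_le _))) fun xs _ => h₁ xs).trans ?_
      rw [expect_add _ (fun _ => le_rfl) fun _ => abs_ind_le _, expect_const]
      push_cast
      linarith [ih u]

theorem abs_list_sum_le (l : List β) {f : β → ℝ} {C : ℝ} (hf : ∀ b, |f b| ≤ C) :
    |(l.map f).sum| ≤ l.length * C := by
  induction l with
  | nil => simp
  | cons b l ih =>
    simp only [List.map_cons, List.sum_cons, List.length_cons]
    refine (abs_add_le _ _).trans ((add_le_add (hf b) ih).trans_eq ?_)
    push_cast; ring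

theorem expect_list_sum (p : PMF α) (l : List β) (f : α → β → ℝ) {C : ℝ} (hf : ∀ a b, |f a b| ≤ C) :
    expect p (fun a => (l.map (f a)).sum) = (l.map fun b => expect p fun a => f a b).sum := by
  induction l with
  | nil => simp [expect_const]
  | cons b l ih =>
    simp only [List.map_cons, List.sum_cons]
    rw [expect_add _ (fun a => hf a b) fun a => abs_list_sum_le l (hf a), ih]

theorem map_drop_coins {l r : ℕ} (h : r ≤ l) : (coins l).map (List.drop r) = coins (l - r) := by
  obtain ⟨d, rfl⟩ := Nat.exists_eq_add_of_le h
  rw [Nat.add_sub_cancel_left, coins, iid_add]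
  simp only [PMF.map, PMF.bind_bind, PMF.pure_bind, Function.comp_def]
  have : ∀ xs ∈ (iid coin r).support, ((iid coin d).bind fun ys => PMF.pure (List.drop r (xs ++ ys))) =
      iid coin d := by
    intro xs hxs
    have hl := length_of_mem_support_iid hxs
    simp only [← hl, List.drop_left]
    exact PMF.bind_pure _
  rw [bind_congr_support _ this, PMF.bind_const]
  rfl

theorem expect_coins_eq_sum (d : ℕ) (f : List Bool → ℝ) :
    expect (coins d) f = (∑ v ∈ Finset.range (2 ^ d), f (msgBits d v)) / 2 ^ d := by
  have hsum : HasSum (fun b => (coins d b).toReal * f b)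
      (∑ b ∈ (Finset.range (2 ^ d)).image (msgBits d), (coins d b).toReal * f b) := by
    refine hasSum_sum_of_ne_finset_zero fun b hb => ?_
    have : coins d b = 0 := by
      by_contra h0
      refine hb ?_
      have hl := length_of_mem_support_coins ((PMF.mem_support_iff _ _).2 h0)
      have hm : b ∈ cells d := mem_cells.2 hl
      rw [cells_eq, List.mem_map] at hm
      obtain ⟨v, hv, rfl⟩ := hm
      exact Finset.mem_image_of_mem _ (by simpa using hv)
    rw [this]; simp
  rw [expect, hsum.tsum_eq, Finset.sum_image, Finset.sum_div]
  · refine Finset.sum_congr rfl fun v _ => ?_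
    rw [coins_apply (length_msgBits d v)]
    simp only [ENNReal.toReal_pow, ENNReal.toReal_inv, ENNReal.toReal_ofNat]
    rw [inv_pow]; field_simp
  · intro v hv w hw h
    have hv' : v < 2 ^ d := by simpa using hv
    have hw' : w < 2 ^ d := by simpa using hw
    rw [← bitsVal_msgBits hv', h, bitsVal_msgBits hw']

/-- If the first half of a finite sequence is on average larger than the second half, then the
sequence must fall at some point. -/
theorem exists_drop {p : ℕ → ℝ} {K : ℕ} {θ : ℝ}
    (h : (K : ℝ) * K * θ < ∑ v ∈ Finset.range K, p v - ∑ v ∈ Finset.range K, p (K + v)) :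
    ∃ v, v + 1 < 2 * K ∧ θ ≤ p v - p (v + 1) := by
  by_contra! hcon
  -- Telescoping over the `K` steps from `v` to `K + v`, each of which falls by less than `θ`.
  have hstep : ∀ v, v < K → p v - p (K + v) ≤ K * θ := by
    intro v hv
    have : ∀ i ≤ K, p v - p (i + v) ≤ i * θ := by
      intro i hi
      induction i with
      | zero => simp
      | succ i ih =>
        have h₁ := ih (by omega)
        have h₂ := hcon (i + v) (by omega)
        rw [show i + 1 + v = i + v + 1 by omega]
        push_cast
        linarith
    exact this K le_rfl
  have := Finset.sum_le_sum fun v (hv : v ∈ Finset.range K) => hstep v (Finset.mem_range.1 hv)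
  rw [Finset.sum_sub_distrib, Finset.sum_const, Finset.card_range, nsmul_eq_mul] at this
  linarith

end

/-- The inverse polynomial bound holds only eventually; the finitely many remaining arguments, where
`f` is still positive, are absorbed by a constant term. -/
theorem Noticeable.exists_polynomial {f : ℕ → ℝ} (hf : Noticeable f) :
    ∃ P : Polynomial ℕ, ∀ n, 1 ≤ n → 1 ≤ P.eval n * f n := by
  obtain ⟨hpos, c, hc⟩ := hf
  obtain ⟨n₀, hn₀⟩ := eventually_atTop.1 hc
  refine ⟨.X ^ c + .C (∑ m ∈ Finset.range n₀, ⌈1 / f m⌉₊), fun n hn => ?_⟩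
  have h0 := hpos n hn
  simp only [Polynomial.eval_add, Polynomial.eval_pow, Polynomial.eval_X, Polynomial.eval_C]
  push_cast
  rcases lt_or_ge n n₀ with h | h
  · have h₁ : (⌈1 / f n⌉₊ : ℝ) ≤ ∑ m ∈ Finset.range n₀, (⌈1 / f m⌉₊ : ℝ) :=
      Finset.single_le_sum (f := fun m => (⌈1 / f m⌉₊ : ℝ)) (fun _ _ => Nat.cast_nonneg _)
        (Finset.mem_range.2 h)
    have h₂ := Nat.le_ceil (1 / f n)
    rw [div_le_iff₀ h0] at h₂
    have h₃ : (0 : ℝ) ≤ (n : ℝ) ^ c := by positivity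
    nlinarith
  · have h₁ := hn₀ n h
    have hp : (0 : ℝ) < (n : ℝ) ^ c := by positivity
    rw [div_le_iff₀ hp] at h₁
    have : (0 : ℝ) ≤ ∑ m ∈ Finset.range n₀, (⌈1 / f m⌉₊ : ℝ) :=
      Finset.sum_nonneg fun _ _ => Nat.cast_nonneg _
    nlinarith

namespace ORE

variable (E : ORE)

/-! ### The tests -/

theorem expect_bitLaw (h : Data → Bool) (keys : Data) (r : ℕ) (j : List Bool) :
    expect (E.bitLaw h keys r j) (fun b => ind (b = true)) = E.blockProb h keys r j := by
  have hb : ∀ b : Bool, |ind (b = true)| ≤ 1 := fun _ => abs_ind_le _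
  rw [bitLaw, expect_bind _ _ hb]
  simp only [expect_map _ _ hb]
  rfl

def diffVal (e : Bool × Bool) : ℝ := ind (e.1 = true) - ind (e.2 = true)

theorem abs_diffVal_le (e : Bool × Bool) : |diffVal e| ≤ 1 := by
  rcases e with ⟨_ | _, _ | _⟩ <;> simp [diffVal, ind]

theorem expect_diffVal (h : Data → Bool) (keys : Data) (r : ℕ) (j : List Bool × List Bool) :
    expect (E.pairLaw h keys r j) diffVal =
      E.blockProb h keys r j.1 - E.blockProb h keys r j.2 := by
  rw [pairLaw, expect_bind _ _ abs_diffVal_le]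
  simp only [expect_map _ _ abs_diffVal_le, diffVal]
  simp only [expect_sub _ (fun _ => le_refl |ind _|) (fun b => abs_ind_le (b = true)),
    expect_const, expect_bitLaw]
  rw [expect_sub _ (fun b => abs_ind_le (b = true)) (fun _ => le_rfl), expect_const, expect_bitLaw]

theorem sum_diffVal (ys : List (Bool × Bool)) : (ys.map diffVal).sum =
    (ys.countP (fun e => e.1) : ℝ) - ys.countP (fun e => e.2) := by
  induction ys with
  | nil => simp
  | cons e ys ih =>
    rw [List.map_cons, List.sum_cons, ih, List.countP_cons, List.countP_cons]
    rcases e with ⟨_ | _, _ | _⟩ <;> simp [diffVal, ind] <;> ring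

/-- Blocks on which the hypothesis behaves similarly rarely pass the test. -/
theorem prob_testLaw_true_le (h : Data → Bool) (keys : Data) (r : ℕ) (j : List Bool × List Bool)
    {N : ℕ} (hN : 0 < N) : prob (E.testLaw h keys r (8 * N ^ 3) (8 * N ^ 2) j) {true} ≤
      1 / (2 * N) + 4 * N ^ 2 * (E.blockProb h keys r j.1 - E.blockProb h keys r j.2) ^ 2 := by
  have hN' : (0 : ℝ) < N := by exact_mod_cast hN
  -- If the mean drop is at most `1/(2N)`, the counts differ on average by at most `4N²`, so a
  -- positive test is a deviation of at least `4N²`, of probability at most `8N³/(4N²)² = 1/(2N)`.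
  -- Otherwise the squared term is at least 1 and there is nothing to prove.
  rcases le_or_gt (E.blockProb h keys r j.1 - E.blockProb h keys r j.2) (1 / (2 * N)) with hj | hj
  · refine le_trans ?_ (le_add_of_nonneg_right (by positivity))
    rw [testLaw, prob_map]
    refine (prob_mono _ fun ys _ hys => ?_).trans ((prob_iid_deviation_le (E.pairLaw h keys r j)
      abs_diffVal_le (8 * N ^ 3) (c := 4 * N ^ 2) (by positivity)).trans_eq ?_)
    · simp only [Set.mem_preimage, Set.mem_singleton_iff, decide_eq_true_eq] at hys
      rw [Set.mem_ofPred_eq, E.expect_diffVal, sum_diffVal]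
      have h₁ : (ys.countP (fun e => e.2) : ℝ) + 8 * N ^ 2 ≤ ys.countP (fun e => e.1) := by
        exact_mod_cast hys
      have h₂ := mul_le_mul_of_nonneg_left hj (show (0 : ℝ) ≤ 8 * N ^ 3 by positivity)
      have h₃ : (8 * N ^ 3 : ℝ) * (1 / (2 * N)) = 4 * N ^ 2 := by field_simp; ring
      rw [h₃] at h₂
      push_cast
      exact le_trans (by linarith) (le_abs_self _)
    · push_cast; field_simp; norm_num
  · have h₁ : 1 ≤ 4 * (N : ℝ) ^ 2 * (E.blockProb h keys r j.1 - E.blockProb h keys r j.2) ^ 2 := by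
      have h₂ := pow_le_pow_left₀ (by positivity) hj.le 2
      have h₃ := mul_le_mul_of_nonneg_left h₂ (show (0 : ℝ) ≤ 4 * N ^ 2 by positivity)
      refine le_trans (le_of_eq ?_) h₃
      field_simp
      norm_num
    have h₂ : (0 : ℝ) ≤ 1 / (2 * N) := by positivity
    linarith [prob_le_one (E.testLaw h keys r (8 * N ^ 3) (8 * N ^ 2) j) {true}]

/-- Blocks between which the acceptance probability falls usually pass the test. -/
theorem prob_testLaw_false_le (h : Data → Bool) (keys : Data) (r : ℕ) (j : List Bool × List Bool)
    {N : ℕ} (hN : 0 < N)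
    (hj : 2 / (N : ℝ) ≤ E.blockProb h keys r j.1 - E.blockProb h keys r j.2) :
    prob (E.testLaw h keys r (8 * N ^ 3) (8 * N ^ 2) j) {false} ≤ 1 / (8 * N) := by
  have hN' : (0 : ℝ) < N := by exact_mod_cast hN
  rw [testLaw, prob_map]
  -- The counts differ on average by at least `16N²`, so missing the threshold `8N²` is a deviation
  -- of at least `8N²`, of probability at most `8N³/(8N²)² = 1/(8N)`.
  refine (prob_mono _ fun ys _ hys => ?_).trans ((prob_iid_deviation_le (E.pairLaw h keys r j)
    abs_diffVal_le (8 * N ^ 3) (c := 8 * N ^ 2) (by positivity)).trans_eq ?_)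
  · simp only [Set.mem_preimage, Set.mem_singleton_iff, decide_eq_false_iff_not, not_le] at hys
    rw [Set.mem_ofPred_eq, E.expect_diffVal, sum_diffVal]
    have h₁ : (ys.countP (fun e => e.1) : ℝ) < ys.countP (fun e => e.2) + 8 * N ^ 2 := by
      exact_mod_cast hys
    have h₂ := mul_le_mul_of_nonneg_left hj (show (0 : ℝ) ≤ 8 * N ^ 3 by positivity)
    have h₃ : (8 * N ^ 3 : ℝ) * (2 / N) = 16 * N ^ 2 := by field_simp; ring
    rw [h₃] at h₂
    push_cast
    rw [abs_sub_comm]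
    exact le_trans (by linarith) (le_abs_self _)
  · push_cast; field_simp

end ORE

end PrivLearn

/-! ### Positive tests at unseen blocks, messages in common blocks, and drops forced by accuracy. -/

namespace PrivLearn

open Data Filter

theorem mem_consecutive_cells_of_lt {d v : ℕ} (h : v + 1 < 2 ^ d) :
    (msgBits d v, msgBits d (v + 1)) ∈ consecutive (cells d) := by
  refine List.mem_of_getElem? (i := v) ?_
  rw [consecutive, List.getElem?_zip_eq_some, List.getElem?_tail]
  exact ⟨getElem?_cells (by omega), getElem?_cells h⟩

theorem length_consecutive_cells_le (d : ℕ) : (consecutive (cells d)).length ≤ 2 ^ d - 1 := by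
  rw [consecutive, List.length_zip, List.length_tail, length_cells]
  exact min_le_right _ _

theorem exists_of_mem_support_seqLaw {α β : Type} {l : List β} {K : β → PMF α} {xs : List α}
    (h : xs ∈ (seqLaw (l.map K)).support) : ∀ x ∈ xs, ∃ b ∈ l, x ∈ (K b).support := by
  induction l generalizing xs with
  | nil => simp [seqLaw] at h; simp [h]
  | cons b l ih =>
    simp only [List.map_cons, seqLaw, PMF.mem_support_bind_iff, PMF.mem_support_map_iff] at h
    obtain ⟨y, hy, ys, hys, rfl⟩ := h
    intro x hx
    rcases List.mem_cons.1 hx with rfl | hx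
    · exact ⟨b, by simp, hy⟩
    · obtain ⟨b', hb', h'⟩ := ih hys x hx
      exact ⟨b', by simp [hb'], h'⟩

namespace ORE

variable (E : ORE)

theorem mem_consecutive_of_mem_tests {P Q : Polynomial ℕ} {h : Data → Bool} {keys : Data} {l n : ℕ}
    {tests : List ((List Bool × List Bool) × Bool)}
    (ht : tests ∈ (E.testsLaw P Q h keys l n).support) :
    ∀ e ∈ tests, e.1 ∈ consecutive (cells (depth Q n)) := by
  intro e he
  obtain ⟨j, hj, he⟩ := exists_of_mem_support_seqLaw ht e he
  rw [PMF.mem_support_map_iff] at he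
  obtain ⟨b, _, rfl⟩ := he
  exact hj

/-- The joint law of the messages of the sample, the keys and the hypothesis learned from the
sample with example number `u` replaced by the junk example. -/
def learnLaw (L : Learner) (s l n u : ℕ) : PMF (List (List Bool) × Data × (Data → Bool)) :=
  (iid (coins l) n).bind fun ms => (E.keyLaw s l).bind fun keys =>
    (E.hypLaw L s keys (ms.set u [])).map fun h => (ms, keys, h)

theorem expect_learnLaw_eq_unseen (L : Learner) (s l n u r : ℕ) (j : List Bool × List Bool) :
    expect (E.learnLaw L s l n u) (fun w => ind (Clear r (w.1.set u []) j) *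
      (E.blockProb w.2.2 w.2.1 r j.1 - E.blockProb w.2.2 w.2.1 r j.2) ^ 2) =
      E.unseen L s l r j n u := by
  have hb : ∀ w : List (List Bool) × Data × (Data → Bool), |ind (Clear r (w.1.set u []) j) *
      (E.blockProb w.2.2 w.2.1 r j.1 - E.blockProb w.2.2 w.2.1 r j.2) ^ 2| ≤ 1 * 4 := by
    intro w
    rw [abs_mul]
    exact mul_le_mul (abs_ind_le _) (sq_sub_le (E.abs_blockProb_le _ _ _ _)
      (E.abs_blockProb_le _ _ _ _)) (abs_nonneg _) zero_le_one
  rw [learnLaw, expect_bind _ _ hb]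
  simp only [expect_bind _ _ hb, expect_map _ _ hb, expect_const_mul]
  rfl

/-- The joint law of `learnLaw` and of the test results. -/
def traceLaw (P Q : Polynomial ℕ) (L : Learner) (s l n u : ℕ) :
    PMF ((List (List Bool) × Data × (Data → Bool)) × List ((List Bool × List Bool) × Bool)) :=
  (E.learnLaw L s l n u).bind fun w =>
    (E.testsLaw P Q w.2.2 w.2.1 l n).map fun tests => (w, tests)

theorem mem_support_traceLaw {P Q : Polynomial ℕ} {L : Learner} {s l n u : ℕ}
    {z : (List (List Bool) × Data × (Data → Bool)) × List ((List Bool × List Bool) × Bool)}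
    (h : z ∈ (E.traceLaw P Q L s l n u).support) :
    z.1.1 ∈ (iid (coins l) n).support ∧ z.1.2.1 ∈ (E.keyLaw s l).support ∧
      z.2 ∈ (E.testsLaw P Q z.1.2.2 z.1.2.1 l n).support := by
  simp only [traceLaw, learnLaw, PMF.mem_support_bind_iff, PMF.mem_support_map_iff] at h
  obtain ⟨_, ⟨ms, hms, keys, hkeys, h, _, rfl⟩, tests, ht, rfl⟩ := h
  exact ⟨hms, hkeys, ht⟩

/-- A positive test of a pair of blocks that the learner has not seen is improbable. -/
theorem prob_positive_unseen_le (P Q : Polynomial ℕ) (L : Learner) (s l n u : ℕ) {η : ℝ}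
    (hP : 0 < P.eval n) (hη : ∀ j ∈ consecutive (cells (depth Q n)),
      E.unseen L s l (l - depth Q n) j n u ≤ η) :
    prob (E.traceLaw P Q L s l n u) {z | ∃ e ∈ z.2, e.2 = true ∧
      Clear (l - depth Q n) (z.1.1.set u []) e.1} ≤
    (consecutive (cells (depth Q n))).length *
      (1 / (2 * (2 ^ depth Q n * P.eval n : ℕ)) + 4 * (2 ^ depth Q n * P.eval n : ℕ) ^ 2 * η) := by
  set N := 2 ^ depth Q n * P.eval n with hN
  have hN0 : 0 < N := by positivity
  set r := l - depth Q n with hr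
  rw [traceLaw, prob_bind]
  -- For fixed messages, keys and hypothesis, a union bound over the pairs of blocks; pairs that are
  -- not clear cannot occur in the event.
  have hw : ∀ w : List (List Bool) × Data × (Data → Bool),
      prob ((E.testsLaw P Q w.2.2 w.2.1 l n).map fun tests => (w, tests))
        {z | ∃ e ∈ z.2, e.2 = true ∧ Clear r (z.1.1.set u []) e.1} ≤
      ((consecutive (cells (depth Q n))).map fun j => 1 / (2 * (N : ℝ)) + 4 * (N : ℝ) ^ 2 *
        (ind (Clear r (w.1.set u []) j) *
        (E.blockProb w.2.2 w.2.1 r j.1 - E.blockProb w.2.2 w.2.1 r j.2) ^ 2)).sum := by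
    intro w
    rw [prob_map, testsLaw]
    refine (prob_seqLaw_exists_le _ _ {e : (List Bool × List Bool) × Bool |
      e.2 = true ∧ Clear r (w.1.set u []) e.1}).trans ?_
    refine List.sum_le_sum fun j _ => ?_
    rw [prob_map]
    by_cases hc : Clear r (w.1.set u []) j
    · rw [ind_true hc, one_mul]
      refine (prob_mono _ fun b _ hb => ?_).trans (E.prob_testLaw_true_le w.2.2 w.2.1 r j hN0)
      exact hb.1
    · rw [ind_false hc, prob_eq_expect]
      refine (expect_congr _ fun b _ => ind_false fun hb => hc hb.2).trans_le ?_
      rw [expect_const]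
      positivity
  have hb : ∀ (w : List (List Bool) × Data × (Data → Bool)) (j : List Bool × List Bool),
      |ind (Clear r (w.1.set u []) j) *
      (E.blockProb w.2.2 w.2.1 r j.1 - E.blockProb w.2.2 w.2.1 r j.2) ^ 2| ≤ 1 * 4 := by
    intro w j
    rw [abs_mul]
    exact mul_le_mul (abs_ind_le _) (sq_sub_le (E.abs_blockProb_le _ _ _ _)
      (E.abs_blockProb_le _ _ _ _)) (abs_nonneg _) zero_le_one
  have hb' : ∀ (w : List (List Bool) × Data × (Data → Bool)) (j : List Bool × List Bool),
      |1 / (2 * (N : ℝ)) + 4 * (N : ℝ) ^ 2 * (ind (Clear r (w.1.set u []) j) *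
      (E.blockProb w.2.2 w.2.1 r j.1 - E.blockProb w.2.2 w.2.1 r j.2) ^ 2)| ≤
      1 / (2 * (N : ℝ)) + 4 * (N : ℝ) ^ 2 * (1 * 4) := by
    intro w j
    refine (abs_add_le _ _).trans (add_le_add (abs_of_nonneg (by positivity)).le ?_)
    rw [abs_mul, abs_of_nonneg (by positivity : (0 : ℝ) ≤ 4 * (N : ℝ) ^ 2)]
    exact mul_le_mul_of_nonneg_left (hb w j) (by positivity)
  have hsum : ∀ w : List (List Bool) × Data × (Data → Bool), |((consecutive (cells (depth Q n))).map fun j => 1 / (2 * (N : ℝ)) +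
      4 * (N : ℝ) ^ 2 * (ind (Clear r (w.1.set u []) j) *
      (E.blockProb w.2.2 w.2.1 r j.1 - E.blockProb w.2.2 w.2.1 r j.2) ^ 2)).sum| ≤
      (consecutive (cells (depth Q n))).length *
        (1 / (2 * (N : ℝ)) + 4 * (N : ℝ) ^ 2 * (1 * 4)) := by
    exact fun w => abs_list_sum_le _ (hb' w)
  refine (expect_mono _ (fun _ => abs_prob_le _ _) hsum fun w _ => hw w).trans ?_
  rw [expect_list_sum _ _ _ hb']
  refine (List.sum_le_card_nsmul _ (1 / (2 * (N : ℝ)) + 4 * (N : ℝ) ^ 2 * η) fun x hx => ?_).trans_eq ?_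
  · rw [List.mem_map] at hx
    obtain ⟨j, hj, rfl⟩ := hx
    rw [expect_add _ (fun _ => le_rfl) (C' := 4 * (N : ℝ) ^ 2 * (1 * 4)) fun w => by
      rw [abs_mul, abs_of_nonneg (by positivity : (0 : ℝ) ≤ 4 * (N : ℝ) ^ 2)]
      exact mul_le_mul_of_nonneg_left (hb w j) (by positivity), expect_const, expect_const_mul,
      E.expect_learnLaw_eq_unseen]
    have := hη j hj
    gcongr
  · rw [List.length_map, nsmul_eq_mul]

/-- Two messages meet the same pair of consecutive blocks. -/
def Near (d r : ℕ) (x y : List Bool) : Prop :=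
  ∃ j ∈ consecutive (cells d), (x.drop r = j.1 ∨ x.drop r = j.2) ∧ (y.drop r = j.1 ∨ y.drop r = j.2)

/-- If `x` lies in block `v`, a message near it lies in block `v - 1`, `v` or `v + 1`, each of
probability `2 ^ (-d)`. For `v = 0` the truncated subtraction only lists a block twice. -/
theorem expect_near_le {l d : ℕ} (hd : d ≤ l) (x : List Bool) :
    expect (coins l) (fun y => ind (Near d (l - d) x y)) ≤ 3 * (2⁻¹ : ℝ) ^ d := by
  set v := bitsVal (x.drop (l - d))
  have h₁ := expect_ind_mem_le (coins d) Function.injective_id (toReal_coins_apply_le d)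
    (by positivity) [msgBits d (v - 1), msgBits d v, msgBits d (v + 1)]
  have h₂ : coins d = (coins l).map (List.drop (l - d)) := by
    rw [map_drop_coins (Nat.sub_le _ _), Nat.sub_sub_self hd]
  conv_lhs at h₁ => rw [h₂]
  rw [expect_map _ _ fun _ => abs_ind_le _] at h₁
  refine (expect_mono _ (fun _ => abs_ind_le _) (fun _ => abs_ind_le _) fun y _ =>
    ind_mono ?_).trans (h₁.trans_eq (by norm_num))
  rintro ⟨j, hj, hx, hy⟩
  obtain ⟨w, hw, -, rfl⟩ := mem_consecutive_cells hj
  have hv : v = w ∨ v = w + 1 := by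
    rcases hx with hx | hx
    · left; exact (congrArg bitsVal hx).trans (bitsVal_msgBits (by omega))
    · right; exact (congrArg bitsVal hx).trans (bitsVal_msgBits hw)
  simp only [id, List.mem_cons, List.not_mem_nil, or_false]
  rcases hv with hv | hv <;> rcases hy with hy | hy <;> rw [hy, hv] <;> simp

/-- A hypothesis that errs less than every other time is more likely to accept one block than the
next one. -/
theorem exists_drop_of_error {s l d : ℕ} {keys : Data} (hk : keys ∈ (E.keyLaw s l).support)
    (hd : 1 ≤ d) (hdl : d ≤ l) {γ : ℝ} {p : ℕ} (hp : 1 ≤ p * γ) (h : Data → Bool)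
    (herr : genError ((coins l).bind fun m => (E.encBits keys.fst m).map (Data.cons keys.snd))
      (E.thresh l keys (2 ^ (l - 1) + 1)) h ≤ 1 / 2 - γ) :
    ∃ j ∈ consecutive (cells d), 2 / ((2 ^ d * p : ℕ) : ℝ) ≤
      E.blockProb h keys (l - d) j.1 - E.blockProb h keys (l - d) j.2 := by
  set r := l - d with hr
  have herr' : genError ((coins l).bind fun m => (E.encBits keys.fst m).map (Data.cons keys.snd))
      (E.thresh l keys (2 ^ (l - 1) + 1)) h =
      expect (coins l) fun m => bif label m then 1 - E.accept h keys m else E.accept h keys m := by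
    rw [genError, prob_bind]
    refine expect_congr _ fun m hm => ?_
    have hl := length_of_mem_support_coins hm
    rw [prob_map, prob_eq_expect]
    have : ∀ c ∈ (E.encBits keys.fst m).support, ind (c ∈ Data.cons keys.snd ⁻¹'
        {x | h x ≠ E.thresh l keys (2 ^ (l - 1) + 1) x}) =
        bif label m then 1 - ind (h (.cons keys.snd c) = true)
          else ind (h (.cons keys.snd c) = true) := by
      intro c hc
      have ht := E.thresh_eq_label (s := s) (m := m) (by rw [hl]; exact hk) hc
      rw [hl] at ht
      simp only [Set.mem_preimage, Set.mem_ofPred_eq, ht]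
      cases label m <;> cases h (.cons keys.snd c) <;> simp [ind]
    rw [expect_congr _ this]
    cases label m
    · rfl
    · simp only [cond_true]
      rw [expect_sub _ (fun _ => le_rfl) fun _ => abs_ind_le _, expect_const]
      rfl
  have hbound : ∀ m, |(bif label m then 1 - E.accept h keys m else E.accept h keys m)| ≤ 1 := by
    intro m
    have h₁ := E.accept_nonneg h keys m
    have h₂ := E.accept_le_one h keys m
    cases label m
    · exact E.abs_accept_le h keys m
    · simp only [cond_true]; rw [abs_le]; constructor <;> linarith
  have hsplit : coins l = (coins r).bind fun a => (coins d).map fun b => a ++ b := by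
    have := iid_add coin r d
    rwa [hr, Nat.sub_add_cancel hdl] at this
  -- `K` is half the number of blocks. As there are at least two blocks, the threshold falls on a
  -- boundary between blocks, and the label of a message is determined by its block.
  obtain ⟨K, hK⟩ : ∃ K, 2 ^ d = K + K := ⟨2 ^ (d - 1), by
    rw [← two_mul, ← pow_succ']; congr 1; omega⟩
  have hlabel : ∀ v < 2 ^ d, ∀ a, label (a ++ msgBits d v) = decide (v < K) := by
    intro v hv a
    have h₁ : label (a ++ msgBits d v) = label (msgBits d v) := by
      have : (msgBits d v).reverse ≠ [] := by
        intro h0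
        have := congrArg List.length h0
        simp at this
        omega
      rw [label, label, List.reverse_append]
      cases hc : (msgBits d v).reverse with
      | nil => exact absurd hc this
      | cons b bs => rfl
    have h₂ : 2 ^ (d - 1) = K := by
      have : 2 ^ d = 2 * 2 ^ (d - 1) := by rw [← pow_succ']; congr 1; omega
      omega
    rw [h₁, label_eq, bitsVal_msgBits hv, length_msgBits, h₂]
  have hval : expect (coins l) (fun m => bif label m then 1 - E.accept h keys m
      else E.accept h keys m) = (∑ v ∈ Finset.range (2 ^ d), if v < K then
        1 - E.blockProb h keys r (msgBits d v) else E.blockProb h keys r (msgBits d v)) / 2 ^ d := by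
    rw [hsplit, expect_bind _ _ hbound]
    simp only [expect_map _ _ hbound]
    rw [expect_comm _ _ fun a b => hbound (a ++ b), expect_coins_eq_sum]
    congr 1
    refine Finset.sum_congr rfl fun v hv => ?_
    simp only [hlabel v (Finset.mem_range.1 hv)]
    by_cases hvK : v < K
    · simp only [hvK, decide_true, cond_true, if_true]
      rw [expect_sub _ (fun _ => le_rfl) fun _ => E.abs_accept_le _ _ _, expect_const]
      rfl
    · simp only [hvK, decide_false, cond_false, if_false]
      rfl
  rw [herr', hval, hK, Finset.sum_range_add] at herr
  rw [Finset.sum_congr rfl fun v hv => if_pos (Finset.mem_range.1 hv)] at herr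
  simp only [Nat.not_lt.2 (Nat.le_add_right _ _), if_false, Finset.sum_sub_distrib,
    Finset.sum_const, Finset.card_range, nsmul_eq_mul, mul_one] at herr
  have hK0 : (0 : ℝ) < K := by
    have : 0 < K := by
      have : 0 < 2 ^ d := by positivity
      omega
    exact_mod_cast this
  have h2d : (2 : ℝ) ^ d = K + K := by exact_mod_cast hK
  have hp0 : (0 : ℝ) < p := by
    rcases Nat.eq_zero_or_pos p with h0 | h0
    · rw [h0] at hp; norm_num at hp
    · exact_mod_cast h0
  rw [h2d, div_le_iff₀ (by linarith)] at herr
  -- Here `2 ^ d = 2K`, so `θ = 1/(Kp)` and `K * K * θ = K/p ≤ Kγ`, whereas the bound on the error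
  -- makes the two half-sums differ by at least `2Kγ`.
  obtain ⟨v, hv, hdrop⟩ := exists_drop (p := fun v => E.blockProb h keys r (msgBits d v)) (K := K)
    (θ := 2 / ((2 ^ d * p : ℕ) : ℝ)) (by
      have : (K : ℝ) * K * (2 / ((2 ^ d * p : ℕ) : ℝ)) = K / p := by
        rw [hK]; push_cast; field_simp; ring
      rw [this, div_lt_iff₀ hp0]
      nlinarith)
  exact ⟨_, mem_consecutive_cells_of_lt (by omega), hdrop⟩

end ORE

end PrivLearn

/-! ### The two failure probabilities of tracing. -/

namespace PrivLearn

open Data Filter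

theorem map_congr_support {α β : Type} (p : PMF α) {f g : α → β} (h : ∀ a ∈ p.support, f a = g a) :
    p.map f = p.map g :=
  bind_congr_support p fun a ha => congrArg PMF.pure (h a ha)

theorem mem_eraseIdx_of_mem_set {α : Type} {l : List α} {i : ℕ} {a y : α} (h : y ∈ l.set i a)
    (hy : y ≠ a) : y ∈ l.eraseIdx i := by
  induction l generalizing i with
  | nil => simp at h
  | cons b l ih =>
    cases i with
    | zero => simpa [hy] using h
    | succ i =>
      simp only [List.set_cons_succ, List.mem_cons, List.eraseIdx_cons_succ] at h ⊢
      exact h.imp_right ih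

namespace ORE

variable (E : ORE)

theorem map_traceLaw (P Q : Polynomial ℕ) (L : Learner) (s l n u : ℕ) :
    (E.traceLaw P Q L s l n u).map (fun z => z.1.1) = iid (coins l) n := by
  simp only [traceLaw, learnLaw, PMF.map, PMF.bind_bind, PMF.pure_bind, Function.comp_def,
    PMF.bind_const]
  exact PMF.bind_pure _

/-- An example that the learner did not get is rarely accused. -/
theorem prob_accused_le (P Q : Polynomial ℕ) (L : Learner) (s l n u : ℕ) {η : ℝ}
    (hP : 0 < P.eval n) (hd : depth Q n ≤ l) (hη : ∀ j ∈ consecutive (cells (depth Q n)),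
      E.unseen L s l (l - depth Q n) j n u ≤ η) :
    prob (E.traceLaw P Q L s l n u) {z | ∃ m, z.1.1[u]? = some m ∧
      accused (l - depth Q n) z.2 m} ≤
    (consecutive (cells (depth Q n))).length *
      (1 / (2 * (2 ^ depth Q n * P.eval n : ℕ)) + 4 * (2 ^ depth Q n * P.eval n : ℕ) ^ 2 * η) +
      n * (3 * (2⁻¹ : ℝ) ^ depth Q n) := by
  have hcol := expect_iid_collision_le (coins l) (expect_near_le hd) (by positivity) u n
  rw [← E.map_traceLaw P Q L s l n u, expect_map _ _ fun _ => abs_ind_le _] at hcol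
  refine le_trans ?_ (add_le_add (E.prob_positive_unseen_le P Q L s l n u hP hη) hcol)
  refine le_trans (prob_mono _ fun z hz h => ?_) ((prob_union_le _ _ {z | ∃ x, z.1.1[u]? = some x ∧
    ∃ y ∈ z.1.1.eraseIdx u, Near (depth Q n) (l - depth Q n) x y}).trans_eq
    (congrArg _ (prob_eq_expect _ _)))
  obtain ⟨m, hm, e, he, hpos, hme⟩ := h
  -- The pair that leads to the accusation of message `u` either contains no message given to the
  -- learner, so that its positive test is of the improbable kind, or it contains another message,
  -- which is then near to message `u`.
  by_cases hc : Clear (l - depth Q n) (z.1.1.set u []) e.1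
  · exact Or.inl ⟨e, he, hpos, hc⟩
  · right
    simp only [Clear, not_forall] at hc
    obtain ⟨y, hy, hye⟩ := hc
    rw [mem_real] at hy
    refine ⟨m, hm, y, mem_eraseIdx_of_mem_set hy.1 hy.2, e.1,
      E.mem_consecutive_of_mem_tests (mem_support_traceLaw E hz).2.2 e he, hme, ?_⟩
    tauto

/-- The law of an instance: an encryption of a uniformly random message. -/
def messageDist (l : ℕ) (keys : Data) : PMF Data :=
  (coins l).bind fun m => (E.encBits keys.fst m).map (Data.cons keys.snd)

/-- Somebody is accused if the hypothesis is accurate. -/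
theorem prob_not_accused_le (P Q : Polynomial ℕ) (L : Learner) (s l n : ℕ) {η γ : ℝ}
    (hP : 1 ≤ P.eval n * γ) (hd₁ : 1 ≤ depth Q n) (hd : depth Q n ≤ l)
    (hη : ∀ j ∈ consecutive (cells (depth Q n)), E.unseen L s l (l - depth Q n) j n n ≤ η) :
    prob (E.traceLaw P Q L s l n n) {z | genError (E.messageDist l z.1.2.1)
      (E.thresh l z.1.2.1 (2 ^ (l - 1) + 1)) z.1.2.2 ≤ 1 / 2 - γ ∧
      ∀ m ∈ z.1.1, ¬ accused (l - depth Q n) z.2 m} ≤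
    (consecutive (cells (depth Q n))).length *
      (1 / (2 * (2 ^ depth Q n * P.eval n : ℕ)) + 4 * (2 ^ depth Q n * P.eval n : ℕ) ^ 2 * η) +
      1 / (8 * (2 ^ depth Q n * P.eval n : ℕ)) := by
  have hP0 : 0 < P.eval n := Nat.pos_of_ne_zero fun h => by rw [h] at hP; norm_num at hP
  set N := 2 ^ depth Q n * P.eval n with hN
  have hN0 : 0 < N := by positivity
  set r := l - depth Q n with hr
  refine le_trans ?_ (add_le_add_left (E.prob_positive_unseen_le P Q L s l n n hP0 hη) _)
  have hadd : ∀ f : List (List Bool) × Data × (Data → Bool) → ℝ, (∀ w, |f w| ≤ 1) →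
      expect (E.learnLaw L s l n n) f + 1 / (8 * (N : ℝ)) =
      expect (E.learnLaw L s l n n) fun w => f w + 1 / (8 * (N : ℝ)) := fun f hf => by
    rw [expect_add _ hf fun _ => le_rfl, expect_const]
  rw [traceLaw, prob_bind, prob_bind, hadd _ fun _ => abs_prob_le _ _]
  refine expect_mono (C' := 1 + |1 / (8 * (N : ℝ))|) _ (fun _ => abs_prob_le _ _)
    (fun _ => (abs_add_le _ _).trans (add_le_add (abs_prob_le _ _) le_rfl)) fun w hw => ?_
  simp only [learnLaw, PMF.mem_support_bind_iff, PMF.mem_support_map_iff] at hw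
  obtain ⟨ms, hms, keys, hkeys, h, _, rfl⟩ := hw
  -- Position `n` is past the end of a sample of size `n`, so the case `u = n` describes the learner
  -- that gets the whole sample.
  have hset : ms.set n [] = ms := List.set_eq_of_length_le (length_of_mem_support_iid hms).le
  rw [prob_map, prob_map]
  by_cases herr : genError (E.messageDist l keys) (E.thresh l keys (2 ^ (l - 1) + 1)) h ≤ 1 / 2 - γ
  · obtain ⟨j, hj, hdrop⟩ := E.exists_drop_of_error hkeys hd₁ hd hP h herr
    have h₁ := prob_seqLaw_forall_le (fun j => (E.testLaw h keys r (8 * N ^ 3) (8 * N ^ 2) j).map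
      fun b => (j, b)) {e | e.1 = j → e.2 = false} hj
    rw [prob_map] at h₁
    have h₂ : prob (E.testLaw h keys r (8 * N ^ 3) (8 * N ^ 2) j) ((fun b => (j, b)) ⁻¹'
        {e | e.1 = j → e.2 = false}) ≤ 1 / (8 * N) :=
      (prob_mono _ fun b _ (hb : j = j → b = false) => hb rfl).trans (E.prob_testLaw_false_le h keys r j hN0 hdrop)
    refine le_trans (prob_mono _ fun tests ht hmem => ?_) ((prob_union_le _ _ {tests |
      ∀ e ∈ tests, e ∈ {e : (List Bool × List Bool) × Bool | e.1 = j → e.2 = false}}).trans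
      (add_le_add le_rfl (h₁.trans h₂)))
    -- If the pair with the large drop tests positive and nobody is accused, then no message of the
    -- sample lies in it, and it is an unseen pair with a positive test.
    by_cases hall : ∀ e ∈ tests, e.1 = j → e.2 = false
    · exact Or.inr hall
    · left
      push Not at hall
      obtain ⟨e, he, rfl, hpos⟩ := hall
      have hpos : e.2 = true := by simpa using hpos
      refine ⟨e, he, hpos, fun m hm => ?_⟩
      have hm := (mem_real.1 hm).1
      simp only [hset] at hm
      have := hmem.2 m hm
      simp only [accused, not_exists, not_and, not_or] at this
      exact this e he hpos
  · rw [prob_eq_expect, expect_congr _ fun tests _ => ind_false fun hmem => herr hmem.1, expect_const]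
    have := prob_nonneg (E.testsLaw P Q h keys l n) ((fun tests => ((ms, keys, h), tests)) ⁻¹'
      {z | ∃ e ∈ z.2, e.2 = true ∧ Clear r (z.1.1.set n []) e.1})
    positivity

/-- Both kinds of failure are improbable. -/
theorem eventually_trace_le {ℓ : ℕ → ℕ} (hN : Negligible fun s => 1 / (2 : ℝ) ^ ℓ s)
    (hsec : E.StaticallySingleChallengeSecure ℓ) {γ : ℕ → ℝ} {P : Polynomial ℕ}
    (hP : ∀ n, 1 ≤ n → 1 ≤ P.eval n * γ n) {Q : Polynomial ℕ} (hQ : Q = 12 * (.X + 1) * P)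
    (L : Learner) (b : Polynomial ℕ) :
    ∀ᶠ s in atTop, 1 ≤ ℓ s ∧ ∀ n, 1 ≤ n → n ≤ b.eval s → depth Q n ≤ ℓ s ∧
      prob (E.traceLaw P Q L s (ℓ s) n n) {z | genError (E.messageDist (ℓ s) z.1.2.1)
        (E.thresh (ℓ s) z.1.2.1 (2 ^ (ℓ s - 1) + 1)) z.1.2.2 ≤ 1 / 2 - γ n ∧
        ∀ m ∈ z.1.1, ¬ accused (ℓ s - depth Q n) z.2 m} ≤ 1 / (P.eval n : ℕ) ∧
      ∀ u < n, prob (E.traceLaw P Q L s (ℓ s) n u) {z | ∃ m, z.1.1[u]? = some m ∧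
        accused (ℓ s - depth Q n) z.2 m} ≤ 1 / (P.eval n : ℕ) := by
  -- The last polynomial is at least `16N³` for every `n ≤ b(s)`, where `N = 2 ^ depth Q n * P n`;
  -- so the mean square on unseen pairs is at most `1/(16N³)`.
  filter_upwards [eventually_depth_le hN b Q, E.eventually_unseen_le hN hsec L b Q
    (16 * ((2 * Q.comp b + 1) * P.comp b) ^ 3)] with s ⟨hl, hd⟩ hη
  refine ⟨hl, fun n hn hnb => ?_⟩
  have hP0 : 0 < P.eval n := Nat.pos_of_ne_zero fun h => by
    have := hP n hn
    rw [h] at this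
    norm_num at this
  have hdn := hd n hnb
  set K := 2 ^ depth Q n with hK
  -- This is what the form of `Q` is for: it gives `3n/K ≤ 1/(4P)` for the probability that another
  -- message falls into the same pair.
  have hKQ : 12 * (n + 1) * P.eval n ≤ K := by
    have : Q.eval n ≤ K := Nat.le_pow_clog (by norm_num) _
    rw [hQ] at this
    simpa using this
  have hKn : 24 ≤ K := by nlinarith
  have hd₁ : 1 ≤ depth Q n := by
    by_contra! h0
    have : depth Q n = 0 := by omega
    rw [hK, this] at hKn
    norm_num at hKn
  set N := K * P.eval n with hNdef
  have hN0 : 0 < N := by positivity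
  have hη' : ∀ u ≤ n, ∀ j ∈ consecutive (cells (depth Q n)),
      E.unseen L s (ℓ s) (ℓ s - depth Q n) j n u ≤ 1 / (16 * (N : ℝ) ^ 3) := by
    intro u hu j hj
    have h := hη n hnb u hu j hj
    have h0 : 0 ≤ E.unseen L s (ℓ s) (ℓ s - depth Q n) j n u :=
      expect_nonneg _ fun _ => mul_nonneg (ind_nonneg _) (E.spread_nonneg _ _ _ _ _ _)
    have hle : 16 * N ^ 3 ≤ (16 * ((2 * Q.comp b + 1) * P.comp b) ^ 3 : Polynomial ℕ).eval s := by
      simp only [Polynomial.eval_mul, Polynomial.eval_pow, Polynomial.eval_add,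
        Polynomial.eval_ofNat, Polynomial.eval_comp, Polynomial.eval_one]
      have h₁ : K ≤ 2 * Q.eval n + 1 := two_pow_clog_le _
      have h₂ := eval_mono Q hnb
      have h₃ := eval_mono P hnb
      have h₄ : K ≤ 2 * Q.eval (b.eval s) + 1 := by omega
      rw [hNdef]
      gcongr
    have hle' : 16 * (N : ℝ) ^ 3 ≤
        ((16 * ((2 * Q.comp b + 1) * P.comp b) ^ 3 : Polynomial ℕ).eval s : ℕ) := by
      exact_mod_cast hle
    rw [le_div_iff₀ (by positivity)]
    nlinarith
  have hlen : ((consecutive (cells (depth Q n))).length : ℝ) ≤ K - 1 := by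
    have h₁ := length_consecutive_cells_le (depth Q n)
    have h₂ : (consecutive (cells (depth Q n))).length + 1 ≤ K := by omega
    have h₃ : (((consecutive (cells (depth Q n))).length + 1 : ℕ) : ℝ) ≤ K := by exact_mod_cast h₂
    push_cast at h₃
    linarith
  have hK0 : (0 : ℝ) < K := by positivity
  have hp0 : (0 : ℝ) < (P.eval n : ℕ) := by exact_mod_cast hP0
  have hNR : (N : ℝ) = K * (P.eval n : ℕ) := by rw [hNdef]; push_cast; ring
  -- Each of the at most `K - 1` pairs contributes `1/(2N) + 4N²/(16N³) = 3/(4N)`, and `K/N = 1/P`.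
  -- There is one pair less than there are blocks; the term `3/(4N)` saved in this way later pays
  -- for the `1/(8N)` of a missed drop.
  have hmain : ((consecutive (cells (depth Q n))).length : ℝ) *
      (1 / (2 * (N : ℝ)) + 4 * (N : ℝ) ^ 2 * (1 / (16 * (N : ℝ) ^ 3))) ≤
      3 / (4 * (P.eval n : ℕ)) - 3 / (4 * N) := by
    have h₁ : 1 / (2 * (N : ℝ)) + 4 * (N : ℝ) ^ 2 * (1 / (16 * (N : ℝ) ^ 3)) = 3 / (4 * N) := by
      have : (0 : ℝ) < N := by exact_mod_cast hN0
      field_simp; ring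
    rw [h₁]
    refine (mul_le_mul_of_nonneg_right hlen (by positivity)).trans_eq ?_
    rw [sub_mul, one_mul, hNR]
    congr 1
    field_simp
  have hN0' : (0 : ℝ) < N := by exact_mod_cast hN0
  refine ⟨hdn, ?_, fun u hu => ?_⟩
  · refine (E.prob_not_accused_le P Q L s (ℓ s) n (hP n hn) hd₁ hdn (hη' n le_rfl)).trans
      ((add_le_add_left hmain _).trans ?_)
    have h₁ : 1 / (8 * (N : ℝ)) ≤ 3 / (4 * N) := by
      rw [div_le_div_iff₀ (by positivity) (by positivity)]; linarith
    have h₂ : (3 : ℝ) / (4 * (P.eval n : ℕ)) ≤ 1 / (P.eval n : ℕ) := by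
      rw [div_le_div_iff₀ (by positivity) (by positivity)]; linarith
    linarith
  · refine (E.prob_accused_le P Q L s (ℓ s) n u hP0 hdn (hη' u hu.le)).trans
      ((add_le_add_left hmain _).trans ?_)
    have h₁ : (n : ℝ) * (3 * (2⁻¹ : ℝ) ^ depth Q n) ≤ 1 / (4 * (P.eval n : ℕ)) := by
      have h₂ : (2⁻¹ : ℝ) ^ depth Q n = 1 / K := by rw [hK]; push_cast; rw [inv_pow, one_div]
      have h₃ : (12 : ℝ) * (n + 1) * (P.eval n : ℕ) ≤ K := by exact_mod_cast hKQ
      rw [h₂, show (n : ℝ) * (3 * (1 / (K : ℝ))) = 3 * n / K by ring,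
        div_le_div_iff₀ hK0 (by positivity)]
      nlinarith
    have h₂ : (3 : ℝ) / (4 * (P.eval n : ℕ)) + 1 / (4 * (P.eval n : ℕ)) = 1 / (P.eval n : ℕ) := by
      field_simp; norm_num
    have h₃ : 0 ≤ 3 / (4 * (N : ℝ)) := by positivity
    linarith

end ORE

end PrivLearn

namespace PrivLearn

open Data Filter

namespace ORE

variable (E : ORE)

/-! ### The example reidentification scheme -/

/-- The key is `((sk, params), 1ˡ)`; the threshold is half-way. -/
def reidScheme (G T : RandAlg) : ReidScheme where
  gen := G
  trace := T
  concept k := E.thresh k.snd.toList.length k.fst (2 ^ (k.snd.toList.length - 1) + 1)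
  dist k := E.messageDist k.snd.toList.length k.fst

def sampleOf (keys : Data) (ex : List (List Bool × Data)) : List (Data × Bool) :=
  ex.map fun e => (.cons keys.snd e.2, label e.1)

theorem key_outputOf (l n : ℕ) (keys : Data) (ex : List (List Bool × Data)) :
    ReidScheme.key (outputOf l n keys ex) = .cons keys (unary l) := rfl

theorem junk_outputOf (l n : ℕ) (keys : Data) (ex : List (List Bool × Data)) :
    ReidScheme.junk (outputOf l n keys ex) = (.nil, false) := rfl

theorem state_outputOf (l n : ℕ) (keys : Data) (ex : List (List Bool × Data)) :
    ReidScheme.state (outputOf l n keys ex) =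
      .cons (.cons (unary n) (unary l)) (.cons keys (ofLists (ex.map fun e => e.1))) := by
  simp only [ReidScheme.state, outputOf, reidOutput, snd_cons, fst_cons, toList_ofList,
    List.map_map, Function.comp_def, ofLists]

theorem sample_outputOf (l n : ℕ) (keys : Data) (ex : List (List Bool × Data)) :
    ReidScheme.sample (outputOf l n keys ex) = sampleOf keys ex := by
  simp only [ReidScheme.sample, outputOf, reidOutput, snd_cons, fst_cons, toList_ofList,
    List.map_map, Function.comp_def, decodeSample, decodeExample, sampleOf, labelData_ofBits,
    toBool_ofBool]

theorem seqLaw_sampleOf (keys : Data) {ms : List (List Bool)} (h : ∀ m ∈ ms, m ≠ []) :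
    (seqLaw (ms.map fun m => (E.encBits keys.fst m).map fun c => (m, c))).map
      (fun ex => (ex.map (fun e => e.1), sampleOf keys ex)) =
    (seqLaw (ms.map (E.exLaw keys))).map fun S => (ms, S) := by
  induction ms with
  | nil => simp [seqLaw, PMF.pure_map, sampleOf]
  | cons m ms ih =>
    have ih := ih fun m hm => h m (List.mem_cons_of_mem _ hm)
    have ih' := congrArg (fun p => fun (x : List Bool × (Data × Bool)) =>
      p.map fun z : List (List Bool) × List (Data × Bool) => (x.1 :: z.1, x.2 :: z.2)) ih
    simp only [PMF.map_comp, Function.comp_def] at ih'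
    have hm : m ≠ [] := h m (by simp)
    simp only [List.map_cons, seqLaw, exLaw, if_neg hm, PMF.bind_map, PMF.map_bind, PMF.map_comp,
      Function.comp_def]
    congr 1
    ext1 c
    exact congrFun ih' (m, (.cons keys.snd c, label m))

/-- Replacing an example by the junk example discards its encryption, which is independent of
everything else. Marking the message by the empty string before encrypting therefore gives the same
law, jointly with the true messages kept by the tracer. -/
theorem seqLaw_sampleOf_set (keys : Data) {ms : List (List Bool)} (h : ∀ m ∈ ms, m ≠ []) (u : ℕ) :
    (seqLaw (ms.map fun m => (E.encBits keys.fst m).map fun c => (m, c))).map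
      (fun ex => (ex.map (fun e => e.1), (sampleOf keys ex).set u (.nil, false))) =
    (seqLaw ((ms.set u []).map (E.exLaw keys))).map fun S => (ms, S) := by
  induction ms generalizing u with
  | nil => simp [seqLaw, PMF.pure_map, sampleOf]
  | cons m ms ih =>
    have ih := ih fun m hm => h m (List.mem_cons_of_mem _ hm)
    have hm : m ≠ [] := h m (by simp)
    cases u with
    | zero =>
      have h₁ := congrArg (PMF.map fun z : List (List Bool) × List (Data × Bool) =>
        (m :: z.1, (Data.nil, false) :: z.2))
        (E.seqLaw_sampleOf keys fun m hm => h m (List.mem_cons_of_mem _ hm))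
      simp only [PMF.map_comp, Function.comp_def] at h₁
      simp only [List.map_cons, seqLaw, exLaw, List.set_cons_zero, if_true, PMF.bind_map,
        PMF.map_bind, PMF.map_comp, Function.comp_def, PMF.pure_bind, sampleOf] at h₁ ⊢
      rw [PMF.bind_const]
      exact h₁
    | succ u =>
      have ih' := congrArg (fun p => fun (x : List Bool × (Data × Bool)) =>
        p.map fun z : List (List Bool) × List (Data × Bool) => (x.1 :: z.1, x.2 :: z.2)) (ih u)
      simp only [PMF.map_comp, Function.comp_def] at ih'
      simp only [List.map_cons, seqLaw, exLaw, List.set_cons_succ, if_neg hm, PMF.bind_map,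
        PMF.map_bind, PMF.map_comp, Function.comp_def]
      congr 1
      ext1 c
      exact congrFun ih' (m, (.cons keys.snd c, label m))

theorem genLaw_reidScheme {G T : RandAlg} {A : Alg} {s l : ℕ} (n : ℕ)
    (hG : ∀ x, G.run noOracle x = E.reidGenKernel A x) (hA : A.out noOracle (unary s) = unary l) :
    (E.reidScheme G T).genLaw s n = (E.keyLaw s l).bind fun keys =>
      (iid (E.exampleLaw keys l) n).map (outputOf l n keys) := by
  rw [ReidScheme.genLaw, ← E.reidGenKernel_eq hA]
  exact hG _

/-- Messages and keys are independent, so the messages may be drawn first, as in `learnLaw`. The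
assumption `1 ≤ l` ensures that no message is the empty string, which is reserved for the junk
example. -/
theorem game_reidScheme {G T : RandAlg} {A : Alg} {P Q : Polynomial ℕ} {s l : ℕ} (n u : ℕ)
    (hG : ∀ x, G.run noOracle x = E.reidGenKernel A x) (hA : A.out noOracle (unary s) = unary l)
    (hT : ∀ O x, T.run O x = E.traceKernel P Q O x) (hl : 1 ≤ l) (L : Learner) :
    (E.reidScheme G T).game L s n (ReidScheme.sampleWithout u) =
      (E.traceLaw P Q L s l n u).map fun z => (.cons z.1.2.1 (unary l), z.1.2.2,
        verdictData (unary (l - depth Q n)) (testsData z.2) (ofLists z.1.1)) := by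
  rw [ReidScheme.game, E.genLaw_reidScheme n hG hA, traceLaw, learnLaw]
  have hk : ∀ keys, ((iid (E.exampleLaw keys l) n).map (outputOf l n keys)).bind (fun o =>
      (L.hyp s (ReidScheme.sampleWithout u o)).bind fun h =>
        ((E.reidScheme G T).trace.run h (ReidScheme.state o)).map fun z =>
          (ReidScheme.key o, h, z)) =
      (iid (coins l) n).bind fun ms => (E.hypLaw L s keys (ms.set u [])).bind fun h =>
        (E.testsLaw P Q h keys l n).map fun tests => (.cons keys (unary l), h,
          verdictData (unary (l - depth Q n)) (testsData tests) (ofLists ms)) := by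
    intro keys
    have htr : ∀ h x, (E.reidScheme G T).trace.run h x = E.traceKernel P Q h x := fun h x => hT h x
    simp only [PMF.bind_map, Function.comp_def, ReidScheme.sampleWithout, key_outputOf,
      junk_outputOf, state_outputOf, sample_outputOf, htr, traceKernel_eq, PMF.map_comp]
    rw [exampleLaw, iid_bind, PMF.bind_bind]
    refine bind_congr_support _ fun ms hms => ?_
    have hne : ∀ m ∈ ms, m ≠ [] := by
      rintro m hm rfl
      have := length_of_mem_support_coins (mem_support_of_mem_support_iid hms _ hm)
      simp at this
      omega
    have h₁ := congrArg (fun p => p.bind fun z : List (List Bool) × List (Data × Bool) =>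
      (L.hyp s z.2).bind fun h => (E.testsLaw P Q h keys l n).map fun tests =>
        (Data.cons keys (unary l), h,
          verdictData (unary (l - depth Q n)) (testsData tests) (ofLists z.1)))
      (E.seqLaw_sampleOf_set keys hne u)
    simp only [PMF.bind_map, Function.comp_def] at h₁
    rw [h₁, hypLaw, PMF.bind_bind]
  rw [PMF.bind_bind]
  simp only [hk]
  rw [PMF.bind_comm]
  simp only [PMF.bind_bind, PMF.map_bind, PMF.bind_map, PMF.map_comp, Function.comp_def]

theorem mem_support_genLaw {G T : RandAlg} {A : Alg} {s l n : ℕ}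
    (hG : ∀ x, G.run noOracle x = E.reidGenKernel A x) (hA : A.out noOracle (unary s) = unary l)
    {o : Data} (ho : o ∈ ((E.reidScheme G T).genLaw s n).support) :
    ∃ keys ∈ (E.keyLaw s l).support, ∃ ex ∈ (iid (E.exampleLaw keys l) n).support,
      o = outputOf l n keys ex := by
  rw [E.genLaw_reidScheme n hG hA] at ho
  simp only [PMF.mem_support_bind_iff, PMF.mem_support_map_iff] at ho
  obtain ⟨keys, hk, ex, hex, rfl⟩ := ho
  exact ⟨keys, hk, ex, hex, rfl⟩

/-- Replacing an entry past the end changes nothing; completeness and soundness thus become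
statements about one family of laws. -/
theorem game_sample_eq {G T : RandAlg} {A : Alg} {s l : ℕ} (n : ℕ)
    (hG : ∀ x, G.run noOracle x = E.reidGenKernel A x) (hA : A.out noOracle (unary s) = unary l)
    (L : Learner) : (E.reidScheme G T).game L s n ReidScheme.sample =
      (E.reidScheme G T).game L s n (ReidScheme.sampleWithout n) := by
  refine bind_congr_support _ fun o ho => ?_
  obtain ⟨keys, _, ex, hex, rfl⟩ := E.mem_support_genLaw hG hA ho
  have : (sampleOf keys ex).length ≤ n := by
    rw [sampleOf, List.length_map, length_of_mem_support_iid hex]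
  rw [ReidScheme.sampleWithout, sample_outputOf, List.set_eq_of_length_le this]

/-- The verdict in terms of the tests. -/
theorem accused_of_accuses {P Q : Polynomial ℕ} {h : Data → Bool} {keys : Data} {l n : ℕ}
    {tests : List ((List Bool × List Bool) × Bool)} {ms : List (List Bool)} (hd : depth Q n ≤ l)
    (ht : tests ∈ (E.testsLaw P Q h keys l n).support) (hms : ms ∈ (iid (coins l) n).support) :
    (∀ i, ReidScheme.Accuses (verdictData (unary (l - depth Q n)) (testsData tests) (ofLists ms)) i →
      ∃ m, ms[i]? = some m ∧ accused (l - depth Q n) tests m) ∧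
    ((∀ i < n, ¬ ReidScheme.Accuses (verdictData (unary (l - depth Q n)) (testsData tests)
      (ofLists ms)) i) → ∀ m ∈ ms, ¬ accused (l - depth Q n) tests m) := by
  have hacc : ∀ m ∈ ms, ((accusedData (unary (l - depth Q n)) (testsData tests)
      (ofBits m)).toBool = true ↔ accused (l - depth Q n) tests m) := by
    intro m hm
    have hl := length_of_mem_support_coins (mem_support_of_mem_support_iid hms m hm)
    have hlen : (m.drop (l - depth Q n)).length = depth Q n := by
      rw [List.length_drop, hl]; omega
    rw [toBool_accusedData, length_unary]
    intro e he
    obtain ⟨v, _, _, hj⟩ := mem_consecutive_cells (E.mem_consecutive_of_mem_tests ht e he)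
    rw [length_unary, hlen, hj, length_msgBits, length_msgBits]
    exact ⟨rfl, rfl⟩
  constructor
  · intro i hi
    obtain ⟨d, hd, hacd⟩ := accusedData_of_accuses hi
    rw [toList_ofLists, List.getElem?_map, Option.map_eq_some_iff] at hd
    obtain ⟨m, hm, rfl⟩ := hd
    exact ⟨m, hm, (hacc m (List.mem_of_getElem? hm)).1 hacd⟩
  · intro hno m hm hma
    have hlen : (ofLists ms).toList.length = n := by
      rw [toList_ofLists, List.length_map, length_of_mem_support_iid hms]
    have := accusedData_of_not_accuses (by rw [hlen]; exact hno) (ofBits m)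
      (by rw [toList_ofLists]; exact List.mem_map_of_mem hm)
    rw [(hacc m hm).2 hma] at this
    cases this

/-- The scheme traces, if the polynomial `P` dominates `1 / γ` and `1 / ξ`. -/
theorem isFor_reidScheme {ℓ k : ℕ → ℕ} {G T : RandAlg} {A : Alg} {P Q : Polynomial ℕ}
    {γ ξ : ℕ → ℝ} (hG : ∀ x, G.run noOracle x = E.reidGenKernel A x)
    (hA : ∀ s, A.out noOracle (unary s) = unary (ℓ s))
    (hT : ∀ O x, T.run O x = E.traceKernel P Q O x)
    (hN : Negligible fun s => 1 / (2 : ℝ) ^ ℓ s) (hkE : E.InstancesFit ℓ k)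
    (hsec : E.StaticallySingleChallengeSecure ℓ) (hQ : Q = 12 * (.X + 1) * P)
    (hγ : ∀ n, 1 ≤ n → 1 ≤ P.eval n * γ n) (hξ : ∀ n, 1 ≤ n → 1 ≤ P.eval n * ξ n) :
    (E.reidScheme G T).IsFor (E.encThresh ℓ k) (fun n => 1 / 2 - γ n) ξ := by
  have hξ' : ∀ n, 1 ≤ n → 1 / ((P.eval n : ℕ) : ℝ) ≤ ξ n := by
    intro n hn
    have h := hξ n hn
    have hP0 : 0 < P.eval n := Nat.pos_of_ne_zero fun h0 => by rw [h0] at h; norm_num at h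
    rw [div_le_iff₀ (by exact_mod_cast hP0), mul_comm]
    exact h
  have hdist : ∀ s, ∀ keys ∈ (E.keyLaw s (ℓ s)).support,
      (E.messageDist (ℓ s) keys).support ⊆ {x | x.size ≤ k s} := by
    intro s keys hk x hx
    simp only [messageDist, PMF.mem_support_bind_iff, PMF.mem_support_map_iff] at hx
    obtain ⟨m, hm, c, hc, rfl⟩ := hx
    have hl := length_of_mem_support_coins hm
    have := hkE s keys hk
    rw [← hl] at this
    exact this (msgOf m) c (by rw [encodeMsg_msgOf]; exact hc)
  refine ⟨?_, ?_, ?_, ?_, ?_, ?_⟩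
  · intro s n o ho
    obtain ⟨keys, hk, ex, hex, rfl⟩ := E.mem_support_genLaw hG (hA s) ho
    rw [key_outputOf]
    rw [keyLaw, RandAlg.run, PMF.mem_support_map_iff] at hk
    obtain ⟨r, -, rfl⟩ := hk
    refine ⟨r, 2 ^ (ℓ s - 1) + 1, ⟨Nat.le_add_left _ _, ?_⟩, ?_⟩
    · have := Nat.pow_le_pow_right (n := 2) (by norm_num) (Nat.sub_le (ℓ s) 1)
      omega
    · simp only [reidScheme, fst_cons, snd_cons, length_unary]
  · intro s n o ho
    obtain ⟨keys, hk, ex, hex, rfl⟩ := E.mem_support_genLaw hG (hA s) ho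
    rw [key_outputOf]
    simp only [reidScheme, fst_cons, snd_cons, length_unary]
    exact hdist s keys hk
  · intro s n o ho
    obtain ⟨keys, hk, ex, hex, rfl⟩ := E.mem_support_genLaw hG (hA s) ho
    rw [junk_outputOf]
    refine ⟨?_, rfl⟩
    -- The junk instance `nil` has the least possible size 1, so it is an instance as soon as there
    -- is any, and honest encryptions are.
    obtain ⟨x, hx⟩ := (E.messageDist (ℓ s) keys).support_nonempty
    have h₁ := hdist s keys hk hx
    have h₂ := size_pos x
    exact h₂.trans_le h₁
  · intro s n
    rw [E.genLaw_reidScheme n hG (hA s)]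
    simp only [PMF.map_bind, PMF.map_comp, Function.comp_def, key_outputOf, junk_outputOf,
      sample_outputOf, PMF.bind_bind, PMF.bind_map, PMF.bind_const]
    refine bind_congr_support _ fun keys hk => ?_
    have hd : (E.reidScheme G T).dist (.cons keys (unary (ℓ s))) =
        (E.exampleLaw keys (ℓ s)).map fun e => .cons keys.snd e.2 := by
      simp only [reidScheme, fst_cons, snd_cons, length_unary, messageDist, exampleLaw,
        PMF.map_bind, PMF.map_comp, Function.comp_def]
    rw [hd, iid_map, PMF.map_comp]
    refine map_congr_support _ fun ex hex => ?_
    simp only [Function.comp_apply, sampleOf, labeled, List.map_map]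
    congr 2
    refine List.map_congr_left fun e he => ?_
    have hes := mem_support_of_mem_support_iid hex e he
    simp only [exampleLaw, PMF.mem_support_bind_iff, PMF.mem_support_map_iff] at hes
    obtain ⟨m, hm, c, hc, rfl⟩ := hes
    have hl := length_of_mem_support_coins hm
    have := E.thresh_eq_label (s := s) (m := m) (by rw [hl]; exact hk) hc
    rw [hl] at this
    simp only [Function.comp_apply, reidScheme, fst_cons, snd_cons, length_unary, this]
  · rintro L n ⟨b, hb⟩ hn
    filter_upwards [E.eventually_trace_le hN hsec hγ hQ L b] with s ⟨hl, h⟩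
    obtain ⟨hd, h₁, -⟩ := h (n s) (hn s) (hb s)
    refine le_trans ?_ (h₁.trans (hξ' _ (hn s)))
    rw [E.game_sample_eq (n s) hG (hA s) L, E.game_reidScheme (n s) (n s) hG (hA s) hT hl, prob_map]
    refine prob_mono _ fun z hz hmem => ?_
    obtain ⟨herr, hno⟩ := hmem
    have hsupp := mem_support_traceLaw E hz
    refine ⟨?_, (E.accused_of_accuses hd hsupp.2.2 hsupp.1).2 hno⟩
    simpa only [reidScheme, fst_cons, snd_cons, length_unary] using herr
  · rintro L n ⟨b, hb⟩ hn
    filter_upwards [E.eventually_trace_le hN hsec hγ hQ L b] with s ⟨hl, h⟩ u hu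
    obtain ⟨hd, -, h₁⟩ := h (n s) (hn s) (hb s)
    refine le_trans ?_ ((h₁ u hu).trans (hξ' _ (hn s)))
    rw [E.game_reidScheme (n s) u hG (hA s) hT hl, prob_map]
    refine prob_mono _ fun z hz hmem => ?_
    have hsupp := mem_support_traceLaw E hz
    exact (E.accused_of_accuses hd hsupp.2.2 hsupp.1).1 u hmem

end ORE

end PrivLearn

namespace PrivLearn

open Data Filter

namespace ReidScheme

/-! ### Reidentification contradicts privacy -/

variable {R : ReidScheme} {C : ConceptClass} {α ξ : ℕ → ℝ}

/-- Read off from the support of the right-hand side of `sample_iid`. -/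
theorem IsFor.sample_mem (hR : R.IsFor C α ξ) {s n : ℕ} {o : Data}
    (ho : o ∈ (R.genLaw s n).support) :
    (sample o).length = n ∧ ∀ e ∈ sample o, e.1 ∈ C.inst s := by
  have h : (key o, junk o, sample o) ∈
      ((R.genLaw s n).map fun o => (key o, junk o, sample o)).support :=
    (PMF.mem_support_map_iff _ _ _).2 ⟨o, ho, rfl⟩
  rw [hR.sample_iid] at h
  simp only [PMF.mem_support_bind_iff, PMF.mem_support_map_iff, Prod.mk.injEq] at h
  obtain ⟨_, ⟨o', ho', rfl⟩, xs, hxs, h₁, -, h₂⟩ := h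
  rw [← h₂]
  refine ⟨by rw [labeled, List.length_map, length_of_mem_support_iid hxs], fun e he => ?_⟩
  rw [labeled, List.mem_map] at he
  obtain ⟨x, hx, rfl⟩ := he
  exact hR.dist_support s n o' ho' (mem_support_of_mem_support_iid hxs x hx)

theorem prob_game (R : ReidScheme) (L : Learner) (s n : ℕ) (S : Data → List (Data × Bool))
    (T : Set (Data × (Data → Bool) × Data)) : prob (R.game L s n S) T =
      expect (R.genLaw s n) fun o => expect (L.hyp s (S o)) fun h =>
        prob (R.trace.run h (state o)) {z | (key o, h, z) ∈ T} := by
  rw [game, prob_bind]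
  simp only [prob_bind, prob_map]
  rfl

/-- An accurate learner is accurate on the samples of the scheme. -/
theorem IsFor.le_prob_accurate (hR : R.IsFor C α ξ) {L : Learner} {s n : ℕ} {a β : ℝ}
    (hL : L.IsPAC C s n a β) : 1 - β ≤ prob (R.game L s n sample)
      {w | genError (R.dist w.1) (R.concept w.1) w.2.1 ≤ a} := by
  have hb : ∀ v : Data × (Data × Bool) × List (Data × Bool), |prob (L.hyp s v.2.2)
      {h | genError (R.dist v.1) (R.concept v.1) h ≤ a}| ≤ 1 := fun _ => abs_prob_le _ _
  have h₁ : prob (R.game L s n sample)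
      {w | genError (R.dist w.1) (R.concept w.1) w.2.1 ≤ a} =
      expect ((R.genLaw s n).map fun o => (key o, junk o, sample o)) fun v =>
        prob (L.hyp s v.2.2) {h | genError (R.dist v.1) (R.concept v.1) h ≤ a} := by
    rw [prob_game, expect_map _ _ hb]
    congr 1
    ext1 o
    rw [prob_eq_expect]
    congr 1
    ext1 h
    rw [prob_eq_expect]
    exact expect_const _ (ind (genError (R.dist (key o)) (R.concept (key o)) h ≤ a))
  rw [h₁, hR.sample_iid, PMF.bind_map, expect_bind _ _ hb]
  -- Given key and junk example, the sample is i.i.d. from the distribution and labeled by the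
  -- concept, so accuracy holds for each value of the key and hence on average.
  refine le_expect _ (fun _ => abs_expect_le _ hb) fun o ho => ?_
  rw [Function.comp_apply, expect_map _ _ hb]
  have h := hL _ (hR.concept_mem s n o ho) _ (hR.dist_support s n o ho)
  rw [prob_bind] at h
  exact h

/-- A private learner hides the contribution of each example from the tracing algorithm. -/
theorem IsFor.prob_accuses_le (hR : R.IsFor C α ξ) {L : Learner} {s n : ℕ} {ε δ : ℝ}
    (hL : L.IsDP C s n ε δ) {i : ℕ} (hi : i < n) :
    prob (R.game L s n sample) {w | Accuses w.2.2 i} ≤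
      Real.exp ε * prob (R.game L s n (sampleWithout i)) {w | Accuses w.2.2 i} + δ := by
  -- For fixed coin tosses of the tracer, the accusation of `i` is an event about the hypothesis
  -- alone, to which the definition of privacy applies; the tosses are averaged out afterwards.
  have hrun : ∀ (o : Data) (S : List (Data × Bool)),
      expect (L.hyp s S) (fun h => prob (R.trace.run h (state o)) {z | Accuses z i}) =
      expect (PMF.uniformOfFintype (Fin (R.trace.coins.eval (state o).size) → Bool)) fun r =>
        prob (L.hyp s S) {h | Accuses (R.trace.onCoins h (state o) r) i} := by
    intro o S
    simp only [RandAlg.run, prob_map]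
    simp only [prob_eq_expect]
    exact expect_comm _ _ fun _ _ => abs_ind_le _
  have hδ : ∀ {β : Type} (p : PMF β) (f : β → ℝ), (∀ b, |f b| ≤ 1) →
      Real.exp ε * expect p f + δ = expect p fun b => Real.exp ε * f b + δ := by
    intro β p f hf
    rw [expect_add (C := Real.exp ε * 1) _ (fun b => by
      rw [abs_mul, abs_of_pos (Real.exp_pos ε)]
      exact mul_le_mul_of_nonneg_left (hf b) (Real.exp_pos ε).le) fun _ => le_rfl,
      expect_const, expect_const_mul]
  have hbd : ∀ f : ℝ, |f| ≤ 1 → |Real.exp ε * f + δ| ≤ Real.exp ε + |δ| := fun f hf => by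
    refine (abs_add_le _ _).trans (add_le_add ?_ le_rfl)
    rw [abs_mul, abs_of_pos (Real.exp_pos ε)]
    exact mul_le_of_le_one_right (Real.exp_pos ε).le hf
  rw [prob_game, prob_game]
  simp only [Set.mem_ofPred_eq]
  rw [hδ _ _ fun _ => abs_expect_le _ fun _ => abs_prob_le _ _]
  refine expect_mono _ (fun _ => abs_expect_le _ fun _ => abs_prob_le _ _)
    (fun _ => hbd _ (abs_expect_le _ fun _ => abs_prob_le _ _)) fun o ho => ?_
  rw [hrun, hrun, hδ _ _ fun _ => abs_prob_le _ _]
  refine expect_mono _ (fun _ => abs_prob_le _ _) (fun _ => hbd _ (abs_prob_le _ _)) fun r _ => ?_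
  obtain ⟨hlen, hmem⟩ := hR.sample_mem ho
  exact (hL (sample o) hlen hmem i (junk o) hi (hR.junk_mem s n o ho).1 _).1

/-- Concept classes with an example reidentification scheme have no private learners. -/
theorem IsFor.not_exists_private (hR : R.IsFor C α ξ) {n : ℕ → ℕ} (hn : PolyBounded n)
    (hn₁ : ∀ s, 1 ≤ n s) {β ε δ : ℕ → ℝ} (h : ∃ᶠ s in atTop,
      δ s < (1 - β s - ξ (n s)) / (n s : ℝ) - Real.exp (ε s) * ξ (n s)) :
    ¬ ∃ L : Learner, (∀ s, L.IsDP C s (n s) (ε s) (δ s)) ∧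
      ∀ s, L.IsPAC C s (n s) (α (n s)) (β s) := by
  rintro ⟨L, hDP, hPAC⟩
  obtain ⟨s, hs, hcomp, hsound⟩ := (h.and_eventually
    ((hR.complete L n hn hn₁).and (hR.sound L n hn hn₁))).exists
  have hn0 : (0 : ℝ) < n s := by exact_mod_cast hn₁ s
  have h₁ := hR.le_prob_accurate (hPAC s)
  have h₂ : prob (R.game L s (n s) sample)
      {w | genError (R.dist w.1) (R.concept w.1) w.2.1 ≤ α (n s)} ≤ ξ (n s) +
      prob (R.game L s (n s) sample) {w | ∃ i < n s, Accuses w.2.2 i} := by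
    -- An accurate hypothesis either leads to an accusation or is a failure of completeness.
    refine (prob_mono _ fun w _ hw => ?_).trans ((prob_union_le _ _ _).trans
      (add_le_add_left hcomp _))
    by_cases hacc : ∃ i < n s, Accuses w.2.2 i
    · exact Or.inr hacc
    · exact Or.inl ⟨hw, fun i hi h' => hacc ⟨i, hi, h'⟩⟩
  have hunion : ∀ m : ℕ, prob (R.game L s (n s) sample) {w | ∃ i < m, Accuses w.2.2 i} ≤
      ∑ i ∈ Finset.range m, prob (R.game L s (n s) sample) {w | Accuses w.2.2 i} := by
    intro m
    induction m with
    | zero => simp [prob_eq_expect, ind, expect_const]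
    | succ m ih =>
      rw [Finset.sum_range_succ]
      refine (prob_mono _ fun w _ hw => ?_).trans ((prob_union_le _ _ _).trans
        (add_le_add_left ih _))
      obtain ⟨i, hi, hacc⟩ := hw
      rcases Nat.lt_succ_iff_lt_or_eq.1 hi with hi | rfl
      · exact Or.inl ⟨i, hi, hacc⟩
      · exact Or.inr hacc
  have hsum : ∑ i ∈ Finset.range (n s), prob (R.game L s (n s) sample) {w | Accuses w.2.2 i} ≤
      n s * (Real.exp (ε s) * ξ (n s) + δ s) := by
    refine (Finset.sum_le_card_nsmul _ _ _ fun i hi => ?_).trans_eq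
      (by rw [Finset.card_range, nsmul_eq_mul])
    have hi := Finset.mem_range.1 hi
    refine (hR.prob_accuses_le (hDP s) hi).trans ?_
    have := mul_le_mul_of_nonneg_left (hsound i hi) (Real.exp_pos (ε s)).le
    linarith
  have h₃ : 1 - β s - ξ (n s) ≤ n s * (Real.exp (ε s) * ξ (n s) + δ s) := by
    linarith [hunion (n s)]
  have h₄ : (1 - β s - ξ (n s)) / (n s : ℝ) ≤ Real.exp (ε s) * ξ (n s) + δ s := by
    rw [div_le_iff₀ hn0]
    linarith
  linarith

end ReidScheme

/-- Encrypted thresholds have an efficient example reidentification scheme. -/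
theorem ORE.exists_isFor (E : ORE) {ℓ k : ℕ → ℕ} (hℓ : UnaryComputable ℓ)
    (hN : Negligible fun s => 1 / (2 : ℝ) ^ ℓ s) (hkE : E.InstancesFit ℓ k)
    (hsec : E.StaticallySingleChallengeSecure ℓ) {γ ξ : ℕ → ℝ} (hγ : Noticeable γ)
    (hξ : Noticeable ξ) :
    ∃ R : ReidScheme, R.IsFor (E.encThresh ℓ k) (fun n => 1 / 2 - γ n) ξ := by
  obtain ⟨A, hA⟩ := hℓ
  obtain ⟨P₁, h₁⟩ := hγ.exists_polynomial
  obtain ⟨P₂, h₂⟩ := hξ.exists_polynomial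
  obtain ⟨G, hG⟩ := Samplable.exists_alg fun _ x => E.reidGenKernel A x
  obtain ⟨T, hT⟩ := Samplable.exists_alg _
    (h := E.samplable_traceKernel (P₁ + P₂) (12 * (Polynomial.X + 1) * (P₁ + P₂)))
  -- The sum of the two polynomials dominates both `1/γ` and `1/ξ`, because neither summand is
  -- negative.
  refine ⟨E.reidScheme G T, E.isFor_reidScheme (hG noOracle) hA hT hN hkE hsec rfl
    (fun n hn => ?_) fun n hn => ?_⟩
  · have := mul_nonneg (Nat.cast_nonneg (α := ℝ) (P₂.eval n)) (hγ.1 n hn).le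
    rw [Polynomial.eval_add, Nat.cast_add, add_mul]
    linarith [h₁ n hn]
  · have := mul_nonneg (Nat.cast_nonneg (α := ℝ) (P₁.eval n)) (hξ.1 n hn).le
    rw [Polynomial.eval_add, Nat.cast_add, add_mul]
    linarith [h₂ n hn]

end PrivLearn

end

theorem mainTheorem1 (E : PrivLearn.ORE) (ℓ k : ℕ → ℕ)
    (hℓ : PrivLearn.UnaryComputable ℓ)
    (hN : PrivLearn.Negligible fun s => 1 / (2 : ℝ) ^ ℓ s)
    (hk : PrivLearn.PolyBounded k) (hkE : E.InstancesFit ℓ k)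
    (hsec : E.StaticallySingleChallengeSecure ℓ)
    (γ ξ : ℕ → ℝ) (hγ : PrivLearn.Noticeable γ) (hξ : PrivLearn.Noticeable ξ) :
    (∃ R : PrivLearn.ReidScheme,
      R.IsFor (E.encThresh ℓ k) (fun n => 1 / 2 - γ n) ξ) ∧
    (∀ n : ℕ → ℕ, PrivLearn.PolyBounded n → (∀ s, 1 ≤ n s) →
      ∀ β ε δ : ℕ → ℝ,
        (∃ᶠ s in Filter.atTop,
          δ s < (1 - β s - ξ (n s)) / (n s : ℝ) - Real.exp (ε s) * ξ (n s)) →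
        ¬ ∃ L : PrivLearn.Learner,
          (∀ s, L.IsDP (E.encThresh ℓ k) s (n s) (ε s) (δ s)) ∧
          (∀ s, L.IsPAC (E.encThresh ℓ k) s (n s) (1 / 2 - γ (n s)) (β s))) := by
  obtain ⟨R, hR⟩ := E.exists_isFor hℓ hN hkE hsec hγ hξ
  exact ⟨⟨R, hR⟩, fun n hn hn₁ β ε δ h => hR.not_exists_private hn hn₁ h⟩
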